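/- **Setting.** Let $\Lambda=[0,L]^D\cap\mathbb Z^D$ with $D,L\ge 1$, let $N=(L+1)^D$, and measure distances in $\Lambda$ by the Manhattan distance (with open or with periodic boundary condition). Let $c_i,c_i^\dagger$ ($i\in\Lambda$) be the fermionic annihilation and creation operators on the $2^N$-dimensional Fock space. $\|\cdot\|$ denotes the operator norm, and $D(\rho,\sigma)=\frac12\operatorname{Tr}\sqrt{(\rho-\sigma)^\dagger(\rho-\sigma)}$ the trace distance. Consider $$H=\sum_{i,j\in\Lambda}M_{ij}\,c_i^\dagger c_j+\varepsilon\sum_j h_j,\qquad \|h_j\|\le 1,$$ where $\varepsilon\in\mathbb R$, the sum over $j$ is finite, and for some $\Delta>0$ and integers $r_0,l\ge1$: * $M$ is a Hermitian matrix with $M\succ\Delta$; $M_{ij}\ne0$ only if $i,j$ are at distance at most $1$; each site appears in at most $l$ of the terms $c_i^\dagger c_j$ with $M_{ij}\neq0$; * $\sum_jh_j$ is Hermitian, and each $h_j$ is a linear combination of products of an even number of operators $c_i,c_i^\dagger$ with $i$ in a set $S_j\subseteq\Lambda$ of diameter at most $r_0$; each site belongs to at most $l$ of the sets $S_j$. Let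 $f:\mathbb R\to\mathbb C$ be a measurable filter function with $\hat f(\nu)=\int_{\mathbb R} f(t)e^{i\nu t}\,dt$ such that, for some constants $C_1,C_2,\alpha>0$, $$\hat f(\nu)=1\ \text{ for }\nu\in[-\|M\|,-\Delta],\qquad \hat f(\nu)=0\ \text{ for }\nu>0,\qquad |f(t)|\le C_1\|M\|\exp\!\big(-C_2|t/\Delta|^{1/\alpha}\big)\ \text{ for } t\in\mathbb R .$$ For the coupling operators $\{A_a\}=\{c_i^\dagger,c_i\}_{i\in\Lambda}$ put $K_a=\int_{\mathbb R} f(t)e^{iHt}A_ae^{-iHt}\,dt$ and $$\mathcal L(\rho)=\sum_a\Big(K_a\rho K_a^\dagger-\tfrac12\{K_a^\dagger K_a,\rho\}\Big).$$ For a ground state $\sigma=|\psi_0\rangle\langle\psi_0|$ of $H$ let $$\tau_{\rm mix}(\eta)=\min\{t\ge0:\ D(e^{t\mathcal L}\rho_0,\sigma)\le\eta\ \text{ for all initial states }\rho_0\},$$ where the initial states are either all density matrices, or all density matrices commuting with the fermion parity. **Theorem.** There is $\varepsilon^*>0$, depending only on $D,r_0,l,\Delta,C_1,C_2,\alpha$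 and on upper bounds $m\ge\max_{i,j}|M_{ij}|$ and $\mu\ge\|M\|$ (so not on $L$, $N$), such that for $|\varepsilon|<\varepsilon^*$ and every ground state of $H$ the minimum defining $\tau_{\rm mix}(\eta)$ exists for all $\eta\in(0,1)$, and $$\tau_{\rm mix}(\eta)=\Theta(\log(N/\eta)).$$ That is, there is a constant $C>0$, and for each $\eta_0\in(0,1)$ a constant $c>0$, depending only on the same parameters (and $c$ on $\eta_0$), such that $c\log(N/\eta)\le\tau_{\rm mix}(\eta)\le C\log(N/\eta)$ for all $\eta\in(0,\eta_0]$. Moreover, $\varepsilon^*$ can be chosen with $$\varepsilon^*=\widetilde{\mathcal O}\big((m\,r_0\,l/\Delta)^{-\Theta(D)}\mu^{-1}\big),$$ that is, $\varepsilon^*\le A\,g\,(1+|\log g|)^{\kappa}$ with $g=(m r_0l/\Delta)^{-p(D)}\mu^{-1}$, where $aD\le p(D)\le bD$ for absolute constants $a,b>0$, and $A,\kappa$ depend only on $D,C_1,C_2,\alpha$. -/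

import Mathlib

open scoped Matrix.Norms.L2Operator MatrixOrder ComplexOrder Matrix

noncomputable section

namespace FermionMixing

/-! ### Fock space, creation and annihilation operators

The Fock space over a finite linearly ordered set `V` of sites has the orthonormal
occupation-number basis indexed by the sets of occupied sites; operators are matrices in this
basis, and their norm is the operator norm induced by the Hilbert space norm. -/

/-- Operators on the fermionic Fock space (of dimension `2 ^ |V|`) over `V`. -/
abbrev FockOp (V : Type) : Type := Matrix (Finset V) (Finset V) ℂ

section Fock

variable {V : Type} [LinearOrder V]

/-- The annihilation operator `c_i` (Jordan--Wigner form): it sends the basis vector of the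
occupied set `T ∋ i` to `(-1) ^ #{j ∈ T | j < i}` times that of `T \ {i}`, and the basis vectors
of the sets not containing `i` to `0`. -/
def annihilation (i : V) : FockOp V :=
  fun S T => if i ∈ T ∧ S = T.erase i then (-1) ^ (T.filter (fun j => j < i)).card else 0

/-- The creation operator `c_i†`. -/
def creation (i : V) : FockOp V := (annihilation i)ᴴ

/-- `ladder (i, true) = c_i†` and `ladder (i, false) = c_i`. -/
def ladder (a : V × Bool) : FockOp V := if a.2 then creation a.1 else annihilation a.1

/-- The fermion parity operator `(-1) ^ N̂`. -/
def parity : FockOp V := Matrix.diagonal fun S => (-1) ^ S.card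

variable [Fintype V]

/-- Parity-preserving operators acting on the set `S` of sites: linear combinations of products
of an even number of operators `c_i, c_i†` with `i ∈ S`. -/
def evenLocal (S : Finset V) : Submodule ℂ (FockOp V) :=
  Submodule.span ℂ {A | ∃ w : List (V × Bool),
    Even w.length ∧ (∀ a ∈ w, a.1 ∈ S) ∧ A = (w.map ladder).prod}

/-- `∑_{ij} M_{ij} c_i† c_j`. -/
def quadraticHamiltonian (M : Matrix V V ℂ) : FockOp V :=
  ∑ i, ∑ j, M i j • (creation i * annihilation j)

/-- `H = ∑_{ij} M_{ij} c_i† c_j + ε ∑_j h_j`. -/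
def hamiltonian {n : ℕ} (M : Matrix V V ℂ) (h : Fin n → FockOp V) (ε : ℝ) : FockOp V :=
  quadraticHamiltonian M + (ε : ℂ) • ∑ j, h j

/-- `ψ` is a normalized ground state of `H`: a unit eigenvector for the least eigenvalue. -/
def IsGroundState (H : FockOp V) (ψ : Finset V → ℂ) : Prop :=
  star ψ ⬝ᵥ ψ = 1 ∧
    ∃ E : ℝ, H *ᵥ ψ = (E : ℂ) • ψ ∧ (H - (E : ℂ) • (1 : FockOp V)).PosSemidef

/-- The rank-one projection `|ψ⟩⟨ψ|`. -/
def pureState (ψ : Finset V → ℂ) : FockOp V := Matrix.vecMulVec ψ (star ψ)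

/-! ### Jump operators and the Lindblad dynamics -/

/-- `f̂(ν) = ∫ f(t) e^{iνt} dt`, inverse to `f(t) = (2π)⁻¹ ∫ f̂(ν) e^{-iνt} dν`. -/
def filterHat (f : ℝ → ℂ) (ν : ℝ) : ℂ :=
  ∫ t : ℝ, f t * Complex.exp (Complex.I * (ν : ℂ) * (t : ℂ))

/-- The jump operator `K = ∫ f(t) e^{iHt} A e^{-iHt} dt` of the coupling operator `A`. -/
def jumpOp (f : ℝ → ℂ) (H A : FockOp V) : FockOp V :=
  ∫ t : ℝ, f t • (NormedSpace.exp ((Complex.I * (t : ℂ)) • H) * A *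
    NormedSpace.exp ((-(Complex.I * (t : ℂ))) • H))

/-- The dissipator `ρ ↦ K ρ K† - (K† K ρ + ρ K† K) / 2`. -/
def dissipator (K : FockOp V) : FockOp V →ₗ[ℂ] FockOp V :=
  LinearMap.mulLeft ℂ K ∘ₗ LinearMap.mulRight ℂ Kᴴ -
    (1 / 2 : ℂ) • (LinearMap.mulLeft ℂ (Kᴴ * K) + LinearMap.mulRight ℂ (Kᴴ * K))

/-- The Lindbladian without coherent term, with the coupling operators `{c_i†, c_i}`. -/
def lindbladian (f : ℝ → ℂ) (H : FockOp V) : FockOp V →L[ℂ] FockOp V :=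
  LinearMap.toContinuousLinearMap (∑ a : V × Bool, dissipator (jumpOp f H (ladder a)))

/-- The state `e^{t𝓛} ρ`. -/
def evolve (𝓛 : FockOp V →L[ℂ] FockOp V) (t : ℝ) (ρ : FockOp V) : FockOp V :=
  NormedSpace.exp ((t : ℂ) • 𝓛) ρ

/-! ### States, trace distance, mixing time -/

/-- `‖A‖₁ = Tr √(A† A)`. -/
def traceNorm (A : FockOp V) : ℝ := (Matrix.trace (CFC.sqrt (Aᴴ * A))).re

/-- `D(ρ, σ) = ‖ρ - σ‖₁ / 2`. -/
def traceDistance (ρ σ : FockOp V) : ℝ := traceNorm (ρ - σ) / 2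

variable (V) in
/-- All density matrices. -/
def densityMatrices : Set (FockOp V) := {ρ | ρ.PosSemidef ∧ ρ.trace = 1}

variable (V) in
/-- The density matrices of even parity, i.e. obeying the parity superselection rule. -/
def evenDensityMatrices : Set (FockOp V) := {ρ | ρ ∈ densityMatrices V ∧ Commute parity ρ}

/-- `τ` is the mixing time `min {t ≥ 0 | D(e^{t𝓛} ρ₀, σ) ≤ η for all initial states ρ₀ ∈ 𝒮}`;
in particular, the minimum exists. -/
def IsMixingTime (𝒮 : Set (FockOp V)) (𝓛 : FockOp V →L[ℂ] FockOp V) (σ : FockOp V)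
    (η τ : ℝ) : Prop :=
  IsLeast {t : ℝ | 0 ≤ t ∧ ∀ ρ₀ ∈ 𝒮, traceDistance (evolve 𝓛 t ρ₀) σ ≤ η} τ

/-- The conditions on the filter function `f`: `f̂ = 1` on `[-‖M‖, -Δ]`, `f̂ = 0` on `(0, ∞)`, and
`|f(t)| ≤ C₁ ‖M‖ exp(-C₂ |t/Δ|^{1/α})`. -/
structure IsFilter (M : Matrix V V ℂ) (Δ C₁ C₂ α : ℝ) (f : ℝ → ℂ) : Prop where
  measurable : MeasureTheory.AEStronglyMeasurable f MeasureTheory.volume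
  hat_eq_one : ∀ ν ∈ Set.Icc (-‖M‖) (-Δ), filterHat f ν = 1
  hat_eq_zero : ∀ ν : ℝ, 0 < ν → filterHat f ν = 0
  decay : ∀ t : ℝ, ‖f t‖ ≤ C₁ * ‖M‖ * Real.exp (-C₂ * |t / Δ| ^ (1 / α))

end Fock

/-! ### The lattice and geometric locality -/

/-- The lattice `[0, L]^D`, with `(L + 1)^D` sites. The lexicographic order only serves to fix the
signs of the creation and annihilation operators. -/
abbrev LatticeSite (D L : ℕ) : Type := Lex (Fin D → Fin (L + 1))

/-- Manhattan distance on `[0, L]^D`, with periodic or with open boundary condition. -/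
def manhattan (periodic : Bool) {D L : ℕ} (x y : LatticeSite D L) : ℕ :=
  ∑ k : Fin D,
    let d : ℕ := (((ofLex x k : ℕ) : ℤ) - ((ofLex y k : ℕ) : ℤ)).natAbs
    if periodic then min d (L + 1 - d) else d

/-- `∑ M_{ij} c_i† c_j` is `(1, l)`-geometrically local: the non-zero terms join sites at distance
at most `1`, and each site appears in at most `l` of them. -/
structure IsLocalHopping (periodic : Bool) {D L : ℕ} (l : ℕ)
    (M : Matrix (LatticeSite D L) (LatticeSite D L) ℂ) : Prop where
  range : ∀ i j, M i j ≠ 0 → manhattan periodic i j ≤ 1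
  degree : ∀ k, {p : LatticeSite D L × LatticeSite D L |
    M p.1 p.2 ≠ 0 ∧ (k = p.1 ∨ k = p.2)}.ncard ≤ l

/-- `∑_j h_j` is an `(r₀, l)`-geometrically local, parity-preserving Hamiltonian with
`‖h_j‖ ≤ 1`: `h_j` acts on a set of sites of Manhattan diameter at most `r₀`, and each site is in
at most `l` of these sets. -/
structure IsLocalPerturbation (periodic : Bool) {D L n : ℕ} (r₀ l : ℕ)
    (h : Fin n → FockOp (LatticeSite D L)) : Prop where
  hermitian : (∑ j, h j).IsHermitian
  norm_le : ∀ j, ‖h j‖ ≤ 1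
  isLocal : ∃ S : Fin n → Finset (LatticeSite D L),
    (∀ j, h j ∈ evenLocal (S j)) ∧
    (∀ j, ∀ x ∈ S j, ∀ y ∈ S j, manhattan periodic x y ≤ r₀) ∧
    (∀ k, {j | k ∈ S j}.ncard ≤ l)

end FermionMixing

end

/-! The argument runs in the Heisenberg picture and measures an observable `O` by its gradient: the
family of commutators of `O` with all `c_i`, `c_i†`, in the supremum norm over the labels.

For `ε = 0` the operator `c_i` evolves with frequencies `-λ` and `c_i†` with `+λ`, where `λ ∈ [Δ,
‖M‖]` runs over eigenvalues of `M`. The filter is 1 on the former and 0 on the latter, so the jump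
operators are exactly `c_i` and `0`, and every mode decays independently. Commuting `c_b` past the
generator gives the generator with reversed sign of the jump terms, acting on `[c_b, O]`, plus a
damping `-1/2`. The sign reversal does not spoil contractivity (`norm_add_heis_le`), so the gradient
decays exponentially.

For small `ε` the jump operators stay odd, are quasi-local by a Lieb-Robinson bound
(`IsLocalModel.norm_acomm_heisTime_le`) and are close to the free ones (`IsLocalModel.jumpBounds`),
with closeness `δ → 0` uniformly in the system size. The errors in the gradient equation are built
from commutators of `O` with quasi-local operators, and these are bounded by the gradient with a
size-independent constant (`norm_commutator_le_grad`). Small `δ` leaves the rate `1/4`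
(`norm_grad_heisEvolve_le`). An operator with small gradient is close to a scalar, up to a factor of
order `N` (`exists_norm_sub_scalar_le`). The jump operators can only lower the energy, so they
annihilate the ground state, which is therefore stationary. Duality turns this into the distance
bound `4 N e^{-t/4}`, hence the upper bound on the mixing time.

The lower bound follows the excitation number `Q = ∑ K_a† K_a`, which vanishes in the ground state.
In the maximally mixed state its mean is at least `N/16`; the mean decays at most exponentially
(`expect_decayOp_ge`), and the variance stays of order `N` (`expect_heisEvolve_sq_le`). Comparing
means forces `e^{-Γt} ≲ η`. A Chebyshev argument for the overlap with the ground state forces `N ≲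
e^{2Γt}`. A start orthogonal to the ground state excludes very short times when `N` is bounded.
`exists_log_le` combines the three.

The theorem bounds `ε*` only from above, so the smallness threshold may simply be cut off at `g`. -/

noncomputable section

namespace FermionMixing

/-! ### Canonical anticommutation relations -/

section CAR

variable {V : Type} [LinearOrder V]

/-- The Jordan-Wigner sign `(-1) ^ #{j ∈ S | j < i}`. -/
def jwSign (i : V) (S : Finset V) : ℂ := (-1) ^ (S.filter (fun j => j < i)).card

lemma jwSign_insert {i j : V} {S : Finset V} (hj : j ∉ S) :
    jwSign i (insert j S) = if j < i then -jwSign i S else jwSign i S := by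
  unfold jwSign
  rw [Finset.filter_insert]
  split_ifs with h
  · rw [Finset.card_insert_of_notMem (by simp [hj])]; ring
  · rfl

lemma jwSign_mul_self (i : V) (S : Finset V) : jwSign i S * jwSign i S = 1 := by
  unfold jwSign
  rw [← mul_pow]; norm_num

lemma star_jwSign (i : V) (S : Finset V) : star (jwSign i S) = jwSign i S := by
  unfold jwSign; simp

lemma jwSign_erase_self (i : V) (S : Finset V) : jwSign i (S.erase i) = jwSign i S := by
  unfold jwSign
  congr 2
  ext j
  simp only [Finset.mem_filter, Finset.mem_erase]
  constructor
  · rintro ⟨⟨_, h⟩, h'⟩; exact ⟨h, h'⟩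
  · rintro ⟨h, h'⟩; exact ⟨⟨h'.ne, h⟩, h'⟩

/-- Determining the column from the row makes left multiplication by `c_i` a sum with a single term.
-/
lemma annihilation_apply (i : V) (S T : Finset V) :
    annihilation i S T = if i ∉ S ∧ T = insert i S then jwSign i S else 0 := by
  unfold annihilation
  by_cases h : i ∈ T ∧ S = T.erase i
  · obtain ⟨h1, rfl⟩ := h
    rw [if_pos ⟨h1, rfl⟩, if_pos ⟨by simp, by rw [Finset.insert_erase h1]⟩, jwSign_erase_self]
    rfl
  · rw [if_neg h, if_neg]
    rintro ⟨h1, rfl⟩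
    exact h ⟨by simp, by rw [Finset.erase_insert h1]⟩

variable [Fintype V]

lemma annihilation_mul_apply (i : V) (A : FockOp V) (S T : Finset V) :
    (annihilation i * A) S T = if i ∈ S then 0 else jwSign i S * A (insert i S) T := by
  rw [Matrix.mul_apply]
  simp only [annihilation_apply]
  split_ifs with h
  · simp [h]
  · simp [h]

lemma creation_mul_apply (i : V) (A : FockOp V) (S T : Finset V) :
    (creation i * A) S T = if i ∈ S then jwSign i S * A (S.erase i) T else 0 := by
  rw [Matrix.mul_apply]
  simp only [creation, Matrix.conjTranspose_apply, annihilation_apply]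
  split_ifs with h
  · rw [Finset.sum_eq_single (S.erase i)]
    · rw [if_pos ⟨by simp, (Finset.insert_erase h).symm⟩, star_jwSign, jwSign_erase_self]
    · intro U _ hU
      rw [if_neg, star_zero, zero_mul]
      rintro ⟨h1, h2⟩
      exact hU (by rw [h2, Finset.erase_insert h1])
    · simp
  · apply Finset.sum_eq_zero
    intro U _
    rw [if_neg, star_zero, zero_mul]
    rintro ⟨h1, h2⟩
    exact h (by rw [h2]; simp)

lemma annihilation_anticomm (i j : V) :
    annihilation i * annihilation j + annihilation j * annihilation i = 0 := by
  ext S T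
  rw [Matrix.add_apply, annihilation_mul_apply, annihilation_mul_apply, annihilation_apply,
    annihilation_apply]
  by_cases hi : i ∈ S <;> by_cases hj : j ∈ S
  · simp [hi, hj]
  · simp [hi, hj]
  · simp [hi, hj]
  · rcases lt_trichotomy i j with h | rfl | h
    · simp only [hi, hj, Finset.mem_insert, h.ne, h.ne', or_self, not_false_eq_true, true_and,
        if_false, jwSign_insert hi, jwSign_insert hj, h, h.not_gt, if_true,
        Finset.insert_comm i j S, Matrix.zero_apply]
      split_ifs <;> ring
    · simp
    · simp only [hi, hj, Finset.mem_insert, h.ne, h.ne', or_self, not_false_eq_true, true_and,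
        if_false, jwSign_insert hi, jwSign_insert hj, h, h.not_gt, if_true,
        Finset.insert_comm i j S, Matrix.zero_apply]
      split_ifs <;> ring

lemma creation_apply (i : V) (S T : Finset V) :
    creation i S T = if i ∈ S ∧ T = S.erase i then jwSign i S else 0 := by
  have := creation_mul_apply i (1 : FockOp V) S T
  rw [mul_one] at this
  rw [this, ite_and]
  simp [Matrix.one_apply, eq_comm]

lemma annihilation_creation_anticomm (i j : V) :
    annihilation i * creation j + creation j * annihilation i = if i = j then 1 else 0 := by
  ext S T
  rw [Matrix.add_apply, annihilation_mul_apply, creation_mul_apply, annihilation_apply,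
    creation_apply]
  rcases eq_or_ne i j with rfl | hij
  · by_cases hi : i ∈ S
    · simp only [hi, if_true, zero_add, Finset.notMem_erase, not_false_eq_true, true_and,
        Finset.insert_erase hi, jwSign_erase_self, Matrix.one_apply, eq_comm (a := T)]
      split_ifs <;> simp [jwSign_mul_self]
    · simp only [hi, if_false, add_zero, Finset.mem_insert_self, true_and,
        Finset.erase_insert hi, if_true, Matrix.one_apply, eq_comm (a := T), jwSign_insert hi,
        lt_self_iff_false]
      split_ifs <;> simp [jwSign_mul_self]
  · rw [if_neg hij, Matrix.zero_apply]
    by_cases hi : i ∈ S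
    · simp [hi, hij]
    · by_cases hj : j ∈ S
      · obtain ⟨U, hU, rfl⟩ : ∃ U, j ∉ U ∧ S = insert j U :=
          ⟨S.erase j, by simp, (Finset.insert_erase hj).symm⟩
        have hiU : i ∉ U := fun h => hi (by simp [h])
        have hji : j ∉ insert i U := by simp [hU, hij.symm]
        have hij' : i ∉ insert j U := hi
        simp only [hi, if_false, Finset.mem_insert, true_or, or_true, if_true, true_and,
          Finset.erase_insert hU, hiU, not_false_eq_true, Finset.insert_comm i j U,
          Finset.erase_insert hji, jwSign_insert hU, jwSign_insert hji, jwSign_insert hiU,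
          lt_self_iff_false]
        rcases lt_or_gt_of_ne hij with h | h
        · simp only [h, h.not_gt, if_true, if_false]
          split_ifs <;> ring
        · simp only [h, h.not_gt, if_true, if_false]
          split_ifs <;> ring
      · simp [hi, hj, hij.symm]

lemma creation_anticomm (i j : V) :
    creation i * creation j + creation j * creation i = 0 := by
  have := congrArg Matrix.conjTranspose (annihilation_anticomm j i)
  simpa [creation, Matrix.conjTranspose_mul] using this

/-- The label of the adjoint ladder operator. -/
def flip (a : V × Bool) : V × Bool := (a.1, !a.2)

lemma flip_flip (a : V × Bool) : flip (flip a) = a := by simp [flip]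

lemma star_ladder (a : V × Bool) : star (ladder a) = ladder (flip a) := by
  rcases a with ⟨i, b⟩
  cases b <;> simp [ladder, flip, creation, Matrix.star_eq_conjTranspose]

lemma ladder_anticomm (a b : V × Bool) :
    ladder a * ladder b + ladder b * ladder a = if a = flip b then 1 else 0 := by
  rcases a with ⟨i, x⟩
  rcases b with ⟨j, y⟩
  cases x <;> cases y <;> simp only [ladder, flip, Prod.mk.injEq, Bool.not_true, Bool.not_false,
    and_true, and_false, if_true, if_false, Bool.false_eq_true, Bool.true_eq_false,
    reduceCtorEq]
  · exact annihilation_anticomm i j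
  · exact annihilation_creation_anticomm i j
  · rw [add_comm, annihilation_creation_anticomm]; simp [eq_comm]
  · exact creation_anticomm i j

/-! ### Parity -/

lemma parity_mul_parity : (parity : FockOp V) * parity = 1 := by
  rw [parity, Matrix.diagonal_mul_diagonal, ← Matrix.diagonal_one]
  congr 1
  ext S
  rw [← mul_pow]; norm_num

lemma star_parity : star (parity : FockOp V) = parity := by
  rw [Matrix.star_eq_conjTranspose, parity, Matrix.diagonal_conjTranspose]
  congr 1
  ext S
  simp

lemma parity_mul_annihilation (i : V) :
    parity * annihilation i = -(annihilation i * parity) := by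
  ext S T
  rw [Matrix.neg_apply, parity, Matrix.diagonal_mul, Matrix.mul_diagonal, annihilation_apply]
  split_ifs with h
  · obtain ⟨h, rfl⟩ := h
    rw [Finset.card_insert_of_notMem h]; ring
  · simp

lemma parity_mul_ladder (a : V × Bool) : parity * ladder a = -(ladder a * parity) := by
  rcases a with ⟨i, b⟩
  cases b
  · simpa [ladder] using parity_mul_annihilation i
  · have := congrArg star (parity_mul_annihilation i)
    rw [star_neg, star_mul, star_mul, star_parity] at this
    simp only [ladder, creation, ← Matrix.star_eq_conjTranspose, if_true]
    rw [this, neg_neg]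

/-! ### Majorana operators -/

/-- The Majorana operators `c_i† + c_i` and `i (c_i† - c_i)`. -/
def majorana (a : V × Bool) : FockOp V :=
  if a.2 then ladder (a.1, true) + ladder (a.1, false)
  else Complex.I • (ladder (a.1, true) - ladder (a.1, false))

lemma star_majorana (a : V × Bool) : star (majorana a) = majorana a := by
  rcases a with ⟨i, b⟩
  cases b
  · simp only [majorana, if_false, Bool.false_eq_true, star_smul, star_sub, star_ladder, flip,
      Bool.not_true, Bool.not_false, Complex.star_def, Complex.conj_I]
    rw [neg_smul, ← smul_neg, neg_sub]
  · simp only [majorana, if_true, star_add, star_ladder, flip,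
      Bool.not_true, Bool.not_false]
    rw [add_comm]

lemma majorana_anticomm (a b : V × Bool) :
    majorana a * majorana b + majorana b * majorana a = if a = b then 2 else 0 := by
  rcases a with ⟨i, x⟩
  rcases b with ⟨j, y⟩
  have h1 := ladder_anticomm (i, false) (j, false)
  have h2 := ladder_anticomm (i, false) (j, true)
  have h3 := ladder_anticomm (i, true) (j, false)
  have h4 := ladder_anticomm (i, true) (j, true)
  simp only [flip, Prod.mk.injEq, Bool.not_true, Bool.not_false, and_true, and_false,
    if_false, Bool.false_eq_true, Bool.true_eq_false, reduceCtorEq] at h1 h2 h3 h4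
  rw [add_eq_zero_iff_eq_neg] at h1 h4
  rw [← eq_sub_iff_add_eq] at h2 h3
  cases x <;> cases y <;>
    simp only [majorana, Prod.mk.injEq, and_true, and_false, if_true, if_false,
      Bool.false_eq_true, Bool.true_eq_false, reduceCtorEq, smul_mul_assoc, mul_smul_comm,
      smul_smul, Complex.I_mul_I, mul_add, add_mul, mul_sub, sub_mul, h1, h2, h3, h4]
  · split_ifs
    · rw [← one_add_one_eq_two]
      match_scalars <;>
        first | ring1 | linear_combination (-2) * Complex.I_sq | linear_combination 2 * Complex.I_sq
    · module
  · module
  · module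
  · split_ifs
    · rw [← one_add_one_eq_two]; module
    · module

lemma majorana_sq (a : V × Bool) : majorana a * majorana a = 1 := by
  have := majorana_anticomm a a
  rw [if_pos rfl, ← two_smul ℂ, show (2 : FockOp V) = (2 : ℂ) • 1 by rw [two_smul, one_add_one_eq_two]] at this
  exact smul_right_injective _ (two_ne_zero) this

lemma majorana_anticomm_of_ne {a b : V × Bool} (h : a ≠ b) :
    majorana a * majorana b = -(majorana b * majorana a) := by
  have := majorana_anticomm a b
  rw [if_neg h] at this
  exact eq_neg_of_add_eq_zero_left this

lemma parity_mul_majorana (a : V × Bool) : parity * majorana a = -(majorana a * parity) := by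
  rcases a with ⟨i, b⟩
  cases b
  · simp [majorana, mul_sub, sub_mul, parity_mul_ladder]; module
  · simp [majorana, mul_add, add_mul, parity_mul_ladder]; module

lemma ladder_eq_majorana (a : V × Bool) :
    ladder a = (1 / 2 : ℂ) • majorana (a.1, true) +
      (if a.2 then -(Complex.I / 2) else Complex.I / 2) • majorana (a.1, false) := by
  rcases a with ⟨i, b⟩
  have hI : Complex.I / 2 * Complex.I = -(1 / 2 : ℂ) := by
    rw [div_mul_eq_mul_div, Complex.I_mul_I]; ring
  cases b
  · simp only [majorana, if_true, Bool.false_eq_true, if_false, smul_smul, hI]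
    module
  · simp only [majorana, if_true, Bool.false_eq_true, if_false, smul_smul, hI, neg_mul]
    module

lemma norm_majorana (a : V × Bool) : ‖(majorana a : FockOp V)‖ = 1 := by
  have h : ‖(majorana a : FockOp V)‖ * ‖(majorana a : FockOp V)‖ = 1 := by
    rw [← CStarRing.norm_star_mul_self, star_majorana, majorana_sq, CStarRing.norm_one]
  nlinarith [norm_nonneg (majorana a : FockOp V)]

lemma norm_ladder_le (a : V × Bool) : ‖(ladder a : FockOp V)‖ ≤ 1 := by
  rw [ladder_eq_majorana]
  refine (norm_add_le _ _).trans ?_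
  rw [norm_smul, norm_smul, norm_majorana, norm_majorana]
  split_ifs <;> norm_num

/-- The Majorana operators with labels in `s` generate this algebra. -/
abbrev majoranaAlg (s : Set (V × Bool)) : Subalgebra ℂ (FockOp V) :=
  Algebra.adjoin ℂ (majorana '' s)

lemma ladder_mem_majoranaAlg (a : V × Bool) : ladder a ∈ majoranaAlg (Set.univ : Set (V × Bool)) := by
  rw [ladder_eq_majorana]
  have h : ∀ b : V × Bool, majorana b ∈ majoranaAlg (Set.univ : Set (V × Bool)) := fun b =>
    Algebra.subset_adjoin ⟨b, trivial, rfl⟩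
  exact add_mem (Subalgebra.smul_mem _ (h _) _) (Subalgebra.smul_mem _ (h _) _)

lemma creation_mul_annihilation (i : V) :
    (creation i * annihilation i : FockOp V) =
      Matrix.diagonal fun S => if i ∈ S then (1 : ℂ) else 0 := by
  ext S T
  rw [creation_mul_apply, annihilation_apply, Matrix.diagonal_apply]
  by_cases h : i ∈ S
  · simp only [h, if_true, Finset.notMem_erase, not_false_eq_true, Finset.insert_erase h, true_and,
      jwSign_erase_self, eq_comm (a := T)]
    split_ifs <;> simp [jwSign_mul_self]
  · simp [h]

/-- The projection onto the basis vector of `T` is the product of the number operators `n_i` for `i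
∈ T` and of `1 - n_i` for `i ∉ T`. -/
lemma single_self_mem (A : Subalgebra ℂ (FockOp V)) (hA : ∀ a, ladder a ∈ A) (T : Finset V) :
    Matrix.single T T (1 : ℂ) ∈ A := by
  let B := A.comap (Matrix.diagonalAlgHom ℂ : (Finset V → ℂ) →ₐ[ℂ] FockOp V)
  have hn : ∀ i : V, (fun S : Finset V => if i ∈ S then (1 : ℂ) else 0) ∈ B := by
    intro i
    change Matrix.diagonal _ ∈ A
    rw [← creation_mul_annihilation]
    exact mul_mem (hA (i, true)) (hA (i, false))
  have hf : ∀ i : V, (if i ∈ T then (fun S : Finset V => if i ∈ S then (1 : ℂ) else 0)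
      else 1 - (fun S : Finset V => if i ∈ S then (1 : ℂ) else 0)) ∈ B := by
    intro i
    split_ifs
    · exact hn i
    · exact sub_mem (one_mem _) (hn i)
  have hp := Subalgebra.prod_mem B (t := Finset.univ) fun i _ => hf i
  have : (∏ i : V, (if i ∈ T then (fun S : Finset V => if i ∈ S then (1 : ℂ) else 0)
      else 1 - (fun S : Finset V => if i ∈ S then (1 : ℂ) else 0))) = Pi.single T 1 := by
    ext S
    rw [Finset.prod_apply]
    by_cases h : S = T
    · subst h
      rw [Pi.single_eq_same]
      apply Finset.prod_eq_one
      intro i _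
      split_ifs with h <;> simp [h]
    · rw [Pi.single_eq_of_ne h]
      obtain ⟨i, hi⟩ : ∃ i, ¬ (i ∈ S ↔ i ∈ T) := by
        by_contra hh
        push Not at hh
        exact h (Finset.ext hh)
      apply Finset.prod_eq_zero (Finset.mem_univ i)
      by_cases h1 : i ∈ T <;> by_cases h2 : i ∈ S <;> simp_all
  rw [this] at hp
  have h2 : Matrix.diagonal (Pi.single T (1 : ℂ)) ∈ A := hp
  rwa [Matrix.diagonal_single] at h2

/-- Ladder operators combined with the diagonal projections give the matrix units between `T` and
`insert i T`. Chaining these connects every basis vector with the vacuum, so all matrix units are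
reached. -/
lemma eq_top_of_ladder_mem (A : Subalgebra ℂ (FockOp V)) (hA : ∀ a, ladder a ∈ A) : A = ⊤ := by
  have hstep : ∀ (i : V) (T : Finset V), i ∉ T →
      Matrix.single T (insert i T) (1 : ℂ) = jwSign i T • (Matrix.single T T (1 : ℂ) * ladder (i, false)) := by
    intro i T hi
    ext S U
    simp only [ladder, Bool.false_eq_true, if_false, Matrix.smul_apply, smul_eq_mul]
    by_cases hS : S = T
    · subst hS
      rw [Matrix.single_mul_apply_same, annihilation_apply]
      simp only [hi, not_false_eq_true, true_and, one_mul, eq_comm (a := U)]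
      split_ifs with h
      · subst h; simp [jwSign_mul_self]
      · rw [Matrix.single_apply_of_ne]
        · simp
        · simp [h]
    · rw [Matrix.single_mul_apply_of_ne _ _ _ _ _ hS, Matrix.single_apply_of_ne]
      · simp
      · exact fun h => hS h.1.symm
  have hstep2 : ∀ (i : V) (T : Finset V), i ∉ T →
      Matrix.single (insert i T) T (1 : ℂ) = jwSign i T • (ladder (i, true) * Matrix.single T T (1 : ℂ)) := by
    intro i T hi
    have := congrArg star (hstep i T hi)
    rw [star_smul, star_mul, star_ladder, star_jwSign] at this
    simpa [Matrix.star_eq_conjTranspose, Matrix.conjTranspose_single, flip] using this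
  have h1 : ∀ T : Finset V, Matrix.single (∅ : Finset V) T (1 : ℂ) ∈ A ∧
      Matrix.single T (∅ : Finset V) (1 : ℂ) ∈ A := by
    intro T
    induction T using Finset.induction_on with
    | empty => exact ⟨single_self_mem A hA ∅, single_self_mem A hA ∅⟩
    | insert i T hi ih =>
      constructor
      · have : Matrix.single (∅ : Finset V) (insert i T) (1 : ℂ) =
            Matrix.single (∅ : Finset V) T (1 : ℂ) * Matrix.single T (insert i T) (1 : ℂ) := by simp
        rw [this, hstep i T hi]
        exact mul_mem ih.1 (Subalgebra.smul_mem _ (mul_mem (single_self_mem A hA T) (hA _)) _)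
      · have : Matrix.single (insert i T) (∅ : Finset V) (1 : ℂ) =
            Matrix.single (insert i T) T (1 : ℂ) * Matrix.single T (∅ : Finset V) (1 : ℂ) := by simp
        rw [this, hstep2 i T hi]
        exact mul_mem (Subalgebra.smul_mem _ (mul_mem (hA _) (single_self_mem A hA T)) _) ih.2
  rw [eq_top_iff]
  intro X _
  rw [Matrix.matrix_eq_sum_single X]
  refine sum_mem fun S _ => sum_mem fun T _ => ?_
  have : Matrix.single S T (X S T) =
      X S T • (Matrix.single S (∅ : Finset V) (1 : ℂ) * Matrix.single (∅ : Finset V) T (1 : ℂ)) := by simp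
  rw [this]
  exact Subalgebra.smul_mem _ (mul_mem (h1 S).2 (h1 T).1) _

lemma majoranaAlg_univ : majoranaAlg (Set.univ : Set (V × Bool)) = ⊤ :=
  eq_top_of_ladder_mem _ ladder_mem_majoranaAlg

/-- Irreducibility of the Fock representation: the Majorana operators generate the full matrix
algebra, whose centre is scalar. -/
lemma eq_scalar_of_commute (X : FockOp V) (h : ∀ a, majorana a * X = X * majorana a) :
    ∃ z : ℂ, X = z • 1 := by
  have h2 : ∀ Y : FockOp V, Y * X = X * Y := by
    intro Y
    have hY : Y ∈ majoranaAlg (Set.univ : Set (V × Bool)) := by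
      rw [majoranaAlg_univ]; trivial
    induction hY using Algebra.adjoin_induction with
    | mem x hx =>
      obtain ⟨a, _, rfl⟩ := hx
      exact h a
    | algebraMap r => rw [Algebra.commutes]
    | add x y _ _ hx hy => rw [add_mul, mul_add, hx, hy]
    | mul x y _ _ hx hy => rw [mul_assoc, hy, ← mul_assoc, hx, mul_assoc]
  have : X ∈ Set.range (Matrix.scalar (Finset V)) := by
    rw [Matrix.mem_range_scalar_iff_commute_single]
    intro i j _
    exact h2 _
  obtain ⟨z, hz⟩ := this
  exact ⟨z, by rw [← hz, Matrix.scalar_apply, ← Matrix.smul_one_eq_diagonal]⟩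

end CAR

/-! ### Averaging over Majorana operators -/

section Twirl

variable {V : Type} [LinearOrder V] [Fintype V]

/-- The graded commutator `γ_a B - σ B γ_a` with a Majorana operator. -/
def defect (σ : ℂ) (a : V × Bool) (B : FockOp V) : FockOp V :=
  majorana a * B - σ • (B * majorana a)

/-- The projection `(B + σ γ_a B γ_a) / 2` onto the operators with `γ_a B = σ B γ_a`. -/
def twirl (σ : ℂ) (a : V × Bool) (B : FockOp V) : FockOp V :=
  (1 / 2 : ℂ) • (B + σ • (majorana a * B * majorana a))

lemma majorana_mul_cancel (a : V × Bool) (B : FockOp V) : majorana a * (majorana a * B) = B := by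
  rw [← mul_assoc, majorana_sq, one_mul]

lemma mul_majorana_cancel (a : V × Bool) (B : FockOp V) : B * majorana a * majorana a = B := by
  rw [mul_assoc, majorana_sq, mul_one]

lemma norm_majorana_mul_le (a : V × Bool) (B : FockOp V) : ‖majorana a * B‖ ≤ ‖B‖ := by
  simpa [norm_majorana] using norm_mul_le (majorana a) B

lemma norm_mul_majorana_le (a : V × Bool) (B : FockOp V) : ‖B * majorana a‖ ≤ ‖B‖ := by
  simpa [norm_majorana] using norm_mul_le B (majorana a)

lemma defect_twirl_self {σ : ℂ} (hσ : σ * σ = 1) (a : V × Bool) (B : FockOp V) :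
    defect σ a (twirl σ a B) = 0 := by
  simp only [defect, twirl, mul_smul_comm, smul_mul_assoc, mul_add, add_mul, mul_assoc,
    majorana_mul_cancel, majorana_sq, mul_one]
  match_scalars
  · linear_combination (-1 / 2) * hσ
  · ring

/-- Moving `γ_b` through the two outer `γ_a` costs one sign on either side, so the new defect is an
average of the old one and of a conjugate of it. Hence repairing one label does not worsen the
others. -/
lemma defect_twirl_of_ne {σ : ℂ} {a b : V × Bool} (h : b ≠ a) (B : FockOp V) :
    defect σ b (twirl σ a B) =
      (1 / 2 : ℂ) • (defect σ b B - σ • (majorana a * defect σ b B * majorana a)) := by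
  have h1 : majorana b * (majorana a * B * majorana a) =
      -(majorana a * (majorana b * B) * majorana a) := by
    rw [← mul_assoc, ← mul_assoc, majorana_anticomm_of_ne h]; noncomm_ring
  have h2 : majorana a * B * majorana a * majorana b =
      -(majorana a * (B * majorana b) * majorana a) := by
    rw [mul_assoc _ (majorana a) (majorana b), majorana_anticomm_of_ne h.symm]; noncomm_ring
  simp only [defect, twirl, mul_smul_comm, smul_mul_assoc, mul_add, add_mul, mul_sub, sub_mul,
    h1, h2]
  module

lemma norm_defect_twirl_le {σ : ℂ} (hσ : σ = 1 ∨ σ = -1) (a b : V × Bool) (B : FockOp V) :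
    ‖defect σ b (twirl σ a B)‖ ≤ ‖defect σ b B‖ := by
  have hn : ‖σ‖ = 1 := by rcases hσ with rfl | rfl <;> simp
  by_cases h : b = a
  · subst h
    rw [defect_twirl_self (by rcases hσ with rfl | rfl <;> norm_num), norm_zero]
    exact norm_nonneg _
  · rw [defect_twirl_of_ne h, norm_smul]
    have h1 : ‖majorana a * defect σ b B * majorana a‖ ≤ ‖defect σ b B‖ :=
      (norm_mul_majorana_le _ _).trans (norm_majorana_mul_le _ _)
    have h2 := norm_sub_le (defect σ b B) (σ • (majorana a * defect σ b B * majorana a))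
    rw [norm_smul, hn, one_mul] at h2
    norm_num
    linarith

lemma sub_twirl {σ : ℂ} (a : V × Bool) (B : FockOp V) :
    B - twirl σ a B = (1 / 2 : ℂ) • (majorana a * defect σ a B) := by
  simp only [defect, twirl, mul_sub, mul_smul_comm, majorana_mul_cancel, mul_assoc]
  module

lemma norm_sub_twirl_le {σ : ℂ} (a : V × Bool) (B : FockOp V) :
    ‖B - twirl σ a B‖ ≤ 1 / 2 * ‖defect σ a B‖ := by
  rw [sub_twirl, norm_smul]
  have := norm_majorana_mul_le a (defect σ a B)
  norm_num
  linarith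

/-- Every operator is close to one that commutes (`σ = 1`) or anticommutes (`σ = -1`) with the
Majorana operators from `s`. -/
lemma exists_twirl {σ : ℂ} (hσ : σ = 1 ∨ σ = -1) (s : Finset (V × Bool)) (B : FockOp V) :
    ∃ B' : FockOp V, (∀ k ∈ s, majorana k * B' = σ • (B' * majorana k)) ∧
      (∀ k, ‖defect σ k B'‖ ≤ ‖defect σ k B‖) ∧
      ‖B - B'‖ ≤ 1 / 2 * ∑ k ∈ s, ‖defect σ k B‖ := by
  induction s using Finset.induction_on generalizing B with
  | empty => exact ⟨B, by simp, fun _ => le_rfl, by simp⟩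
  | insert a s ha ih =>
    obtain ⟨B', h1, h2, h3⟩ := ih (twirl σ a B)
    have h4 : ∀ k, ‖defect σ k B'‖ ≤ ‖defect σ k B‖ := fun k =>
      (h2 k).trans (norm_defect_twirl_le hσ a k B)
    refine ⟨B', ?_, h4, ?_⟩
    · intro k hk
      rcases Finset.mem_insert.mp hk with rfl | hk
      · have h5 := h2 k
        rw [defect_twirl_self (by rcases hσ with rfl | rfl <;> norm_num), norm_zero] at h5
        exact sub_eq_zero.mp (norm_le_zero_iff.mp h5)
      · exact h1 k hk
    · rw [Finset.sum_insert ha]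
      have h5 : ∑ k ∈ s, ‖defect σ k (twirl σ a B)‖ ≤ ∑ k ∈ s, ‖defect σ k B‖ :=
        Finset.sum_le_sum fun k _ => norm_defect_twirl_le hσ a k B
      have h6 := norm_sub_twirl_le (σ := σ) a B
      have h7 := norm_sub_le_norm_sub_add_norm_sub B (twirl σ a B) B'
      linarith

/-- Every operator is close to a multiple of the identity if it almost commutes with the Majorana
operators. -/
lemma exists_norm_sub_scalar_le (O : FockOp V) :
    ∃ z : ℂ, ‖O - z • 1‖ ≤ 1 / 2 * ∑ k, ‖defect 1 k O‖ := by
  obtain ⟨B, h1, -, h3⟩ := exists_twirl (σ := 1) (Or.inl rfl) Finset.univ O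
  obtain ⟨z, rfl⟩ := eq_scalar_of_commute B fun a => by
    simpa using h1 a (Finset.mem_univ a)
  exact ⟨z, h3⟩

/-- Twirling `O` over `s` gives an operator commuting with the whole algebra of `s`; only the
difference enters the commutator, twice, which cancels the factor `1/2` of the twirl estimate. -/
lemma norm_commutator_le {s : Finset (V × Bool)} {X : FockOp V} (hX : X ∈ majoranaAlg (s : Set (V × Bool)))
    (O : FockOp V) : ‖O * X - X * O‖ ≤ ‖X‖ * ∑ k ∈ s, ‖defect 1 k O‖ := by
  obtain ⟨B, h1, -, h3⟩ := exists_twirl (σ := 1) (Or.inl rfl) s O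
  have h2 : B * X = X * B := by
    induction hX using Algebra.adjoin_induction with
    | mem x hx =>
      obtain ⟨a, ha, rfl⟩ := hx
      simpa using (h1 a ha).symm
    | algebraMap r => rw [Algebra.commutes]
    | add x y _ _ hx hy => rw [add_mul, mul_add, hx, hy]
    | mul x y _ _ hx hy => rw [mul_assoc, ← hy, ← mul_assoc, hx, mul_assoc]
  have h4 : O * X - X * O = (O - B) * X - X * (O - B) := by
    rw [sub_mul, mul_sub, h2]; abel
  rw [h4]
  have h5 := norm_sub_le ((O - B) * X) (X * (O - B))
  have h6 := norm_mul_le (O - B) X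
  have h7 := norm_mul_le X (O - B)
  have h8 : ‖O - B‖ * ‖X‖ ≤ (1 / 2 * ∑ k ∈ s, ‖defect 1 k O‖) * ‖X‖ :=
    mul_le_mul_of_nonneg_right h3 (norm_nonneg _)
  nlinarith

/-- Conjugation by `γ_a` and by the parity are algebra automorphisms that both flip the sign of each
generator with label in `s`. -/
lemma conj_majorana {s : Set (V × Bool)} {a : V × Bool} (ha : a ∉ s) {X : FockOp V}
    (hX : X ∈ majoranaAlg s) :
    majorana a * X * majorana a = parity * X * parity ∧
      parity * X * parity ∈ majoranaAlg s := by
  induction hX using Algebra.adjoin_induction with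
  | mem x hx =>
    obtain ⟨b, hb, rfl⟩ := hx
    have hab : a ≠ b := fun h => ha (h ▸ hb)
    have h1 : parity * majorana b * parity = -majorana b := by
      rw [parity_mul_majorana, neg_mul, mul_assoc, parity_mul_parity, mul_one]
    rw [h1, majorana_anticomm_of_ne hab, neg_mul, mul_majorana_cancel]
    exact ⟨rfl, neg_mem (Algebra.subset_adjoin ⟨b, hb, rfl⟩)⟩
  | algebraMap r =>
    rw [← Algebra.commutes, mul_assoc, majorana_sq, ← Algebra.commutes, mul_assoc,
      parity_mul_parity, mul_one]
    exact ⟨rfl, Subalgebra.algebraMap_mem _ r⟩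
  | add x y _ _ hx hy =>
    rw [mul_add, add_mul, mul_add, add_mul, hx.1, hy.1]
    exact ⟨rfl, add_mem hx.2 hy.2⟩
  | mul x y _ _ hx hy =>
    have h1 : majorana a * (x * y) * majorana a =
        (majorana a * x * majorana a) * (majorana a * y * majorana a) := by
      rw [mul_assoc _ y, ← mul_assoc (majorana a * x * majorana a), mul_majorana_cancel]
      noncomm_ring
    have h2 : parity * (x * y) * parity = (parity * x * parity) * (parity * y * parity) := by
      calc parity * (x * y) * parity = parity * x * 1 * y * parity := by noncomm_ring
        _ = parity * x * (parity * parity) * y * parity := by rw [parity_mul_parity]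
        _ = _ := by noncomm_ring
    rw [h1, h2, hx.1, hy.1]
    exact ⟨rfl, mul_mem hx.2 hy.2⟩

lemma exists_decomp {s : Set (V × Bool)} {a : V × Bool} (ha : a ∉ s) {X : FockOp V}
    (hX : X ∈ majoranaAlg (insert a s)) :
    ∃ A ∈ majoranaAlg s, ∃ B ∈ majoranaAlg s, X = A + majorana a * B := by
  induction hX using Algebra.adjoin_induction with
  | mem x hx =>
    obtain ⟨b, hb, rfl⟩ := hx
    rcases hb with rfl | hb
    · exact ⟨0, zero_mem _, 1, one_mem _, by simp⟩
    · exact ⟨majorana b, Algebra.subset_adjoin ⟨b, hb, rfl⟩, 0, zero_mem _, by simp⟩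
  | algebraMap r => exact ⟨_, Subalgebra.algebraMap_mem _ r, 0, zero_mem _, by simp⟩
  | add x y _ _ hx hy =>
    obtain ⟨A, hA, B, hB, rfl⟩ := hx
    obtain ⟨A', hA', B', hB', rfl⟩ := hy
    exact ⟨A + A', add_mem hA hA', B + B', add_mem hB hB', by rw [mul_add]; abel⟩
  | mul x y _ _ hx hy =>
    obtain ⟨A, hA, B, hB, rfl⟩ := hx
    obtain ⟨A', hA', B', hB', rfl⟩ := hy
    have h1 := conj_majorana ha hA
    have h2 := conj_majorana ha hB
    rw [← h1.1] at h1
    rw [← h2.1] at h2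
    refine ⟨A * A' + (majorana a * B * majorana a) * B', add_mem (mul_mem hA hA') (mul_mem h2.2 hB'),
      (majorana a * A * majorana a) * B' + B * A', add_mem (mul_mem h1.2 hB') (mul_mem hB hA'), ?_⟩
    have h3 : majorana a * (majorana a * A * majorana a * B') = A * majorana a * B' := by
      rw [mul_assoc (majorana a), mul_assoc (majorana a), majorana_mul_cancel]
    rw [mul_add (majorana a), h3]
    noncomm_ring

/-- Write `X = A + γ_a B` with `A`, `B` in the algebra of `s`. On these, conjugation by `γ_a` is
conjugation by the parity, and the definite parity of `X` makes the `γ_a B` parts cancel in the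
average. For mixed parity this cancellation would fail. -/
lemma twirl_mem {σ : ℂ} (hσ : σ * σ = 1) {s : Set (V × Bool)} {a : V × Bool} (ha : a ∉ s)
    {X : FockOp V} (hX : X ∈ majoranaAlg (insert a s)) (hP : parity * X = σ • (X * parity)) :
    twirl σ a X ∈ majoranaAlg s := by
  obtain ⟨A, hA, B, hB, h⟩ := exists_decomp ha hX
  have h1 := conj_majorana ha hA
  have h2 := conj_majorana ha hB
  have h3 : parity * X * parity = σ • X := by
    rw [hP, smul_mul_assoc, mul_assoc, parity_mul_parity, mul_one]
  have h4 : majorana a * X * majorana a = parity * A * parity + majorana a * (parity * B * parity) := by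
    rw [← h1.1, ← h2.1, h]; noncomm_ring
  have h5 : σ • X = parity * A * parity - majorana a * (parity * B * parity) := by
    rw [← h3, h, mul_add, add_mul, ← mul_assoc parity (majorana a), parity_mul_majorana]
    noncomm_ring
  have h6 : twirl σ a X = σ • (parity * A * parity) := by
    have h7 : majorana a * (parity * B * parity) = parity * A * parity - σ • X := by
      rw [h5]; abel
    rw [twirl, h4, h7]
    match_scalars
    · linear_combination (-1 / 2) * hσ
    · ring
  rw [h6]
  exact Subalgebra.smul_mem _ h1.2 _

/-- Commutators with a quasi-local operator of definite parity. -/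
lemma norm_commutator_le_of_defect {σ : ℂ} (hσ : σ = 1 ∨ σ = -1) (d : V × Bool → ℕ)
    {X : FockOp V} (hP : parity * X = σ • (X * parity)) (O : FockOp V) :
    ‖O * X - X * O‖ ≤ ∑ j, ‖defect 1 j O‖ *
      ∑ k with d j ≤ d k, ‖defect σ k X‖ := by
  have hσ2 : σ * σ = 1 := by rcases hσ with rfl | rfl <;> norm_num
  -- The Majorana operators are peeled off `X` from the farthest one inwards. Twirling over `a`
  -- removes it at a cost controlled by the defect of `X` at `a`, and the removed piece still lies
  -- in the algebra of the labels `j` with `d j ≤ d a`. This yields the constraint `d j ≤ d k` in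
  -- the double sum.
  suffices H : ∀ (s : Finset (V × Bool)) (X : FockOp V), X ∈ majoranaAlg (s : Set (V × Bool)) →
      parity * X = σ • (X * parity) → ‖O * X - X * O‖ ≤ ∑ j ∈ s, ‖defect 1 j O‖ *
      ∑ k ∈ s with d j ≤ d k, ‖defect σ k X‖ by
    exact H Finset.univ X (by rw [Finset.coe_univ, majoranaAlg_univ]; trivial) hP
  intro s
  induction s using Finset.induction_on_max_value d with
  | empty =>
    intro X hX _
    have := norm_commutator_le hX O
    simpa using this
  | insert a s ha hmax ih =>
    intro X hX hP
    have hX' : X ∈ majoranaAlg (insert a (s : Set (V × Bool))) := by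
      rwa [Finset.coe_insert] at hX
    have hT := twirl_mem hσ2 (by simpa using ha) hX' hP
    have hTP : parity * twirl σ a X = σ • (twirl σ a X * parity) := by
      have : parity * (majorana a * X * majorana a) =
          σ • (majorana a * X * majorana a * parity) := by
        calc parity * (majorana a * X * majorana a)
            = (parity * majorana a) * X * majorana a := by noncomm_ring
          _ = -(majorana a * (parity * X) * majorana a) := by
            rw [parity_mul_majorana]; noncomm_ring
          _ = -(σ • (majorana a * X * (parity * majorana a))) := by
            rw [hP, mul_smul_comm, smul_mul_assoc]
            simp only [mul_assoc]
          _ = _ := by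
            rw [parity_mul_majorana, mul_neg, smul_neg, neg_neg]
            simp only [mul_assoc]
      rw [twirl, mul_smul_comm, mul_add, mul_smul_comm, this, hP, smul_mul_assoc, add_mul,
        smul_mul_assoc]
      module
    have h1 := ih _ hT hTP
    have h2 : X - twirl σ a X ∈ majoranaAlg ((insert a s : Finset (V × Bool)) : Set (V × Bool)) :=
      sub_mem hX (Algebra.adjoin_mono (Set.image_mono (by simp)) hT)
    have h3 := norm_commutator_le h2 O
    have h4 := norm_sub_twirl_le (σ := σ) a X
    have h5 : O * X - X * O = (O * twirl σ a X - twirl σ a X * O) +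
        (O * (X - twirl σ a X) - (X - twirl σ a X) * O) := by noncomm_ring
    have h6 : ∑ j ∈ s, ‖defect 1 j O‖ * ∑ k ∈ s with d j ≤ d k, ‖defect σ k (twirl σ a X)‖ ≤
        ∑ j ∈ s, ‖defect 1 j O‖ * ∑ k ∈ s with d j ≤ d k, ‖defect σ k X‖ := by
      gcongr
      exact norm_defect_twirl_le hσ a _ X
    -- Since `d a` is maximal, `a` occurs in the inner sum of every `j`.
    have h7 : ∀ j ∈ s, ∑ k ∈ insert a s with d j ≤ d k, ‖defect σ k X‖ =
        ‖defect σ a X‖ + ∑ k ∈ s with d j ≤ d k, ‖defect σ k X‖ := by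
      intro j hj
      rw [Finset.filter_insert, if_pos (hmax j hj), Finset.sum_insert (by simp [ha])]
    have h8 : ‖defect σ a X‖ ≤ ∑ k ∈ insert a s with d a ≤ d k, ‖defect σ k X‖ :=
      Finset.single_le_sum (f := fun k => ‖defect σ k X‖) (fun _ _ => norm_nonneg _) (by simp)
    have h9 : ‖X - twirl σ a X‖ * ∑ k ∈ insert a s, ‖defect 1 k O‖ ≤
        ‖defect σ a X‖ * ∑ k ∈ insert a s, ‖defect 1 k O‖ := by
      apply mul_le_mul_of_nonneg_right _ (Finset.sum_nonneg fun _ _ => norm_nonneg _)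
      linarith [norm_nonneg (defect σ a X)]
    have h11 : ∑ j ∈ s, ‖defect 1 j O‖ * ∑ k ∈ insert a s with d j ≤ d k, ‖defect σ k X‖ =
        (∑ j ∈ s, ‖defect 1 j O‖) * ‖defect σ a X‖ +
          ∑ j ∈ s, ‖defect 1 j O‖ * ∑ k ∈ s with d j ≤ d k, ‖defect σ k X‖ := by
      rw [Finset.sum_mul, ← Finset.sum_add_distrib]
      refine Finset.sum_congr rfl fun j hj => ?_
      rw [h7 j hj, mul_add]
    rw [Finset.sum_insert ha, h11]
    rw [Finset.sum_insert ha] at h9 h3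
    have h10 := mul_le_mul_of_nonneg_left h8 (norm_nonneg (defect 1 a O))
    rw [h5]
    refine (norm_add_le _ _).trans ?_
    nlinarith

end Twirl

/-! ### Semigroups -/

section Semigroup

open Filter Topology

variable {E F : Type*} [NormedAddCommGroup E] [NormedSpace ℂ E] [CompleteSpace E]
  [NormedAddCommGroup F] [NormedSpace ℂ F]

lemma hasDerivAt_exp_apply (T : E →L[ℂ] E) (x : E) (t : ℝ) :
    HasDerivAt (fun t : ℝ => NormedSpace.exp ((t : ℂ) • T) x)
      (T (NormedSpace.exp ((t : ℂ) • T) x)) t := by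
  have h1 := (hasDerivAt_exp_smul_const' (𝕂 := ℂ) T (t : ℂ)).scomp t Complex.ofRealCLM.hasDerivAt
  have h2 := ((ContinuousLinearMap.apply ℂ E x).restrictScalars ℝ).hasFDerivAt.comp_hasDerivAt t h1
  refine HasDerivAt.congr_deriv (f := fun t : ℝ => NormedSpace.exp ((t : ℂ) • T) x) h2 ?_
  simp

lemma exp_zero_smul_apply (T : E →L[ℂ] E) (x : E) :
    NormedSpace.exp (((0 : ℝ) : ℂ) • T) x = x := by
  rw [Complex.ofReal_zero, zero_smul, NormedSpace.exp_zero]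
  rfl

lemma exp_apply_comm (T : E →L[ℂ] E) (x : E) (t : ℂ) :
    T (NormedSpace.exp (t • T) x) = NormedSpace.exp (t • T) (T x) := by
  have : Commute T (NormedSpace.exp (t • T)) := ((Commute.refl T).smul_right t).exp_right
  exact congrArg (fun S : E →L[ℂ] E => S x) this.eq

/-- A decay estimate for the Euler steps of a semigroup gives one for the semigroup. -/
lemma norm_exp_apply_le (T : E →L[ℂ] E) (Φ : E →L[ℂ] F) {κ C : ℝ}
    (hT : ∀ x, ∀ h ∈ Set.Ioc (0 : ℝ) 1, ‖Φ (x + (h : ℂ) • T x)‖ ≤ (1 - κ * h + C * h ^ 2) * ‖Φ x‖)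
    (x : E) {t : ℝ} (ht : 0 ≤ t) :
    ‖Φ (NormedSpace.exp ((t : ℂ) • T) x)‖ ≤ Real.exp (-κ * t) * ‖Φ x‖ := by
  set u : ℝ → E := fun t => NormedSpace.exp ((t : ℂ) • T) x with hu
  have hd : ∀ t, HasDerivAt u (T (u t)) t := hasDerivAt_exp_apply T x
  have hc : Continuous u := continuous_iff_continuousAt.mpr fun t => (hd t).continuousAt
  -- The norm along the orbit need not be differentiable, so the Gronwall inequality is used with
  -- one-sided difference quotients. The Euler-step hypothesis bounds these, and the term `C h²`
  -- disappears in the limit.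
  have key := le_gronwallBound_of_liminf_deriv_right_le (f := fun t => ‖Φ (u t)‖)
    (f' := fun t => -κ * ‖Φ (u t)‖) (δ := ‖Φ x‖) (K := -κ) (ε := 0) (a := 0) (b := t)
    (by fun_prop) ?_ (by simp [hu]) (by simp)
  · have := key t ⟨ht, le_rfl⟩
    rwa [gronwallBound_ε0, sub_zero, mul_comm] at this
  · intro s _ r hr
    apply Eventually.frequently
    have h1 : Tendsto (fun z => ‖Φ‖ * ‖(z - s)⁻¹ • (u z - u s) - T (u s)‖ +
        (-κ * ‖Φ (u s)‖ + C * (z - s) * ‖Φ (u s)‖)) (𝓝[>] s)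
        (𝓝 (‖Φ‖ * 0 + (-κ * ‖Φ (u s)‖ + C * 0 * ‖Φ (u s)‖))) := by
      have h2 : Tendsto (fun z => (z - s)⁻¹ • (u z - u s)) (𝓝[>] s) (𝓝 (T (u s))) := by
        have := (hasDerivAt_iff_tendsto_slope.mp (hd s)).mono_left
          (nhdsWithin_mono s (s := Set.Ioi s) (by intro z hz; exact ne_of_gt hz))
        simpa [slope_fun_def] using this
      have h3 : Tendsto (fun z : ℝ => z - s) (𝓝[>] s) (𝓝 0) := by
        have : Tendsto (fun z : ℝ => z - s) (𝓝 s) (𝓝 (s - s)) := by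
          exact (continuous_id.sub continuous_const).tendsto s
        rw [sub_self] at this
        exact this.mono_left nhdsWithin_le_nhds
      have h4 : Tendsto (fun z => ‖(z - s)⁻¹ • (u z - u s) - T (u s)‖) (𝓝[>] s) (𝓝 0) := by
        have := (h2.sub_const (T (u s))).norm
        simpa using this
      exact (h4.const_mul _).add (tendsto_const_nhds.add ((h3.const_mul C).mul_const _))
    simp only [mul_zero, zero_mul, zero_add, add_zero] at h1
    have h5 := h1.eventually_lt_const hr
    have h6 : ∀ᶠ z in 𝓝[>] s, z ∈ Set.Ioc s (s + 1) := Ioc_mem_nhdsGT (by linarith)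
    filter_upwards [h5, h6] with z hz hz'
    refine lt_of_le_of_lt ?_ hz
    have hpos : 0 < z - s := by linarith [hz'.1]
    have h7 := hT (u s) (z - s) ⟨hpos, by linarith [hz'.2]⟩
    have h8 : u z = (u s + ((z - s : ℝ) : ℂ) • T (u s)) +
        (z - s) • ((z - s)⁻¹ • (u z - u s) - T (u s)) := by
      rw [smul_sub, smul_inv_smul₀ hpos.ne', Complex.coe_smul]
      abel
    have h9 : ‖Φ (u z)‖ ≤ (1 - κ * (z - s) + C * (z - s) ^ 2) * ‖Φ (u s)‖ +
        ‖Φ‖ * ((z - s) * ‖(z - s)⁻¹ • (u z - u s) - T (u s)‖) := by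
      conv_lhs => rw [h8]
      rw [map_add]
      refine (norm_add_le _ _).trans (add_le_add h7 ?_)
      refine (Φ.le_opNorm _).trans ?_
      rw [norm_smul, Real.norm_of_nonneg hpos.le]
    rw [inv_mul_le_iff₀ hpos]
    nlinarith

end Semigroup

/-! ### Heisenberg generators -/

section Heisenberg

variable {n ι : Type*} [Fintype n] [DecidableEq n] [Fintype ι]

/-- The decay operator `∑ K_a† K_a`. -/
def decayOp (K : ι → Matrix n n ℂ) : Matrix n n ℂ := ∑ a, (K a)ᴴ * K a

/-- The map `O ↦ s ∑ K_a† O K_a - (G O + O G) / 2`, where `G = ∑ K_a† K_a`: for `s = 1` the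
generator of the Heisenberg dynamics, for `s = -1` its action on odd operators. -/
def heis (s : ℂ) (K : ι → Matrix n n ℂ) : Matrix n n ℂ →L[ℂ] Matrix n n ℂ :=
  LinearMap.toContinuousLinearMap
    (s • ∑ a, LinearMap.mulLeft ℂ (K a)ᴴ ∘ₗ LinearMap.mulRight ℂ (K a) -
      (1 / 2 : ℂ) • (LinearMap.mulLeft ℂ (decayOp K) + LinearMap.mulRight ℂ (decayOp K)))

lemma heis_apply (s : ℂ) (K : ι → Matrix n n ℂ) (O : Matrix n n ℂ) :
    heis s K O = s • ∑ a, (K a)ᴴ * O * K a - (1 / 2 : ℂ) • (decayOp K * O + O * decayOp K) := by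
  simp [heis, LinearMap.sum_apply, mul_assoc]

lemma decayOp_isHermitian (K : ι → Matrix n n ℂ) : (decayOp K)ᴴ = decayOp K := by
  simp [decayOp, Matrix.conjTranspose_sum, Matrix.conjTranspose_mul]

lemma heis_conjTranspose (K : ι → Matrix n n ℂ) (O : Matrix n n ℂ) :
    heis 1 K Oᴴ = (heis 1 K O)ᴴ := by
  simp only [heis_apply, Matrix.conjTranspose_sub, Matrix.conjTranspose_smul,
    Matrix.conjTranspose_sum, Matrix.conjTranspose_mul, Matrix.conjTranspose_add,
    decayOp_isHermitian, Matrix.conjTranspose_conjTranspose, mul_assoc]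
  simp [add_comm]

lemma heis_one (K : ι → Matrix n n ℂ) : heis 1 K 1 = 0 := by
  simp only [heis_apply, mul_one, one_mul, one_smul]
  rw [decayOp]; module

lemma norm_le_of_inner_le {A : Matrix n n ℂ} {c : ℝ} (hc : 0 ≤ c)
    (h : ∀ x y : EuclideanSpace ℂ n,
      ‖inner ℂ x (Matrix.toEuclideanCLM (𝕜 := ℂ) A y)‖ ≤ c * ‖x‖ * ‖y‖) : ‖A‖ ≤ c := by
  rw [← Matrix.l2_opNorm_toEuclideanCLM]
  refine ContinuousLinearMap.opNorm_le_bound _ hc fun y => ?_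
  set z := Matrix.toEuclideanCLM (𝕜 := ℂ) A y
  rcases eq_or_ne z 0 with hz | hz
  · rw [hz, norm_zero]; positivity
  · have h1 := h z y
    rw [inner_self_eq_norm_sq_to_K, norm_pow] at h1
    simp only [Complex.coe_algebraMap, Complex.norm_real, norm_norm] at h1
    have hz' : 0 < ‖z‖ := norm_pos_iff.mpr hz
    nlinarith

lemma inner_conj_mul (A B O : Matrix n n ℂ) (x y : EuclideanSpace ℂ n) :
    inner ℂ x (Matrix.toEuclideanCLM (𝕜 := ℂ) (Aᴴ * O * B) y) =
      inner ℂ (Matrix.toEuclideanCLM (𝕜 := ℂ) A x)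
        (Matrix.toEuclideanCLM (𝕜 := ℂ) O (Matrix.toEuclideanCLM (𝕜 := ℂ) B y)) := by
  rw [← Matrix.star_eq_conjTranspose, map_mul, map_mul, map_star, mul_assoc,
    ContinuousLinearMap.star_eq_adjoint, mul_apply_eq_comp,
    ContinuousLinearMap.adjoint_inner_right]
  rfl

lemma sum_norm_sq_le (B : ι → Matrix n n ℂ) (x : EuclideanSpace ℂ n) :
    ∑ a, ‖Matrix.toEuclideanCLM (𝕜 := ℂ) (B a) x‖ ^ 2 ≤ ‖decayOp B‖ * ‖x‖ ^ 2 := by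
  have h1 : ((∑ a, ‖Matrix.toEuclideanCLM (𝕜 := ℂ) (B a) x‖ ^ 2 : ℝ) : ℂ) =
      inner ℂ x (Matrix.toEuclideanCLM (𝕜 := ℂ) (decayOp B) x) := by
    rw [decayOp, map_sum, _root_.sum_apply, inner_sum, Complex.ofReal_sum]
    refine Finset.sum_congr rfl fun a _ => ?_
    have := inner_conj_mul (B a) (B a) 1 x x
    rw [mul_one, map_one, one_apply_eq_self] at this
    rw [this, inner_self_eq_norm_sq_to_K]
    simp
  have h2 : ∑ a, ‖Matrix.toEuclideanCLM (𝕜 := ℂ) (B a) x‖ ^ 2 =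
      ‖inner ℂ x (Matrix.toEuclideanCLM (𝕜 := ℂ) (decayOp B) x)‖ := by
    rw [← h1, Complex.norm_real, Real.norm_of_nonneg (by positivity)]
  rw [h2]
  refine (norm_inner_le_norm _ _).trans ?_
  have := (Matrix.toEuclideanCLM (𝕜 := ℂ) (decayOp B)).le_opNorm x
  rw [Matrix.l2_opNorm_toEuclideanCLM] at this
  nlinarith [norm_nonneg x]

/-- Cauchy-Schwarz over the index `a`. Phases are harmless here, unlike in an argument by
positivity; this is what later allows a minus sign in front of the jump terms. -/
lemma norm_sum_conj_le (s : ι → ℂ) (hs : ∀ a, ‖s a‖ ≤ 1) (B : ι → Matrix n n ℂ)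
    (O : Matrix n n ℂ) :
    ‖∑ a, s a • ((B a)ᴴ * O * B a)‖ ≤ ‖decayOp B‖ * ‖O‖ := by
  refine norm_le_of_inner_le (by positivity) fun x y => ?_
  rw [map_sum, _root_.sum_apply, inner_sum]
  refine (norm_sum_le _ _).trans ?_
  have h1 : ∀ a, ‖inner ℂ x (Matrix.toEuclideanCLM (𝕜 := ℂ) (s a • ((B a)ᴴ * O * B a)) y)‖ ≤
      ‖O‖ * (‖Matrix.toEuclideanCLM (𝕜 := ℂ) (B a) x‖ * ‖Matrix.toEuclideanCLM (𝕜 := ℂ) (B a) y‖) := by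
    intro a
    rw [map_smul, _root_.smul_apply, inner_smul_right, norm_mul, inner_conj_mul]
    have h2 := norm_inner_le_norm (𝕜 := ℂ) (Matrix.toEuclideanCLM (𝕜 := ℂ) (B a) x)
      (Matrix.toEuclideanCLM (𝕜 := ℂ) O (Matrix.toEuclideanCLM (𝕜 := ℂ) (B a) y))
    have h3 := (Matrix.toEuclideanCLM (𝕜 := ℂ) O).le_opNorm
      (Matrix.toEuclideanCLM (𝕜 := ℂ) (B a) y)
    rw [Matrix.l2_opNorm_toEuclideanCLM] at h3
    calc _ ≤ 1 * (‖Matrix.toEuclideanCLM (𝕜 := ℂ) (B a) x‖ *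
          (‖O‖ * ‖Matrix.toEuclideanCLM (𝕜 := ℂ) (B a) y‖)) := by
          gcongr
          · exact hs a
          · exact h2.trans (by gcongr)
      _ = _ := by ring
  refine (Finset.sum_le_sum fun a _ => h1 a).trans ?_
  rw [← Finset.mul_sum]
  have h4 := Finset.sum_mul_sq_le_sq_mul_sq Finset.univ
    (fun a => ‖Matrix.toEuclideanCLM (𝕜 := ℂ) (B a) x‖)
    (fun a => ‖Matrix.toEuclideanCLM (𝕜 := ℂ) (B a) y‖)
  have h5 := sum_norm_sq_le B x
  have h6 := sum_norm_sq_le B y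
  have h7 : ∑ a, ‖Matrix.toEuclideanCLM (𝕜 := ℂ) (B a) x‖ *
      ‖Matrix.toEuclideanCLM (𝕜 := ℂ) (B a) y‖ ≤ ‖decayOp B‖ * ‖x‖ * ‖y‖ := by
    refine (sq_le_sq₀ (by positivity) (by positivity)).mp ?_
    calc _ ≤ _ := h4
      _ ≤ (‖decayOp B‖ * ‖x‖ ^ 2) * (‖decayOp B‖ * ‖y‖ ^ 2) := by gcongr
      _ = _ := by ring
  nlinarith [norm_nonneg O]

/-- Up to `h²/4 · G O G`, an Euler step is a signed Kraus map with operators `1 - hG/2` and `√h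
K_a`, and their decay operator is `1 + h²/4 · G²`. Hence the step is contractive to first order in
`h` for both signs. -/
lemma norm_add_heis_le {s : ℂ} (hs : s = 1 ∨ s = -1) (K : ι → Matrix n n ℂ) (O : Matrix n n ℂ)
    {h : ℝ} (hh : 0 ≤ h) :
    ‖O + (h : ℂ) • heis s K O‖ ≤ (1 + ‖decayOp K‖ ^ 2 / 2 * h ^ 2) * ‖O‖ := by
  have hns : ‖s‖ = 1 := by rcases hs with rfl | rfl <;> simp
  set G := decayOp K with hG
  set R : Matrix n n ℂ := 1 - ((h / 2 : ℝ) : ℂ) • G with hR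
  let B : Option ι → Matrix n n ℂ := fun a => a.elim R fun a => ((√h : ℝ) : ℂ) • K a
  let s' : Option ι → ℂ := fun a => a.elim 1 fun _ => s
  have hsq : ((√h : ℝ) : ℂ) * ((√h : ℝ) : ℂ) = (h : ℂ) := by
    rw [← Complex.ofReal_mul, Real.mul_self_sqrt hh]
  have hRR : Rᴴ = R := by
    simp [hR, Matrix.conjTranspose_sub, Matrix.conjTranspose_smul, hG, decayOp_isHermitian]
  have hB : decayOp B = 1 + ((h ^ 2 / 4 : ℝ) : ℂ) • (G * G) := by
    rw [decayOp, Fintype.sum_option]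
    simp only [B, Option.elim, Matrix.conjTranspose_smul, Complex.star_def, Complex.conj_ofReal,
      smul_mul_assoc, mul_smul_comm, smul_smul, hsq, ← Finset.smul_sum, hRR]
    rw [← decayOp, ← hG, hR]
    simp only [mul_sub, sub_mul, mul_one, one_mul, smul_mul_assoc, mul_smul_comm]
    push_cast
    module
  have hsum : O + (h : ℂ) • heis s K O =
      ∑ a, s' a • ((B a)ᴴ * O * B a) - ((h ^ 2 / 4 : ℝ) : ℂ) • (G * O * G) := by
    rw [Fintype.sum_option]
    simp only [B, s', Option.elim, Matrix.conjTranspose_smul, Complex.star_def,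
      Complex.conj_ofReal, smul_mul_assoc, mul_smul_comm, smul_smul, hRR]
    rw [heis_apply, ← hG, hR]
    have : ∑ x, (s * ((√h : ℝ) : ℂ) * ((√h : ℝ) : ℂ)) • ((K x)ᴴ * O * K x) =
        (h : ℂ) • s • ∑ x, (K x)ᴴ * O * K x := by
      rw [mul_assoc, hsq, ← Finset.smul_sum, smul_smul, mul_comm]
    simp only [← mul_assoc] at this ⊢
    rw [this]
    simp only [mul_sub, sub_mul, mul_one, one_mul, smul_mul_assoc, mul_smul_comm]
    push_cast
    module
  rw [hsum]
  refine (norm_sub_le _ _).trans ?_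
  have h1 := norm_sum_conj_le s' (by rintro (_ | a) <;> simp [s', hns]) B O
  have hone : ‖(1 : Matrix n n ℂ)‖ ≤ 1 := by
    rw [← Matrix.diagonal_one, Matrix.l2_opNorm_diagonal]
    exact (pi_norm_le_iff_of_nonneg zero_le_one).mpr fun i => by simp
  have h2 : ‖decayOp B‖ ≤ 1 + h ^ 2 / 4 * ‖G‖ ^ 2 := by
    rw [hB]
    refine (norm_add_le _ _).trans (add_le_add hone ?_)
    rw [norm_smul, Complex.norm_real, Real.norm_of_nonneg (by positivity), sq ‖G‖]
    gcongr
    exact norm_mul_le _ _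
  have h3 : ‖((h ^ 2 / 4 : ℝ) : ℂ) • (G * O * G)‖ ≤ h ^ 2 / 4 * (‖G‖ * ‖O‖ * ‖G‖) := by
    rw [norm_smul, Complex.norm_real, Real.norm_of_nonneg (by positivity)]
    gcongr
    exact (norm_mul_le _ _).trans (by gcongr; exact norm_mul_le _ _)
  have h4 : ‖decayOp B‖ * ‖O‖ ≤ (1 + h ^ 2 / 4 * ‖G‖ ^ 2) * ‖O‖ := by gcongr
  calc _ ≤ _ := add_le_add (h1.trans h4) h3
    _ = _ := by ring

/-- The Heisenberg dynamics. -/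
def heisEvolve (K : ι → Matrix n n ℂ) (t : ℝ) (O : Matrix n n ℂ) : Matrix n n ℂ :=
  NormedSpace.exp ((t : ℂ) • heis 1 K) O

lemma hasDerivAt_heisEvolve (K : ι → Matrix n n ℂ) (O : Matrix n n ℂ) (t : ℝ) :
    HasDerivAt (fun t => heisEvolve K t O) (heis 1 K (heisEvolve K t O)) t :=
  hasDerivAt_exp_apply _ _ _

lemma heis_heisEvolve (K : ι → Matrix n n ℂ) (O : Matrix n n ℂ) (t : ℝ) :
    heis 1 K (heisEvolve K t O) = heisEvolve K t (heis 1 K O) :=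
  exp_apply_comm _ _ _

lemma norm_heisEvolve_le (K : ι → Matrix n n ℂ) (O : Matrix n n ℂ) {t : ℝ} (ht : 0 ≤ t) :
    ‖heisEvolve K t O‖ ≤ ‖O‖ := by
  have := norm_exp_apply_le (heis 1 K) (ContinuousLinearMap.id ℂ _) (κ := 0)
    (C := ‖decayOp K‖ ^ 2 / 2) (fun x h hh => by
      simpa using norm_add_heis_le (Or.inl rfl) K x hh.1.le) O ht
  rw [neg_zero, zero_mul, Real.exp_zero, one_mul] at this
  exact this

lemma heisEvolve_zero_time (K : ι → Matrix n n ℂ) (O : Matrix n n ℂ) : heisEvolve K 0 O = O :=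
  exp_zero_smul_apply _ _

lemma eq_of_hasDerivAt_zero {E : Type*} [NormedAddCommGroup E] [NormedSpace ℝ E] {u : ℝ → E}
    (h : ∀ t, HasDerivAt u 0 t) (s t : ℝ) : u s = u t :=
  is_const_of_deriv_eq_zero (fun x => (h x).differentiableAt) (fun x => (h x).deriv) s t

lemma heisEvolve_one (K : ι → Matrix n n ℂ) (t : ℝ) : heisEvolve K t 1 = 1 := by
  have h : ∀ t, HasDerivAt (fun t => heisEvolve K t 1) 0 t := fun t => by
    have := hasDerivAt_heisEvolve K 1 t
    rw [heis_heisEvolve, heis_one] at this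
    simpa [heisEvolve] using this
  rw [eq_of_hasDerivAt_zero h t 0, heisEvolve_zero_time]

end Heisenberg

/-! ### Gradient estimates -/

/-- A summable weight that decreases with the distance `d`. -/
structure IsWeight {V : Type} [Fintype V] (d : V → V → ℕ) (w : V → V → ℝ) (Z : ℝ) : Prop where
  nonneg : ∀ x y, 0 ≤ w x y
  le_one : ∀ x y, w x y ≤ 1
  anti : ∀ x y z, d x y ≤ d x z → w x z ≤ w x y
  symm : ∀ x y, w x y = w y x
  sum_le : ∀ x, ∑ y, w x y ≤ Z

section Gradient

variable {V : Type} [LinearOrder V] [Fintype V]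

/-- The commutators with all ladder operators. -/
def grad : FockOp V →L[ℂ] (V × Bool → FockOp V) :=
  ContinuousLinearMap.pi fun b => LinearMap.toContinuousLinearMap
    (LinearMap.mulLeft ℂ (ladder b) - LinearMap.mulRight ℂ (ladder b))

lemma grad_apply (O : FockOp V) (b : V × Bool) :
    grad O b = ladder b * O - O * ladder b := rfl

/-- The anticommutator with a ladder operator. -/
def acomm (b : V × Bool) (X : FockOp V) : FockOp V := ladder b * X + X * ladder b

lemma norm_commutator_ladder_le (b : V × Bool) (X : FockOp V) :
    ‖ladder b * X - X * ladder b‖ ≤ 2 * ‖X‖ := by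
  have h1 := norm_sub_le (ladder b * X) (X * ladder b)
  have h2 := norm_mul_le (ladder b) X
  have h3 := norm_mul_le X (ladder b)
  nlinarith [norm_ladder_le b, norm_nonneg X]

lemma norm_acomm_le (b : V × Bool) (X : FockOp V) : ‖acomm b X‖ ≤ 2 * ‖X‖ := by
  have h1 := norm_add_le (ladder b * X) (X * ladder b)
  have h2 := norm_mul_le (ladder b) X
  have h3 := norm_mul_le X (ladder b)
  unfold acomm
  nlinarith [norm_ladder_le b, norm_nonneg X]

lemma norm_grad_le (O : FockOp V) : ‖grad O‖ ≤ 2 * ‖O‖ :=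
  (pi_norm_le_iff_of_nonneg (by positivity)).mpr fun b => norm_commutator_ladder_le b O

lemma acomm_star (b : V × Bool) (X : FockOp V) : acomm b (star X) = star (acomm (flip b) X) := by
  simp only [acomm, star_add, star_mul, star_ladder, flip_flip]
  rw [add_comm]

lemma norm_grad_star (O : FockOp V) : ‖grad (star O)‖ = ‖grad O‖ := by
  have h : ∀ O : FockOp V, ‖grad (star O)‖ ≤ ‖grad O‖ := fun O => by
    refine (pi_norm_le_iff_of_nonneg (norm_nonneg _)).mpr fun b => ?_
    have h1 : grad (star O) b = -star (grad O (flip b)) := by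
      simp only [grad_apply, star_sub, star_mul, star_ladder, flip_flip]
      abel
    rw [h1, norm_neg, norm_star]
    exact norm_le_pi_norm _ _
  exact le_antisymm (h O) (by simpa using h (star O))

lemma norm_defect_le (σ : ℂ) (j : V × Bool) (X : FockOp V) :
    ‖defect σ j X‖ ≤ ‖ladder (j.1, true) * X - σ • (X * ladder (j.1, true))‖ +
      ‖ladder (j.1, false) * X - σ • (X * ladder (j.1, false))‖ := by
  rcases j with ⟨i, b⟩
  cases b
  · have : defect σ (i, false) X = Complex.I • ((ladder (i, true) * X - σ • (X * ladder (i, true))) -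
        (ladder (i, false) * X - σ • (X * ladder (i, false)))) := by
      simp only [defect, majorana, Bool.false_eq_true, if_false, smul_mul_assoc, mul_smul_comm,
        mul_sub, sub_mul]
      module
    rw [this, norm_smul, Complex.norm_I, one_mul]
    exact norm_sub_le _ _
  · have : defect σ (i, true) X = (ladder (i, true) * X - σ • (X * ladder (i, true))) +
        (ladder (i, false) * X - σ • (X * ladder (i, false))) := by
      simp only [defect, majorana, if_true, mul_add, add_mul]
      module
    rw [this]
    exact norm_add_le _ _

lemma norm_defect_one_le (j : V × Bool) (O : FockOp V) : ‖defect 1 j O‖ ≤ 2 * ‖grad O‖ := by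
  refine (norm_defect_le 1 j O).trans ?_
  have h1 := norm_le_pi_norm (grad O) (j.1, true)
  have h2 := norm_le_pi_norm (grad O) (j.1, false)
  rw [grad_apply] at h1 h2
  rw [one_smul, one_smul]
  linarith

lemma sum_prod_bool (g : V → ℝ) : ∑ a : V × Bool, g a.1 = 2 * ∑ i, g i := by
  rw [Fintype.sum_prod_type, Finset.mul_sum]
  exact Finset.sum_congr rfl fun i _ => by simp [two_mul]

/-- Commutators with quasi-local operators are controlled by the gradient. -/
lemma norm_commutator_le_grad {d : V → V → ℕ} {w : V → V → ℝ} {Z : ℝ} (hw : IsWeight d w Z)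
    {σ : ℂ} (hσ : σ = 1 ∨ σ = -1) {X : FockOp V} (hP : parity * X = σ • (X * parity))
    {β : ℝ} (hβ : 0 ≤ β) (a : V)
    (hX : ∀ k, ‖ladder k * X - σ • (X * ladder k)‖ ≤ β * w a k.1 ^ 2) (O : FockOp V) :
    ‖O * X - X * O‖ ≤ 16 * β * Z ^ 2 * ‖grad O‖ := by
  refine (norm_commutator_le_of_defect hσ (fun k => d a k.1) hP O).trans ?_
  have h1 : ∀ k, ‖defect σ k X‖ ≤ 2 * (β * w a k.1 ^ 2) := fun k =>
    (norm_defect_le σ k X).trans (by linarith [hX (k.1, true), hX (k.1, false)])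
  have h2 : ∀ j : V × Bool, ∑ k : V × Bool with d a j.1 ≤ d a k.1, ‖defect σ k X‖ ≤
      w a j.1 * (2 * β * (2 * Z)) := by
    intro j
    -- Since `k` is at least as far from `a` as `j`, one of the two factors `w a k` may be traded
    -- for `w a j`; both sums then converge.
    calc _ ≤ ∑ k : V × Bool with d a j.1 ≤ d a k.1, 2 * (β * (w a j.1 * w a k.1)) := by
          refine Finset.sum_le_sum fun k hk => (h1 k).trans ?_
          rw [sq]
          have := hw.anti a j.1 k.1 (Finset.mem_filter.mp hk).2
          have := hw.nonneg a k.1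
          gcongr
      _ ≤ ∑ k : V × Bool, 2 * (β * (w a j.1 * w a k.1)) := by
          refine Finset.sum_le_sum_of_subset_of_nonneg (Finset.filter_subset _ _) fun k _ _ => ?_
          have := hw.nonneg a k.1
          have := hw.nonneg a j.1
          positivity
      _ = w a j.1 * (2 * β * ∑ k : V × Bool, w a k.1) := by
          simp only [Finset.mul_sum]
          exact Finset.sum_congr rfl fun k _ => by ring
      _ ≤ _ := by
          rw [sum_prod_bool]
          have := hw.sum_le a
          have := hw.nonneg a j.1
          gcongr
  have hZ : 0 ≤ Z := (Finset.sum_nonneg fun y _ => hw.nonneg a y).trans (hw.sum_le a)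
  calc _ ≤ ∑ j : V × Bool, 2 * ‖grad O‖ * (w a j.1 * (2 * β * (2 * Z))) := by
        refine Finset.sum_le_sum fun j _ => ?_
        exact mul_le_mul (norm_defect_one_le j O) (h2 j)
          (Finset.sum_nonneg fun _ _ => norm_nonneg _) (by positivity)
    _ = 2 * ‖grad O‖ * (2 * β * (2 * Z)) * ∑ j : V × Bool, w a j.1 := by
        rw [Finset.mul_sum]
        exact Finset.sum_congr rfl fun k _ => by ring
    _ ≤ 2 * ‖grad O‖ * (2 * β * (2 * Z)) * (2 * Z) := by
        rw [sum_prod_bool]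
        have := hw.sum_le a
        gcongr
    _ = _ := by ring

/-- The jump operators of the quadratic Hamiltonian. -/
def freeJump (a : V × Bool) : FockOp V := if a.2 then 0 else annihilation a.1

/-- Quasi-local odd jump operators, close to those of the quadratic Hamiltonian. -/
structure JumpBounds (w : V → V → ℝ) (K : V × Bool → FockOp V) (κ₀ C δ : ℝ) : Prop where
  odd : ∀ a, parity * K a = -(K a * parity)
  norm_le : ∀ a, ‖K a‖ ≤ κ₀
  decay : ∀ a k, ‖acomm k (K a)‖ ≤ C * w a.1 k.1 ^ 4
  close : ∀ a k, ‖acomm k (K a - freeJump a)‖ ≤ δ * w a.1 k.1 ^ 4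

/-- Here `k` stands for `K†`. The first bracket is the dissipator on `[c, O]` with the jump term
negated, because `c` is moved past odd operators. The second one contains only terms with an
anticommutator of `c` with `k` or `K`; these are scalar for the free jump operators. -/
lemma commutator_dissipator {R : Type*} [Ring R] (c k K O : R) :
    c * (2 * (k * O * K) - k * K * O - O * (k * K)) -
        (2 * (k * O * K) - k * K * O - O * (k * K)) * c =
      (-(2 * (k * (c * O - O * c) * K)) - k * K * (c * O - O * c) - (c * O - O * c) * (k * K)) +
      ((c * k + k * c) * (O * K - K * O) - k * (O * (c * K + K * c) - (c * K + K * c) * O) -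
        (O * (c * k + k * c) - (c * k + k * c) * O) * K - (k * O - O * k) * (c * K + K * c)) := by
  noncomm_ring

lemma heis_eq_sum (s : ℂ) (K : V × Bool → FockOp V) (O : FockOp V) :
    heis s K O = (1 / 2 : ℂ) • ∑ a, (s • (2 * (star (K a) * O * K a)) - star (K a) * K a * O -
      O * (star (K a) * K a)) := by
  rw [heis_apply, decayOp]
  simp only [Finset.sum_sub_distrib, Finset.sum_mul, Finset.mul_sum, Finset.smul_sum,
    Matrix.star_eq_conjTranspose, smul_sub, smul_add, ← Finset.sum_add_distrib]
  rw [← Finset.sum_sub_distrib, ← Finset.sum_sub_distrib, ← Finset.sum_sub_distrib]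
  refine Finset.sum_congr rfl fun a _ => ?_
  rw [two_mul]
  module

lemma commutator_heis (K : V × Bool → FockOp V) (O c : FockOp V) :
    c * heis 1 K O - heis 1 K O * c = heis (-1) K (c * O - O * c) + (1 / 2 : ℂ) • ∑ a,
      ((c * star (K a) + star (K a) * c) * (O * K a - K a * O) -
        star (K a) * (O * (c * K a + K a * c) - (c * K a + K a * c) * O) -
        (O * (c * star (K a) + star (K a) * c) - (c * star (K a) + star (K a) * c) * O) * K a -
        (star (K a) * O - O * star (K a)) * (c * K a + K a * c)) := by
  rw [heis_eq_sum, heis_eq_sum, mul_smul_comm, smul_mul_assoc, ← smul_sub, ← smul_add,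
    Finset.mul_sum, Finset.sum_mul, ← Finset.sum_sub_distrib, ← Finset.sum_add_distrib]
  congr 1
  refine Finset.sum_congr rfl fun a _ => ?_
  rw [one_smul, neg_smul, one_smul]
  exact commutator_dissipator _ _ _ _

lemma parity_mul_freeJump (a : V × Bool) :
    parity * freeJump a = -(freeJump a * parity) := by
  unfold freeJump
  split_ifs
  · simp
  · exact parity_mul_annihilation a.1

lemma acomm_annihilation_freeJump (b : V) (a : V × Bool) :
    acomm (b, false) (freeJump a) = 0 := by
  unfold freeJump acomm
  split_ifs
  · simp
  · simpa [ladder] using annihilation_anticomm b a.1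

lemma acomm_annihilation_star_freeJump (b : V) (a : V × Bool) :
    acomm (b, false) (star (freeJump a)) = if a = (b, false) then 1 else 0 := by
  rcases a with ⟨i, x⟩
  cases x
  · have := annihilation_creation_anticomm b i
    simpa [freeJump, acomm, ladder, creation, Matrix.star_eq_conjTranspose, eq_comm] using this
  · simp [freeJump, acomm]

lemma acomm_add (b : V × Bool) (X Y : FockOp V) : acomm b (X + Y) = acomm b X + acomm b Y := by
  simp only [acomm]; noncomm_ring

lemma parity_mul_acomm (b : V × Bool) {X : FockOp V} (hX : parity * X = -(X * parity)) :
    parity * acomm b X = acomm b X * parity := by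
  have h := parity_mul_ladder b
  unfold acomm
  rw [mul_add, ← mul_assoc, ← mul_assoc, h, hX, add_mul, neg_mul, neg_mul, mul_assoc, mul_assoc,
    h, hX]
  simp [mul_assoc]

/-- By the graded Jacobi identity `[c_k, {c_b, X}] = [{c_k, c_b}, X] - [c_b, {c_k, X}]`, and `{c_k,
c_b}` is a scalar. -/
lemma norm_commutator_acomm_le (b k : V × Bool) (X : FockOp V) :
    ‖ladder k * acomm b X - acomm b X * ladder k‖ ≤ 2 * ‖acomm k X‖ := by
  have h1 : ladder k * acomm b X - acomm b X * ladder k =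
      (ladder k * ladder b + ladder b * ladder k) * X - X * (ladder k * ladder b + ladder b * ladder k)
        - (ladder b * acomm k X - acomm k X * ladder b) := by
    unfold acomm; noncomm_ring
  have h2 : (ladder k * ladder b + ladder b * ladder k) * X =
      X * (ladder k * ladder b + ladder b * ladder k) := by
    rw [ladder_anticomm]; split_ifs <;> simp
  rw [h1, h2, sub_self, zero_sub, norm_neg]
  exact norm_commutator_ladder_le b _

section Euler

variable {d : V → V → ℕ} {w : V → V → ℝ} {Z : ℝ} {K : V × Bool → FockOp V} {κ₀ C δ : ℝ}

lemma neg_one_smul_iff {X : FockOp V} (h : parity * X = -(X * parity)) :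
    parity * X = (-1 : ℂ) • (X * parity) := by rw [h, neg_one_smul]

lemma star_odd {X : FockOp V} (h : parity * X = -(X * parity)) :
    parity * star X = -(star X * parity) := by
  have := congrArg star h
  rw [star_neg, star_mul, star_mul, star_parity] at this
  rw [this, neg_neg]

lemma norm_commutator_odd_le (hw : IsWeight d w Z) {X : FockOp V}
    (hX : parity * X = -(X * parity)) {β : ℝ} (hβ : 0 ≤ β) (a : V)
    (h : ∀ k, ‖acomm k X‖ ≤ β * w a k.1 ^ 4) (O : FockOp V) :
    ‖O * X - X * O‖ ≤ 16 * β * Z ^ 2 * ‖grad O‖ := by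
  refine norm_commutator_le_grad hw (Or.inr rfl) (neg_one_smul_iff hX) hβ a (fun k => ?_) O
  rw [neg_one_smul, sub_neg_eq_add]
  refine (h k).trans ?_
  have h0 := hw.nonneg a k.1
  have h1 := hw.le_one a k.1
  exact mul_le_mul_of_nonneg_left (pow_le_pow_of_le_one h0 h1 (by norm_num)) hβ

/-- The commutator of `ladder k` with `{ladder b, X}` is small if `b` is far from `a`, and also if
`k` is. The smaller of the two fourth powers of the weight is at most `w a b ^ 2 * w a k ^ 2`: one
factor decays in `b` and the other serves the quasi-local commutator bound. -/
lemma norm_commutator_acomm_odd_le (hw : IsWeight d w Z) {X : FockOp V}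
    (hX : parity * X = -(X * parity)) {β : ℝ} (hβ : 0 ≤ β) (a : V) (b : V × Bool)
    (h : ∀ k, ‖acomm k X‖ ≤ β * w a k.1 ^ 4) (O : FockOp V) :
    ‖O * acomm b X - acomm b X * O‖ ≤ 32 * β * w a b.1 ^ 2 * Z ^ 2 * ‖grad O‖ := by
  have hb := hw.nonneg a b.1
  have hβ' : 0 ≤ 2 * β * w a b.1 ^ 2 := by positivity
  have hP : parity * acomm b X = (1 : ℂ) • (acomm b X * parity) := by
    rw [one_smul]; exact parity_mul_acomm b hX
  suffices hk : ∀ k, ‖ladder k * acomm b X - (1 : ℂ) • (acomm b X * ladder k)‖ ≤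
      2 * β * w a b.1 ^ 2 * w a k.1 ^ 2 by
    refine (norm_commutator_le_grad hw (Or.inl rfl) hP hβ' a hk O).trans (le_of_eq ?_)
    ring
  intro k
  rw [one_smul]
  have h1 := norm_commutator_acomm_le b k X
  have h2 := norm_commutator_ladder_le k (acomm b X)
  have h3 := h k
  have h4 := h b
  have hk := hw.nonneg a k.1
  rcases le_total (w a k.1) (w a b.1) with hle | hle
  · calc _ ≤ 2 * (β * w a k.1 ^ 4) := by linarith
      _ = 2 * β * w a k.1 ^ 2 * w a k.1 ^ 2 := by ring
      _ ≤ _ := by gcongr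
  · calc _ ≤ 2 * (β * w a b.1 ^ 4) := by linarith
      _ = 2 * β * w a b.1 ^ 2 * w a b.1 ^ 2 := by ring
      _ ≤ _ := by gcongr

/-- The constant in the gradient estimate. -/
def gradConst (Z κ₀ C : ℝ) : ℝ := 32 * C * Z ^ 3 + 64 * κ₀ * Z ^ 3 + 8 * Z ^ 2

/-- With `K = freeJump + Y` the free part contributes `{c_b, c_b†} = 1` for the single label `(b,
false)`, which produces the damping `-1/2`. Every other term contains a factor `Y`, hence a `δ`,
together with a commutator of `O` with a quasi-local operator; the weights make the sum over `a`
independent of the system size. -/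
lemma norm_commutator_heis_sub_le (hw : IsWeight d w Z) (hK : JumpBounds w K κ₀ C δ) (hC : 0 ≤ C)
    (hδ : 0 ≤ δ) (b : V) (O : FockOp V) :
    ‖ladder (b, false) * heis 1 K O - heis 1 K O * ladder (b, false) -
      (heis (-1) K (grad O (b, false)) - (1 / 2 : ℂ) • grad O (b, false))‖ ≤
      δ * gradConst Z κ₀ C * ‖grad O‖ := by
  set c : FockOp V := ladder (b, false) with hc
  set Y : V × Bool → FockOp V := fun a => K a - freeJump a with hY
  have hκ : 0 ≤ κ₀ := (norm_nonneg _).trans (hK.norm_le (b, false))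
  have hZ : 0 ≤ Z := (Finset.sum_nonneg fun y _ => hw.nonneg b y).trans (hw.sum_le b)
  have hYodd : ∀ a, parity * Y a = -(Y a * parity) := fun a => by
    simp only [hY, mul_sub, sub_mul, hK.odd a, parity_mul_freeJump]; abel
  have hF : ∀ a, c * K a + K a * c = acomm (b, false) (Y a) := fun a => by
    have : K a = Y a + freeJump a := by simp [hY]
    change acomm (b, false) (K a) = _
    rw [this, acomm_add, acomm_annihilation_freeJump, add_zero]
  have hG : ∀ a, c * star (K a) + star (K a) * c =
      acomm (b, false) (star (Y a)) + if a = (b, false) then 1 else 0 := fun a => by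
    have : K a = Y a + freeJump a := by simp [hY]
    change acomm (b, false) (star (K a)) = _
    rw [this, star_add, acomm_add, acomm_annihilation_star_freeJump]
  set g : V × Bool → FockOp V := fun a => acomm (b, false) (star (Y a)) with hg
  set f : V × Bool → FockOp V := fun a => acomm (b, false) (Y a) with hf
  have hsum : ladder (b, false) * heis 1 K O - heis 1 K O * ladder (b, false) -
      (heis (-1) K (grad O (b, false)) - (1 / 2 : ℂ) • grad O (b, false)) =
      (1 / 2 : ℂ) • ((O * Y (b, false) - Y (b, false) * O) +
        ∑ a, (g a * (O * K a - K a * O) - star (K a) * (O * f a - f a * O) -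
          (O * g a - g a * O) * K a - (star (K a) * O - O * star (K a)) * f a)) := by
    rw [commutator_heis, grad_apply]
    simp only [← hc, hF, hG]
    have h1 : ∀ a, (g a + if a = (b, false) then 1 else 0) * (O * K a - K a * O) -
        star (K a) * (O * f a - f a * O) -
        (O * (g a + if a = (b, false) then 1 else 0) - (g a + if a = (b, false) then 1 else 0) * O) * K a -
        (star (K a) * O - O * star (K a)) * f a =
        (g a * (O * K a - K a * O) - star (K a) * (O * f a - f a * O) -
          (O * g a - g a * O) * K a - (star (K a) * O - O * star (K a)) * f a) +
        if a = (b, false) then O * K a - K a * O else 0 := by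
      intro a
      split_ifs
      · noncomm_ring
      · simp
    change _ + (1 / 2 : ℂ) • ∑ a, ((g a + if a = (b, false) then 1 else 0) * (O * K a - K a * O) -
        star (K a) * (O * f a - f a * O) -
        (O * (g a + if a = (b, false) then 1 else 0) - (g a + if a = (b, false) then 1 else 0) * O) * K a -
        (star (K a) * O - O * star (K a)) * f a) - _ = _
    simp only [h1]
    rw [Finset.sum_add_distrib, Finset.sum_ite_eq' Finset.univ (b, false), if_pos (Finset.mem_univ _)]
    -- The damping term: `[O, K]` at the label `(b, false)` is `-[c_b, O]` up to the deviation `Y`.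
    have h2 : O * K (b, false) - K (b, false) * O =
        (O * Y (b, false) - Y (b, false) * O) - (c * O - O * c) := by
      have : K (b, false) = Y (b, false) + c := by simp [hY, freeJump, hc, ladder]
      rw [this]; noncomm_ring
    rw [h2]
    module
  rw [hsum, norm_smul]
  have hstarY : ∀ a k, ‖acomm k (star (Y a))‖ ≤ δ * w a.1 k.1 ^ 4 := fun a k => by
    rw [acomm_star, norm_star]
    exact hK.close a (flip k)
  have hstarK : ∀ a k, ‖acomm k (star (K a))‖ ≤ C * w a.1 k.1 ^ 4 := fun a k => by
    rw [acomm_star, norm_star]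
    exact hK.decay a (flip k)
  have b0 : ‖O * Y (b, false) - Y (b, false) * O‖ ≤ 16 * δ * Z ^ 2 * ‖grad O‖ :=
    norm_commutator_odd_le hw (hYodd _) hδ b (hK.close (b, false)) O
  have hw4 : ∀ a, w a b ^ 4 ≤ w a b ∧ w a b ^ 2 ≤ w a b := fun a =>
    ⟨pow_le_of_le_one (hw.nonneg _ _) (hw.le_one _ _) (by norm_num),
      pow_le_of_le_one (hw.nonneg _ _) (hw.le_one _ _) (by norm_num)⟩
  have hterm : ∀ a, ‖g a * (O * K a - K a * O) - star (K a) * (O * f a - f a * O) -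
          (O * g a - g a * O) * K a - (star (K a) * O - O * star (K a)) * f a‖ ≤
      w a.1 b * (δ * Z ^ 2 * ‖grad O‖ * (32 * C + 64 * κ₀)) := by
    intro a
    have hwn := hw.nonneg a.1 b
    have e1 : ‖g a‖ ≤ δ * w a.1 b := (hstarY a (b, false)).trans (by gcongr; exact (hw4 a.1).1)
    have e2 : ‖f a‖ ≤ δ * w a.1 b := (hK.close a (b, false)).trans (by gcongr; exact (hw4 a.1).1)
    have e3 : ‖O * K a - K a * O‖ ≤ 16 * C * Z ^ 2 * ‖grad O‖ :=
      norm_commutator_odd_le hw (hK.odd a) hC a.1 (hK.decay a) O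
    have e4 : ‖star (K a) * O - O * star (K a)‖ ≤ 16 * C * Z ^ 2 * ‖grad O‖ := by
      rw [norm_sub_rev]
      exact norm_commutator_odd_le hw (star_odd (hK.odd a)) hC a.1 (hstarK a) O
    have e5 : ‖O * f a - f a * O‖ ≤ 32 * δ * w a.1 b * Z ^ 2 * ‖grad O‖ :=
      (norm_commutator_acomm_odd_le hw (hYodd a) hδ a.1 (b, false) (hK.close a) O).trans
        (by gcongr; exact (hw4 a.1).2)
    have e6 : ‖O * g a - g a * O‖ ≤ 32 * δ * w a.1 b * Z ^ 2 * ‖grad O‖ :=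
      (norm_commutator_acomm_odd_le hw (star_odd (hYodd a)) hδ a.1 (b, false) (hstarY a) O).trans
        (by gcongr; exact (hw4 a.1).2)
    have e7 := hK.norm_le a
    have e8 : ‖star (K a)‖ ≤ κ₀ := by rw [norm_star]; exact e7
    refine (norm_sub_le _ _).trans ?_
    refine (add_le_add ((norm_sub_le _ _).trans (add_le_add (norm_sub_le _ _) le_rfl)) le_rfl).trans ?_
    calc _ ≤ δ * w a.1 b * (16 * C * Z ^ 2 * ‖grad O‖) + κ₀ * (32 * δ * w a.1 b * Z ^ 2 * ‖grad O‖) +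
          (32 * δ * w a.1 b * Z ^ 2 * ‖grad O‖) * κ₀ + (16 * C * Z ^ 2 * ‖grad O‖) * (δ * w a.1 b) := by
          gcongr
          · exact (norm_mul_le _ _).trans (by gcongr)
          · exact (norm_mul_le _ _).trans (by gcongr)
          · exact (norm_mul_le _ _).trans (by gcongr)
          · exact (norm_mul_le _ _).trans (by gcongr)
      _ = _ := by ring
  have hs : ∑ a : V × Bool, w a.1 b ≤ 2 * Z := by
    rw [sum_prod_bool fun i => w i b]
    have := hw.sum_le b
    simp only [hw.symm b] at this
    linarith
  have htot : ‖∑ a, (g a * (O * K a - K a * O) - star (K a) * (O * f a - f a * O) -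
          (O * g a - g a * O) * K a - (star (K a) * O - O * star (K a)) * f a)‖ ≤
      2 * Z * (δ * Z ^ 2 * ‖grad O‖ * (32 * C + 64 * κ₀)) := by
    refine (norm_sum_le _ _).trans ((Finset.sum_le_sum fun a _ => hterm a).trans ?_)
    rw [← Finset.sum_mul]
    gcongr
  have := norm_add_le (O * Y (b, false) - Y (b, false) * O) (∑ a, (g a * (O * K a - K a * O) -
    star (K a) * (O * f a - f a * O) - (O * g a - g a * O) * K a -
    (star (K a) * O - O * star (K a)) * f a))
  rw [show ‖(1 / 2 : ℂ)‖ = 1 / 2 by norm_num]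
  unfold gradConst
  linarith

lemma norm_grad_euler_le (hw : IsWeight d w Z) (hK : JumpBounds w K κ₀ C δ) (hC : 0 ≤ C)
    (hδ : 0 ≤ δ) (O : FockOp V) {h : ℝ} (hh : h ∈ Set.Ioc (0 : ℝ) 1) :
    ‖grad (O + (h : ℂ) • heis 1 K O)‖ ≤ (1 - (1 / 2 - δ * gradConst Z κ₀ C) * h +
      (‖decayOp K‖ ^ 2 / 2 + ‖heis (-1) K‖ / 2) * h ^ 2) * ‖grad O‖ := by
  obtain ⟨h0, h1⟩ := hh
  have main : ∀ (O : FockOp V) (b : V), ‖grad (O + (h : ℂ) • heis 1 K O) (b, false)‖ ≤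
      (1 - (1 / 2 - δ * gradConst Z κ₀ C) * h +
      (‖decayOp K‖ ^ 2 / 2 + ‖heis (-1) K‖ / 2) * h ^ 2) * ‖grad O‖ := by
    intro O b
    have e1 := norm_commutator_heis_sub_le hw hK hC hδ b O
    set R := ladder (b, false) * heis 1 K O - heis 1 K O * ladder (b, false) -
      (heis (-1) K (grad O (b, false)) - (1 / 2 : ℂ) • grad O (b, false)) with hR
    -- The damping is factored out as `1 - h/2`, so that it multiplies an Euler step of the
    -- contractive sign-reversed generator; the price is a term of order `h²`.
    have e2 : grad (O + (h : ℂ) • heis 1 K O) (b, false) =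
        ((1 - h / 2 : ℝ) : ℂ) • (grad O (b, false) + (h : ℂ) • heis (-1) K (grad O (b, false))) +
        ((h ^ 2 / 2 : ℝ) : ℂ) • heis (-1) K (grad O (b, false)) + (h : ℂ) • R := by
      rw [hR, grad_apply, grad_apply, mul_add, add_mul, mul_smul_comm, smul_mul_assoc]
      push_cast
      module
    have e3 := norm_add_heis_le (Or.inr rfl) K (grad O (b, false)) h0.le
    have e4 := (heis (-1) K).le_opNorm (grad O (b, false))
    have e5 := norm_le_pi_norm (grad O) (b, false)
    rw [e2]
    refine (norm_add_le _ _).trans ((add_le_add (norm_add_le _ _) le_rfl).trans ?_)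
    rw [norm_smul, norm_smul, norm_smul, Complex.norm_real, Complex.norm_real, Complex.norm_real,
      Real.norm_of_nonneg h0.le, Real.norm_of_nonneg (show 0 ≤ 1 - h / 2 by linarith),
      Real.norm_of_nonneg (show 0 ≤ h ^ 2 / 2 by positivity)]
    set G := ‖grad O‖
    set q := ‖decayOp K‖ ^ 2 / 2
    have hq : 0 ≤ q := by positivity
    have e6 : (1 - h / 2) * ‖grad O (b, false) + (h : ℂ) • heis (-1) K (grad O (b, false))‖ ≤
        (1 - h / 2) * ((1 + q * h ^ 2) * G) := by
      apply mul_le_mul_of_nonneg_left _ (by linarith)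
      exact e3.trans (by gcongr)
    have e7 : h ^ 2 / 2 * ‖heis (-1) K (grad O (b, false))‖ ≤ h ^ 2 / 2 * (‖heis (-1) K‖ * G) := by
      gcongr
      exact e4.trans (by gcongr)
    have e8 : h * ‖R‖ ≤ h * (δ * gradConst Z κ₀ C * G) := by gcongr
    have e9 : 0 ≤ h / 2 * (q * h ^ 2) * G := by positivity
    calc _ ≤ _ := add_le_add (add_le_add e6 e7) e8
      _ = (1 - (1 / 2 - δ * gradConst Z κ₀ C) * h +
            (q + ‖heis (-1) K‖ / 2) * h ^ 2) * G - h / 2 * (q * h ^ 2) * G := by ring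
      _ ≤ _ := by linarith
  rcases isEmpty_or_nonempty V with hV | ⟨⟨v⟩⟩
  · have : grad O = 0 := by ext a; exact (hV.false a.1).elim
    have h2 : grad (O + (h : ℂ) • heis 1 K O) = 0 := by ext a; exact (hV.false a.1).elim
    rw [this, h2, norm_zero, mul_zero]
  refine (pi_norm_le_iff_of_nonneg ((norm_nonneg _).trans (main O v))).mpr ?_
  rintro ⟨b, x⟩
  cases x
  · exact main O b
  -- The creation components follow from the annihilation components of `star O`, since the
  -- generator commutes with the adjoint.
  · have e1 := main (star O) b
    rw [norm_grad_star] at e1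
    refine le_trans (le_of_eq ?_) e1
    have e2 : star O + (h : ℂ) • heis 1 K (star O) = star (O + (h : ℂ) • heis 1 K O) := by
      rw [Matrix.star_eq_conjTranspose, heis_conjTranspose, star_add, star_smul]
      simp [Matrix.star_eq_conjTranspose]
    rw [e2]
    have e3 : ∀ X : FockOp V, grad X (b, true) = -star (grad (star X) (b, false)) := by
      intro X
      simp only [grad_apply, star_sub, star_mul, star_ladder, flip, Bool.not_false, star_star]
      abel
    rw [e3, norm_neg, norm_star]

/-- Exponential decay of the gradient along the Heisenberg dynamics. -/
lemma norm_grad_heisEvolve_le (hw : IsWeight d w Z) (hK : JumpBounds w K κ₀ C δ) (hC : 0 ≤ C)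
    (hδ : 0 ≤ δ) (hsmall : δ * gradConst Z κ₀ C ≤ 1 / 4) (O : FockOp V) {t : ℝ} (ht : 0 ≤ t) :
    ‖grad (heisEvolve K t O)‖ ≤ Real.exp (-(t / 4)) * ‖grad O‖ := by
  have := norm_exp_apply_le (heis 1 K) grad (κ := 1 / 2 - δ * gradConst Z κ₀ C)
    (fun x h hh => norm_grad_euler_le hw hK hC hδ x hh) O ht
  refine this.trans ?_
  gcongr
  nlinarith

end Euler

end Gradient

/-! ### Trace norm and duality -/

section Duality

variable {n : Type*} [Fintype n] [DecidableEq n]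

lemma exists_diagonalization {A : Matrix n n ℂ} (hA : A.IsHermitian) :
    ∃ U : Matrix n n ℂ, star U * U = 1 ∧ U * star U = 1 ∧
      A = U * Matrix.diagonal (fun i => (hA.eigenvalues i : ℂ)) * star U := by
  refine ⟨hA.eigenvectorUnitary, Unitary.coe_star_mul_self _, Unitary.coe_mul_star_self _, ?_⟩
  conv_lhs => rw [hA.spectral_theorem, Unitary.conjStarAlgAut_apply]
  rfl

lemma norm_one_le : ‖(1 : Matrix n n ℂ)‖ ≤ 1 := by
  rw [← Matrix.diagonal_one, Matrix.l2_opNorm_diagonal]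
  exact (pi_norm_le_iff_of_nonneg zero_le_one).mpr fun i => by simp

lemma norm_le_one_of_star_mul_self {U : Matrix n n ℂ} (h : star U * U = 1) : ‖U‖ ≤ 1 := by
  have h1 : ‖U‖ * ‖U‖ ≤ 1 := by
    rw [← CStarRing.norm_star_mul_self, h]; exact norm_one_le
  nlinarith [norm_nonneg U]

lemma norm_apply_le (A : Matrix n n ℂ) (i j : n) : ‖A i j‖ ≤ ‖A‖ := by
  have h := (Matrix.toEuclideanCLM (𝕜 := ℂ) A).le_opNorm (EuclideanSpace.single j 1)
  rw [Matrix.l2_opNorm_toEuclideanCLM, PiLp.norm_single, norm_one, mul_one] at h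
  refine le_trans ?_ h
  have h2 := PiLp.norm_apply_le (Matrix.toEuclideanCLM (𝕜 := ℂ) A (EuclideanSpace.single j 1)) i
  refine le_trans (le_of_eq ?_) h2
  simp [Matrix.ofLp_toEuclideanCLM]

lemma trace_mul_diagonalization (X U : Matrix n n ℂ) (v : n → ℂ) :
    (X * (U * Matrix.diagonal v * star U)).trace = ∑ i, (star U * X * U) i i * v i := by
  rw [← mul_assoc, Matrix.trace_mul_comm, ← mul_assoc, ← mul_assoc, Matrix.trace]
  exact Finset.sum_congr rfl fun i _ => by rw [Matrix.diag_apply, Matrix.mul_diagonal]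

lemma norm_unitary_conj_le {U : Matrix n n ℂ} (h1 : star U * U = 1) (X : Matrix n n ℂ) :
    ‖star U * X * U‖ ≤ ‖X‖ := by
  have h2 := norm_le_one_of_star_mul_self h1
  have h3 : ‖star U‖ ≤ 1 := by rwa [norm_star]
  calc _ ≤ ‖star U‖ * ‖X‖ * ‖U‖ := (norm_mul_le _ _).trans (by gcongr; exact norm_mul_le _ _)
    _ ≤ 1 * ‖X‖ * 1 := by gcongr
    _ = _ := by ring

lemma norm_trace_mul_le {A : Matrix n n ℂ} (hA : A.IsHermitian) (X : Matrix n n ℂ) :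
    ‖(X * A).trace‖ ≤ ‖X‖ * ∑ i, |hA.eigenvalues i| := by
  obtain ⟨U, h1, h2, h3⟩ := exists_diagonalization hA
  have h4 : (X * A).trace = ∑ i, (star U * X * U) i i * (hA.eigenvalues i : ℂ) := by
    conv_lhs => rw [h3]
    exact trace_mul_diagonalization _ _ _
  rw [h4, Finset.mul_sum]
  refine (norm_sum_le _ _).trans (Finset.sum_le_sum fun i _ => ?_)
  rw [norm_mul, Complex.norm_real, Real.norm_eq_abs]
  gcongr
  exact (norm_apply_le _ i i).trans (norm_unitary_conj_le h1 X)

lemma norm_trace_mul_le_of_posSemidef {ρ : Matrix n n ℂ} (hρ : ρ.PosSemidef) (h1 : ρ.trace = 1)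
    (X : Matrix n n ℂ) : ‖(X * ρ).trace‖ ≤ ‖X‖ := by
  refine (norm_trace_mul_le hρ.1 X).trans ?_
  have h2 : ∑ i, |hρ.1.eigenvalues i| = 1 := by
    have h3 := hρ.1.trace_eq_sum_eigenvalues
    rw [h1] at h3
    have h4 : ((∑ i, hρ.1.eigenvalues i : ℝ) : ℂ) = 1 := by
      rw [h3]; push_cast; rfl
    have h5 : ∑ i, hρ.1.eigenvalues i = 1 := by exact_mod_cast h4
    rw [← h5]
    exact Finset.sum_congr rfl fun i _ => abs_of_nonneg (hρ.eigenvalues_nonneg i)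
  rw [h2, mul_one]

lemma trace_mul_nonneg {ρ X : Matrix n n ℂ} (hρ : ρ.PosSemidef) (hX : X.PosSemidef) :
    0 ≤ ((X * ρ).trace).re := by
  obtain ⟨U, h1, h2, h3⟩ := exists_diagonalization hρ.1
  have h4 : (X * ρ).trace = ∑ i, (star U * X * U) i i * (hρ.1.eigenvalues i : ℂ) := by
    conv_lhs => rw [h3]
    exact trace_mul_diagonalization _ _ _
  rw [h4, Complex.re_sum]
  refine Finset.sum_nonneg fun i _ => ?_
  rw [Complex.re_mul_ofReal]
  refine mul_nonneg ?_ (hρ.eigenvalues_nonneg i)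
  have h5 : (star U * X * U).PosSemidef := hX.conjTranspose_mul_mul_same U
  exact (Complex.le_def.mp (h5.diag_nonneg (i := i))).1

end Duality

section TraceNorm

variable {V : Type} [LinearOrder V] [Fintype V]

lemma traceNorm_eq {A : FockOp V} (hA : A.IsHermitian) :
    traceNorm A = ∑ i, |hA.eigenvalues i| := by
  obtain ⟨U, h1, h2, h3⟩ := exists_diagonalization hA
  set B : FockOp V := U * Matrix.diagonal (fun i => ((|hA.eigenvalues i| : ℝ) : ℂ)) * star U with hB
  have hB0 : 0 ≤ B := by
    rw [Matrix.nonneg_iff_posSemidef]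
    have : (Matrix.diagonal (fun i => ((|hA.eigenvalues i| : ℝ) : ℂ))).PosSemidef := by
      rw [Matrix.posSemidef_diagonal_iff]
      intro i
      exact_mod_cast abs_nonneg _
    exact this.mul_mul_conjTranspose_same U
  have hBB : B * B = Aᴴ * A := by
    rw [hA.eq]
    conv_rhs => rw [h3]
    have h4 : ∀ X Y : FockOp V, U * X * star U * (U * Y * star U) = U * (X * Y) * star U := by
      intro X Y
      calc _ = U * X * (star U * U) * Y * star U := by noncomm_ring
        _ = _ := by rw [h1]; noncomm_ring
    rw [hB, h4, h4, Matrix.diagonal_mul_diagonal, Matrix.diagonal_mul_diagonal]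
    congr 3
    ext i
    rw [← Complex.ofReal_mul, abs_mul_abs_self, Complex.ofReal_mul]
  rw [traceNorm, CFC.sqrt_unique hBB hB0, hB, Matrix.trace_mul_comm, ← mul_assoc, h1, one_mul,
    Matrix.trace_diagonal, ← Complex.ofReal_sum, Complex.ofReal_re]

/-- Duality of trace norm and operator norm; the sign of `A` is the optimal test operator. It moves
distance estimates to the Heisenberg picture and exhibits them as closed conditions. -/
lemma traceNorm_le_iff {A : FockOp V} (hA : A.IsHermitian) (c : ℝ) :
    traceNorm A ≤ c ↔ ∀ O : FockOp V, ‖O‖ ≤ 1 → ‖(O * A).trace‖ ≤ c := by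
  constructor
  · intro h O hO
    refine (norm_trace_mul_le hA O).trans ?_
    rw [traceNorm_eq hA] at h
    have : 0 ≤ ∑ i, |hA.eigenvalues i| := Finset.sum_nonneg fun _ _ => abs_nonneg _
    nlinarith
  · intro h
    obtain ⟨U, h1, h2, h3⟩ := exists_diagonalization hA
    set s : Finset V → ℂ := fun i => ((SignType.sign (hA.eigenvalues i) : ℝ) : ℂ) with hs
    have hn : ‖(Matrix.diagonal s : FockOp V)‖ ≤ 1 := by
      rw [Matrix.l2_opNorm_diagonal]
      refine (pi_norm_le_iff_of_nonneg zero_le_one).mpr fun i => ?_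
      rw [hs, Complex.norm_real]
      rcases lt_trichotomy (hA.eigenvalues i) 0 with h | h | h <;> simp [h]
    have h4 := h (U * Matrix.diagonal s * star U) (by
      have := norm_unitary_conj_le (U := star U) (by rwa [star_star]) (Matrix.diagonal s)
      rw [star_star] at this
      exact this.trans hn)
    have h5 : (U * Matrix.diagonal s * star U * A).trace = ((∑ i, |hA.eigenvalues i| : ℝ) : ℂ) := by
      conv_lhs => rw [h3]
      rw [trace_mul_diagonalization, Complex.ofReal_sum]
      refine Finset.sum_congr rfl fun i _ => ?_
      have h6 : star U * (U * Matrix.diagonal s * star U) * U = Matrix.diagonal s := by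
        calc _ = (star U * U) * Matrix.diagonal s * (star U * U) := by noncomm_ring
          _ = _ := by rw [h1, one_mul, mul_one]
      rw [h6, Matrix.diagonal_apply_eq, hs, ← Complex.ofReal_mul, sign_mul_self]
    rw [h5, Complex.norm_real, Real.norm_of_nonneg (Finset.sum_nonneg fun _ _ => abs_nonneg _)] at h4
    rwa [traceNorm_eq hA]

/-- The Lindbladian with jump operators `K`. -/
def lind (K : V × Bool → FockOp V) : FockOp V →L[ℂ] FockOp V :=
  LinearMap.toContinuousLinearMap (∑ a, dissipator (K a))

lemma lind_apply (K : V × Bool → FockOp V) (ρ : FockOp V) :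
    lind K ρ = ∑ a, (K a * ρ * (K a)ᴴ - (1 / 2 : ℂ) • ((K a)ᴴ * K a * ρ + ρ * ((K a)ᴴ * K a))) := by
  simp [lind, dissipator, mul_assoc]

lemma trace_mul_lind (K : V × Bool → FockOp V) (O ρ : FockOp V) :
    (O * lind K ρ).trace = (heis 1 K O * ρ).trace := by
  rw [lind_apply, heis_eq_sum, Finset.mul_sum, smul_mul_assoc, Finset.sum_mul, Matrix.trace_smul,
    Matrix.trace_sum, Matrix.trace_sum, Finset.smul_sum]
  refine Finset.sum_congr rfl fun a _ => ?_
  have h1 : (O * (K a * ρ * (K a)ᴴ)).trace = ((K a)ᴴ * O * K a * ρ).trace := by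
    rw [← mul_assoc, Matrix.trace_mul_comm]
    simp only [mul_assoc]
  have h2 : (O * (ρ * ((K a)ᴴ * K a))).trace = ((K a)ᴴ * K a * O * ρ).trace := by
    rw [← mul_assoc, Matrix.trace_mul_comm]
    simp only [mul_assoc]
  have h3 : (O * ((K a)ᴴ * K a * ρ)).trace = (O * ((K a)ᴴ * K a) * ρ).trace := by
    simp only [mul_assoc]
  simp only [mul_sub, sub_mul, mul_smul_comm, mul_add, Matrix.trace_sub, Matrix.trace_smul,
    Matrix.trace_add, h1, h2, h3, one_smul, two_mul, add_mul, Matrix.star_eq_conjTranspose,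
    smul_eq_mul]
  ring

lemma lind_conjTranspose (K : V × Bool → FockOp V) (ρ : FockOp V) :
    lind K ρᴴ = (lind K ρ)ᴴ := by
  simp only [lind_apply, Matrix.conjTranspose_sum, Matrix.conjTranspose_sub,
    Matrix.conjTranspose_smul, Matrix.conjTranspose_mul, Matrix.conjTranspose_add,
    Matrix.conjTranspose_conjTranspose, mul_assoc]
  simp [add_comm]

end TraceNorm

/-! ### Exponential series and adjoint pairs of generators -/

section ExpSeries

variable {E : Type*} [NormedAddCommGroup E] [NormedSpace ℂ E] [CompleteSpace E]

lemma hasSum_exp_apply (T : E →L[ℂ] E) (x : E) (t : ℝ) :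
    HasSum (fun k : ℕ => ((((k.factorial : ℝ)⁻¹ * t ^ k : ℝ)) : ℂ) • (T ^ k) x)
      (NormedSpace.exp ((t : ℂ) • T) x) := by
  have h1 := NormedSpace.exp_series_hasSum_exp' (𝕂 := ℂ) ((t : ℂ) • T)
  have h2 := (ContinuousLinearMap.apply ℂ E x).hasSum h1
  refine HasSum.congr_fun h2 fun k => ?_
  simp only [ContinuousLinearMap.apply_apply, smul_pow, smul_smul]
  push_cast
  rfl

lemma pow_apply_comm (T : E →L[ℂ] E) (Φ : E → E) (h : ∀ x, Φ (T x) = T (Φ x)) (k : ℕ) (x : E) :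
    Φ ((T ^ k) x) = (T ^ k) (Φ x) := by
  induction k generalizing x with
  | zero => simp
  | succ k ih =>
    rw [pow_succ, mul_apply_eq_comp, mul_apply_eq_comp, ih, h]

/-- Adjointness passes from the generators to their powers and, by continuity of the pairing,
termwise to the exponential series. -/
lemma exp_apply_adjoint (B : E →ₗ[ℂ] E →ₗ[ℂ] ℂ) (hB1 : ∀ y, Continuous fun x => B x y)
    (hB2 : ∀ x, Continuous (B x)) (S T : E →L[ℂ] E) (h : ∀ x y, B x (T y) = B (S x) y)
    (x y : E) (t : ℝ) :
    B x (NormedSpace.exp ((t : ℂ) • T) y) = B (NormedSpace.exp ((t : ℂ) • S) x) y := by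
  have hk : ∀ (k : ℕ) (x y : E), B x ((T ^ k) y) = B ((S ^ k) x) y := by
    intro k
    induction k with
    | zero => simp
    | succ k ih =>
      intro x y
      rw [pow_succ, pow_succ', mul_apply_eq_comp, mul_apply_eq_comp, ih, h]
  have h1 := (hasSum_exp_apply T y t).map (B x) (hB2 x)
  have h2 := (hasSum_exp_apply S x t).map (B.flip y) (hB1 y)
  refine h1.unique ?_
  refine HasSum.congr_fun h2 fun k => ?_
  change B x (_ • (T ^ k) y) = B (_ • (S ^ k) x) y
  rw [map_smul, map_smul, LinearMap.smul_apply, hk]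

end ExpSeries

/-! ### Duality of the two pictures, dark states and the upper bound -/

section Evolution

variable {V : Type} [LinearOrder V] [Fintype V]

lemma trace_mul_evolve (K : V × Bool → FockOp V) (t : ℝ) (O ρ : FockOp V) :
    (O * evolve (lind K) t ρ).trace = (heisEvolve K t O * ρ).trace := by
  let B : FockOp V →ₗ[ℂ] FockOp V →ₗ[ℂ] ℂ :=
    (LinearMap.mul ℂ (FockOp V)).compr₂ (Matrix.traceLinearMap (Finset V) ℂ ℂ)
  have hB : ∀ x y, B x y = (x * y).trace := fun _ _ => rfl
  have := exp_apply_adjoint B (fun y => by simp only [hB]; fun_prop)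
    (fun x => LinearMap.continuous_of_finiteDimensional _) (heis 1 K) (lind K)
    (fun x y => by simpa only [hB] using trace_mul_lind K x y) O ρ t
  exact this

lemma conjTranspose_exp_apply (T : FockOp V →L[ℂ] FockOp V) (h : ∀ x, T xᴴ = (T x)ᴴ)
    (x : FockOp V) (t : ℝ) :
    NormedSpace.exp ((t : ℂ) • T) xᴴ = (NormedSpace.exp ((t : ℂ) • T) x)ᴴ := by
  have h1 := hasSum_exp_apply T xᴴ t
  have h2 := (hasSum_exp_apply T x t).matrix_conjTranspose
  refine h1.unique (HasSum.congr_fun h2 fun k => ?_)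
  rw [Matrix.conjTranspose_smul, Complex.star_def, Complex.conj_ofReal,
    pow_apply_comm T Matrix.conjTranspose (fun x => (h x).symm)]

lemma evolve_isHermitian (K : V × Bool → FockOp V) (t : ℝ) {ρ : FockOp V} (hρ : ρ.IsHermitian) :
    (evolve (lind K) t ρ).IsHermitian := by
  have := conjTranspose_exp_apply (lind K) (lind_conjTranspose K) ρ t
  rw [hρ.eq] at this
  exact this.symm

lemma heisEvolve_conjTranspose (K : V × Bool → FockOp V) (t : ℝ) (O : FockOp V) :
    heisEvolve K t Oᴴ = (heisEvolve K t O)ᴴ :=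
  conjTranspose_exp_apply _ (heis_conjTranspose K) O t

lemma continuous_evolve (K : V × Bool → FockOp V) (ρ : FockOp V) :
    Continuous fun t => evolve (lind K) t ρ :=
  continuous_iff_continuousAt.mpr fun t => (hasDerivAt_exp_apply (lind K) ρ t).continuousAt

lemma trace_mul_pureState (X : FockOp V) (ψ : Finset V → ℂ) :
    (X * pureState ψ).trace = star ψ ⬝ᵥ X *ᵥ ψ := by
  rw [pureState, Matrix.mul_vecMulVec, Matrix.trace_vecMulVec, dotProduct_comm]

lemma pureState_mem {ψ : Finset V → ℂ} (hψ : star ψ ⬝ᵥ ψ = 1) :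
    pureState ψ ∈ densityMatrices V := by
  refine ⟨Matrix.posSemidef_vecMulVec_self_star ψ, ?_⟩
  rw [pureState, Matrix.trace_vecMulVec, dotProduct_comm, hψ]

/-- In each term of the generator some `K_a` meets `ψ` on the right or, through the Hermitian decay
operator, on the left. -/
lemma dark_heis {K : V × Bool → FockOp V} {ψ : Finset V → ℂ} (hψ : ∀ a, K a *ᵥ ψ = 0)
    (O : FockOp V) : star ψ ⬝ᵥ heis 1 K O *ᵥ ψ = 0 := by
  have h1 : decayOp K *ᵥ ψ = 0 := by
    rw [decayOp, Matrix.sum_mulVec]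
    exact Finset.sum_eq_zero fun a _ => by rw [← Matrix.mulVec_mulVec, hψ, Matrix.mulVec_zero]
  have h2 : star ψ ᵥ* decayOp K = 0 := by
    have := congrArg star h1
    rwa [Matrix.star_mulVec, decayOp_isHermitian, star_zero] at this
  have h3 : (∑ a, (K a)ᴴ * O * K a) *ᵥ ψ = 0 := by
    rw [Matrix.sum_mulVec]
    exact Finset.sum_eq_zero fun a _ => by rw [← Matrix.mulVec_mulVec, hψ, Matrix.mulVec_zero]
  rw [heis_apply, one_smul, Matrix.sub_mulVec, h3, Matrix.smul_mulVec, Matrix.add_mulVec,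
    ← Matrix.mulVec_mulVec, ← Matrix.mulVec_mulVec, h1, Matrix.mulVec_zero, add_zero, zero_sub,
    dotProduct_neg, dotProduct_smul, Matrix.dotProduct_mulVec, h2]
  simp

lemma trace_heisEvolve_dark {K : V × Bool → FockOp V} {ψ : Finset V → ℂ}
    (hψ : ∀ a, K a *ᵥ ψ = 0) (t : ℝ) (O : FockOp V) :
    (heisEvolve K t O * pureState ψ).trace = (O * pureState ψ).trace := by
  let B : FockOp V →ₗ[ℂ] ℂ := Matrix.traceLinearMap (Finset V) ℂ ℂ ∘ₗ
    LinearMap.mulRight ℂ (pureState ψ)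
  let B' : FockOp V →L[ℝ] ℂ := (LinearMap.toContinuousLinearMap B).restrictScalars ℝ
  have h : ∀ t, HasDerivAt (fun t => B' (heisEvolve K t O)) 0 t := fun t => by
    have := B'.hasFDerivAt.comp_hasDerivAt t (hasDerivAt_heisEvolve K O t)
    refine HasDerivAt.congr_deriv this ?_
    change (heis 1 K (heisEvolve K t O) * pureState ψ).trace = 0
    rw [trace_mul_pureState, dark_heis hψ]
  have := eq_of_hasDerivAt_zero h t 0
  rw [heisEvolve_zero_time] at this
  exact this

section Bounds

variable {d : V → V → ℕ} {w : V → V → ℝ} {Z : ℝ} {K : V × Bool → FockOp V} {κ₀ C δ : ℝ}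

/-- Upper bound for the distance from the dark state. -/
lemma traceDistance_evolve_le (hw : IsWeight d w Z) (hK : JumpBounds w K κ₀ C δ) (hC : 0 ≤ C)
    (hδ : 0 ≤ δ) (hsmall : δ * gradConst Z κ₀ C ≤ 1 / 4) {ψ : Finset V → ℂ}
    (hψ1 : star ψ ⬝ᵥ ψ = 1) (hψ : ∀ a, K a *ᵥ ψ = 0) {ρ : FockOp V}
    (hρ : ρ ∈ densityMatrices V) {t : ℝ} (ht : 0 ≤ t) :
    traceDistance (evolve (lind K) t ρ) (pureState ψ) ≤
      4 * Fintype.card V * Real.exp (-(t / 4)) := by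
  have hσ := pureState_mem hψ1
  have hA : (evolve (lind K) t ρ - pureState ψ).IsHermitian :=
    (evolve_isHermitian K t hρ.1.1).sub hσ.1.1
  rw [traceDistance, div_le_iff₀ two_pos, traceNorm_le_iff hA]
  intro O hO
  obtain ⟨z, hz⟩ := exists_norm_sub_scalar_le (heisEvolve K t O)
  have h1 : ∑ k, ‖defect 1 k (heisEvolve K t O)‖ ≤
      2 * Fintype.card V * (4 * Real.exp (-(t / 4))) := by
    calc _ ≤ ∑ _k : V × Bool, 4 * Real.exp (-(t / 4)) := by
          refine Finset.sum_le_sum fun k _ => (norm_defect_one_le k _).trans ?_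
          have h2 := norm_grad_heisEvolve_le hw hK hC hδ hsmall O ht
          have h3 := norm_grad_le O
          have h4 : Real.exp (-(t / 4)) * ‖grad O‖ ≤ Real.exp (-(t / 4)) * 2 := by
            gcongr; linarith
          linarith
      _ = _ := by
          rw [Finset.sum_const, nsmul_eq_mul]
          simp [mul_comm]
  set X := heisEvolve K t O - z • (1 : FockOp V) with hX
  -- Both states have trace one, so the scalar `z` drops out of the difference.
  have h2 : (O * (evolve (lind K) t ρ - pureState ψ)).trace =
      (X * ρ).trace - (X * pureState ψ).trace := by
    rw [mul_sub, Matrix.trace_sub, trace_mul_evolve, ← trace_heisEvolve_dark hψ t O, hX,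
      sub_mul, sub_mul, Matrix.trace_sub, Matrix.trace_sub, smul_mul_assoc, smul_mul_assoc,
      one_mul, one_mul, Matrix.trace_smul, Matrix.trace_smul, hρ.2, hσ.2]
    ring
  rw [h2]
  have h3 := norm_trace_mul_le_of_posSemidef hρ.1 hρ.2 X
  have h4 := norm_trace_mul_le_of_posSemidef hσ.1 hσ.2 X
  refine (norm_sub_le _ _).trans ?_
  linarith

/-- The mixing time exists as soon as the distance is eventually small. -/
lemma exists_isMixingTime {𝒮 : Set (FockOp V)} (h𝒮 : 𝒮 ⊆ densityMatrices V) (K : V × Bool → FockOp V)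
    {ψ : Finset V → ℂ} (hψ1 : star ψ ⬝ᵥ ψ = 1) {η t₀ : ℝ} (ht₀ : 0 ≤ t₀)
    (h : ∀ ρ ∈ 𝒮, traceDistance (evolve (lind K) t₀ ρ) (pureState ψ) ≤ η) :
    ∃ τ, IsMixingTime 𝒮 (lind K) (pureState ψ) η τ ∧ τ ≤ t₀ := by
  have hσ := pureState_mem hψ1
  set T : Set ℝ := {t : ℝ | 0 ≤ t ∧ ∀ ρ₀ ∈ 𝒮,
    traceDistance (evolve (lind K) t ρ₀) (pureState ψ) ≤ η} with hT
  have hbdd : BddBelow T := ⟨0, fun t ht => ht.1⟩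
  have hmem : t₀ ∈ T := ⟨ht₀, h⟩
  -- By duality membership in `T` is a family of closed conditions, each continuous in `t`; so the
  -- infimum is attained.
  have hclosed : IsClosed T := by
    have : T = {t : ℝ | 0 ≤ t} ∩ ⋂ ρ ∈ 𝒮, ⋂ O ∈ {O : FockOp V | ‖O‖ ≤ 1},
        {t : ℝ | ‖(O * (evolve (lind K) t ρ - pureState ψ)).trace‖ ≤ η * 2} := by
      ext t
      simp only [hT, Set.mem_ofPred_eq, Set.mem_inter_iff, Set.mem_iInter]
      refine and_congr Iff.rfl (forall₂_congr fun ρ hρ => ?_)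
      rw [traceDistance, div_le_iff₀ two_pos,
        traceNorm_le_iff ((evolve_isHermitian K t (h𝒮 hρ).1.1).sub hσ.1.1)]
    rw [this]
    refine (isClosed_le continuous_const continuous_id).inter ?_
    refine isClosed_biInter fun ρ _ => isClosed_biInter fun O _ => isClosed_le ?_ continuous_const
    have := continuous_evolve K ρ
    fun_prop
  exact ⟨sInf T, hclosed.isLeast_csInf ⟨t₀, hmem⟩ hbdd, csInf_le hbdd hmem⟩

end Bounds

end Evolution

/-! ### Lower bounds on the mixing time -/

section Lower

variable {V : Type} [LinearOrder V] [Fintype V]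

lemma norm_sub_posSemidef_le {n : Type*} [Fintype n] [DecidableEq n] {X : Matrix n n ℂ}
    (hX : X.PosSemidef) : ‖((‖X‖ : ℝ) : ℂ) • (1 : Matrix n n ℂ) - X‖ ≤ ‖X‖ := by
  obtain ⟨U, h1, h2, h3⟩ := exists_diagonalization hX.1
  have h4 : ((‖X‖ : ℝ) : ℂ) • (1 : Matrix n n ℂ) - X =
      star (star U) * Matrix.diagonal (fun i => ((‖X‖ - hX.1.eigenvalues i : ℝ) : ℂ)) * star U := by
    have h5 : Matrix.diagonal (fun i => ((‖X‖ - hX.1.eigenvalues i : ℝ) : ℂ)) =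
        ((‖X‖ : ℝ) : ℂ) • (1 : Matrix n n ℂ) - Matrix.diagonal (fun i => (hX.1.eigenvalues i : ℂ)) := by
      rw [Matrix.smul_one_eq_diagonal, Matrix.diagonal_sub]
      simp
    rw [h5, star_star, mul_sub, sub_mul, ← h3, mul_smul_comm, smul_mul_assoc, mul_one, h2]
  rw [h4]
  refine (norm_unitary_conj_le (U := star U) (by rwa [star_star]) _).trans ?_
  rw [Matrix.l2_opNorm_diagonal]
  refine (pi_norm_le_iff_of_nonneg (norm_nonneg _)).mpr fun i => ?_
  have h6 : hX.1.eigenvalues i ≤ ‖X‖ := by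
    have h7 : (star U * X * U) i i = (hX.1.eigenvalues i : ℂ) := by
      have : star U * X * U = Matrix.diagonal (fun i => (hX.1.eigenvalues i : ℂ)) := by
        conv_lhs => rw [h3]
        calc _ = (star U * U) * Matrix.diagonal (fun i => (hX.1.eigenvalues i : ℂ)) * (star U * U) := by
              noncomm_ring
          _ = _ := by rw [h1, one_mul, mul_one]
      rw [this, Matrix.diagonal_apply_eq]
    have h8 := (norm_apply_le (star U * X * U) i i).trans (norm_unitary_conj_le h1 X)
    rw [h7, Complex.norm_real] at h8
    exact (le_abs_self _).trans h8
  rw [Complex.norm_real, Real.norm_of_nonneg (by linarith)]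
  linarith [hX.eigenvalues_nonneg i]

/-- The Heisenberg dynamics is positive. -/
lemma heisEvolve_trace_nonneg (K : V × Bool → FockOp V) {t : ℝ} (ht : 0 ≤ t) {X ρ : FockOp V}
    (hX : X.PosSemidef) (hρ : ρ ∈ densityMatrices V) :
    0 ≤ ((heisEvolve K t X * ρ).trace).re := by
  -- Positivity follows from contractivity and preservation of the identity: `‖X‖ - X` has norm at
  -- most `‖X‖`, so `‖X‖` minus the evolved expectation of `X` is at most `‖X‖`.
  have h1 := norm_heisEvolve_le K (((‖X‖ : ℝ) : ℂ) • (1 : FockOp V) - X) ht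
  have h2 : heisEvolve K t (((‖X‖ : ℝ) : ℂ) • (1 : FockOp V) - X) =
      ((‖X‖ : ℝ) : ℂ) • (1 : FockOp V) - heisEvolve K t X := by
    have h3 := heisEvolve_one K t
    unfold heisEvolve at h3 ⊢
    rw [map_sub, map_smul, h3]
  have h4 := norm_trace_mul_le_of_posSemidef hρ.1 hρ.2
    (((‖X‖ : ℝ) : ℂ) • (1 : FockOp V) - heisEvolve K t X)
  rw [h2] at h1
  have h5 := (Complex.re_le_norm _).trans (h4.trans (h1.trans (norm_sub_posSemidef_le hX)))
  rw [sub_mul, smul_mul_assoc, one_mul, Matrix.trace_sub, Matrix.trace_smul, hρ.2, Complex.sub_re] at h5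
  simp at h5
  exact h5

/-- The anticommutators `{K_a†, K_b}`. -/
def jumpGram (K : V × Bool → FockOp V) (a b : V × Bool) : FockOp V :=
  star (K a) * K b + K b * star (K a)

lemma star_jumpGram (K : V × Bool → FockOp V) (a b : V × Bool) :
    star (jumpGram K a b) = jumpGram K b a := by
  simp [jumpGram, star_add, star_mul]

/-- The anticommutators are arranged so that the first double sum is manifestly positive; only the
second one can lower the number of excitations. -/
lemma heis_decayOp (K : V × Bool → FockOp V) :
    heis 1 K (decayOp K) =
      (1 / 2 : ℂ) • ∑ a, ∑ b, star (K a * K b + K b * K a) * (K a * K b + K b * K a) -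
        ∑ a, ∑ b, star (K b) * jumpGram K a b * K a := by
  set S : ((V × Bool) → (V × Bool) → FockOp V) → FockOp V := fun g => ∑ a, ∑ b, g a b with hS
  have hswap : ∀ g, S g = S fun a b => g b a := fun g => Finset.sum_comm
  have hadd : ∀ g g', S (fun a b => g a b + g' a b) = S g + S g' := fun g g' => by
    simp only [hS, Finset.sum_add_distrib]
  have h1 : heis 1 K (decayOp K) = S (fun a b => star (K b) * star (K a) * K a * K b) -
      (1 / 2 : ℂ) • (S (fun a b => star (K b) * K b * star (K a) * K a) +
        S fun a b => star (K a) * K a * star (K b) * K b) := by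
    rw [heis_apply, one_smul]
    congr 1
    · simp only [hS, decayOp, Finset.mul_sum, Finset.sum_mul, Matrix.star_eq_conjTranspose]
      rw [Finset.sum_comm]
      simp only [mul_assoc]
    · congr 1
      congr 1
      · simp only [hS, decayOp, Finset.mul_sum, Finset.sum_mul, Matrix.star_eq_conjTranspose]
        simp only [mul_assoc]
      · simp only [hS, decayOp, Finset.mul_sum, Finset.sum_mul, Matrix.star_eq_conjTranspose]
        rw [Finset.sum_comm]
        simp only [mul_assoc]
  have h2 : ∑ a, ∑ b, star (K a * K b + K b * K a) * (K a * K b + K b * K a) =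
      S (fun a b => star (K b) * star (K a) * K a * K b) +
      S (fun a b => star (K b) * star (K a) * K b * K a) +
      S (fun a b => star (K a) * star (K b) * K a * K b) +
      S (fun a b => star (K a) * star (K b) * K b * K a) := by
    rw [← hadd, ← hadd, ← hadd]
    refine Finset.sum_congr rfl fun a _ => Finset.sum_congr rfl fun b _ => ?_
    rw [star_add, star_mul, star_mul]
    noncomm_ring
  have h3 : ∑ a, ∑ b, star (K b) * jumpGram K a b * K a =
      S (fun a b => star (K b) * star (K a) * K b * K a) +
      S (fun a b => star (K b) * K b * star (K a) * K a) := by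
    rw [← hadd]
    refine Finset.sum_congr rfl fun a _ => Finset.sum_congr rfl fun b _ => ?_
    rw [jumpGram]
    noncomm_ring
  rw [h1, h2, h3, hswap (fun a b => star (K a) * star (K b) * K a * K b),
    hswap (fun a b => star (K a) * star (K b) * K b * K a),
    hswap (fun a b => star (K a) * K a * star (K b) * K b)]
  module

lemma star_dotProduct_mulVec (A : FockOp V) (x : Finset V → ℂ) :
    star x ⬝ᵥ A *ᵥ x = inner ℂ (WithLp.toLp 2 x) (Matrix.toEuclideanCLM (𝕜 := ℂ) A (WithLp.toLp 2 x)) := by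
  rw [Matrix.toEuclideanCLM_toLp, EuclideanSpace.inner_toLp_toLp, dotProduct_comm]

/-- A Schur test: the negative part of `heis_decayOp` is a quadratic form in the vectors `K_a x`
with operator coefficients `jumpGram`. Their row and column sums agree by the adjoint symmetry and
are at most `Γ`, so the form is at most `Γ ∑ ‖K_a x‖²`. -/
lemma heis_decayOp_add_posSemidef {K : V × Bool → FockOp V} {Γ : ℝ}
    (hΓ : ∀ a, ∑ b, ‖jumpGram K a b‖ ≤ Γ) :
    (heis 1 K (decayOp K) + (Γ : ℂ) • decayOp K).PosSemidef := by
  set 𝔽 := ∑ a, ∑ b, star (K a * K b + K b * K a) * (K a * K b + K b * K a) with h𝔽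
  set 𝔾 := ∑ a, ∑ b, star (K b) * jumpGram K a b * K a with h𝔾
  have hF : ((1 / 2 : ℂ) • 𝔽).PosSemidef := by
    refine Matrix.PosSemidef.smul ?_ (by rw [Complex.le_def]; norm_num)
    exact Matrix.posSemidef_sum _ fun a _ => Matrix.posSemidef_sum _ fun b _ =>
      Matrix.posSemidef_conjTranspose_mul_self _
  have hG : 𝔾ᴴ = 𝔾 := by
    rw [← Matrix.star_eq_conjTranspose, h𝔾, star_sum]
    simp only [star_sum, star_mul, star_star, star_jumpGram]
    rw [Finset.sum_comm]
    simp only [mul_assoc]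
  have h2 : ((Γ : ℂ) • decayOp K - 𝔾).PosSemidef := by
    refine Matrix.PosSemidef.of_dotProduct_mulVec_nonneg ?_ fun x => ?_
    · change (_ - _)ᴴ = _
      rw [Matrix.conjTranspose_sub, hG, Matrix.conjTranspose_smul, decayOp_isHermitian]
      simp
    · set y := WithLp.toLp 2 x
      set T := fun a => Matrix.toEuclideanCLM (𝕜 := ℂ) (K a) y with hT
      have e1 : star x ⬝ᵥ decayOp K *ᵥ x = ((∑ a, ‖T a‖ ^ 2 : ℝ) : ℂ) := by
        rw [star_dotProduct_mulVec, decayOp, map_sum, _root_.sum_apply, inner_sum, Complex.ofReal_sum]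
        refine Finset.sum_congr rfl fun a _ => ?_
        have := inner_conj_mul (K a) (K a) 1 y y
        rw [mul_one, map_one, one_apply_eq_self] at this
        rw [this, inner_self_eq_norm_sq_to_K]
        simp [hT]
      have e2 : star x ⬝ᵥ 𝔾 *ᵥ x = ∑ a, ∑ b, inner ℂ (T b)
          (Matrix.toEuclideanCLM (𝕜 := ℂ) (jumpGram K a b) (T a)) := by
        rw [star_dotProduct_mulVec, h𝔾, map_sum, _root_.sum_apply, inner_sum]
        refine Finset.sum_congr rfl fun a _ => ?_
        rw [map_sum, _root_.sum_apply, inner_sum]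
        refine Finset.sum_congr rfl fun b _ => ?_
        exact inner_conj_mul (K b) (K a) (jumpGram K a b) y y
      have e3 : ‖star x ⬝ᵥ 𝔾 *ᵥ x‖ ≤ Γ * ∑ a, ‖T a‖ ^ 2 := by
        rw [e2]
        have e4 : ∀ a b, ‖inner ℂ (T b) (Matrix.toEuclideanCLM (𝕜 := ℂ) (jumpGram K a b) (T a))‖ ≤
            ‖jumpGram K a b‖ * ‖T a‖ ^ 2 / 2 + ‖jumpGram K a b‖ * ‖T b‖ ^ 2 / 2 := by
          intro a b
          refine (norm_inner_le_norm _ _).trans ?_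
          have e5 := (Matrix.toEuclideanCLM (𝕜 := ℂ) (jumpGram K a b)).le_opNorm (T a)
          rw [Matrix.l2_opNorm_toEuclideanCLM] at e5
          have e6 := mul_le_mul_of_nonneg_left e5 (norm_nonneg (T b))
          have e7 := mul_nonneg (norm_nonneg (jumpGram K a b)) (sq_nonneg (‖T a‖ - ‖T b‖))
          nlinarith
        have e8 : ∑ a, ∑ b, ‖jumpGram K a b‖ * ‖T a‖ ^ 2 / 2 ≤ Γ * (∑ a, ‖T a‖ ^ 2) / 2 := by
          rw [Finset.mul_sum, Finset.sum_div]
          refine Finset.sum_le_sum fun a _ => ?_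
          rw [← Finset.sum_div, ← Finset.sum_mul]
          have := hΓ a
          gcongr
        have e9 : ∑ a, ∑ b, ‖jumpGram K a b‖ * ‖T b‖ ^ 2 / 2 ≤ Γ * (∑ a, ‖T a‖ ^ 2) / 2 := by
          rw [Finset.sum_comm, Finset.mul_sum, Finset.sum_div]
          refine Finset.sum_le_sum fun a _ => ?_
          rw [← Finset.sum_div, ← Finset.sum_mul]
          have : ∑ b, ‖jumpGram K b a‖ ≤ Γ := by
            refine le_trans (le_of_eq ?_) (hΓ a)
            exact Finset.sum_congr rfl fun b _ => by rw [← star_jumpGram, norm_star]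
          gcongr
        calc _ ≤ ∑ a, ∑ b, (‖jumpGram K a b‖ * ‖T a‖ ^ 2 / 2 + ‖jumpGram K a b‖ * ‖T b‖ ^ 2 / 2) :=
              (norm_sum_le _ _).trans (Finset.sum_le_sum fun a _ =>
                (norm_sum_le _ _).trans (Finset.sum_le_sum fun b _ => e4 a b))
          _ ≤ _ := by
              simp only [Finset.sum_add_distrib]
              linarith
      have e10 : (star x ⬝ᵥ 𝔾 *ᵥ x).im = 0 := by
        exact Matrix.IsHermitian.im_star_dotProduct_mulVec_self hG x
      rw [Matrix.sub_mulVec, dotProduct_sub, Matrix.smul_mulVec, dotProduct_smul, e1, Complex.le_def]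
      constructor
      · have := (Complex.re_le_norm _).trans e3
        simp only [Complex.zero_re, Complex.sub_re, smul_eq_mul, ← Complex.ofReal_mul, Complex.ofReal_re]
        linarith
      · simp only [Complex.zero_im, Complex.sub_im, smul_eq_mul, ← Complex.ofReal_mul, Complex.ofReal_im, e10, sub_zero]
  have h3 : heis 1 K (decayOp K) + (Γ : ℂ) • decayOp K =
      (1 / 2 : ℂ) • 𝔽 + ((Γ : ℂ) • decayOp K - 𝔾) := by
    rw [heis_decayOp]; abel
  rw [h3]
  exact hF.add h2

end Lower

/-! ### Decay of the excitation number and a Poincaré inequality -/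

section LowerBounds

variable {V : Type} [LinearOrder V] [Fintype V]

lemma le_of_hasDerivAt_nonneg {f f' : ℝ → ℝ} {t : ℝ} (ht : 0 ≤ t)
    (hf : ∀ s, HasDerivAt f (f' s) s) (h : ∀ s, 0 ≤ s → s ≤ t → 0 ≤ f' s) : f 0 ≤ f t := by
  have := monotoneOn_of_deriv_nonneg (convex_Icc 0 t)
    (fun x _ => (hf x).continuousAt.continuousWithinAt)
    (fun x _ => (hf x).differentiableAt.differentiableWithinAt)
    (fun x hx => by
      rw [interior_Icc] at hx
      rw [(hf x).deriv]
      exact h x hx.1.le hx.2.le)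
  exact this ⟨le_rfl, ht⟩ ⟨ht, le_rfl⟩ ht

/-- The real part of the expectation value in the state `ρ`. -/
def expect (ρ : FockOp V) : FockOp V →L[ℝ] ℝ :=
  Complex.reCLM ∘L (LinearMap.toContinuousLinearMap (Matrix.traceLinearMap (Finset V) ℂ ℂ ∘ₗ
    LinearMap.mulRight ℂ ρ)).restrictScalars ℝ

lemma expect_apply (ρ X : FockOp V) : expect ρ X = ((X * ρ).trace).re := rfl

lemma abs_expect_le {ρ : FockOp V} (hρ : ρ ∈ densityMatrices V) (X : FockOp V) :
    |expect ρ X| ≤ ‖X‖ :=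
  (Complex.abs_re_le_norm _).trans (norm_trace_mul_le_of_posSemidef hρ.1 hρ.2 X)

lemma expect_heisEvolve_nonneg (K : V × Bool → FockOp V) {t : ℝ} (ht : 0 ≤ t) {X ρ : FockOp V}
    (hX : X.PosSemidef) (hρ : ρ ∈ densityMatrices V) : 0 ≤ expect ρ (heisEvolve K t X) :=
  heisEvolve_trace_nonneg K ht hX hρ

lemma hasDerivAt_expect (K : V × Bool → FockOp V) (ρ O : FockOp V) (t : ℝ) :
    HasDerivAt (fun t => expect ρ (heisEvolve K t O)) (expect ρ (heisEvolve K t (heis 1 K O))) t := by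
  rw [← heis_heisEvolve]
  exact (expect ρ).hasFDerivAt.comp_hasDerivAt t (hasDerivAt_heisEvolve K O t)

lemma heisEvolve_add (K : V × Bool → FockOp V) (t : ℝ) (X Y : FockOp V) :
    heisEvolve K t (X + Y) = heisEvolve K t X + heisEvolve K t Y := map_add _ _ _

lemma heisEvolve_sub (K : V × Bool → FockOp V) (t : ℝ) (X Y : FockOp V) :
    heisEvolve K t (X - Y) = heisEvolve K t X - heisEvolve K t Y := map_sub _ _ _

lemma heisEvolve_smul (K : V × Bool → FockOp V) (t : ℝ) (r : ℝ) (X : FockOp V) :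
    heisEvolve K t ((r : ℂ) • X) = (r : ℂ) • heisEvolve K t X := map_smul _ _ _

lemma expect_smul (ρ X : FockOp V) (r : ℝ) : expect ρ ((r : ℂ) • X) = r * expect ρ X := by
  rw [expect_apply, smul_mul_assoc, Matrix.trace_smul, smul_eq_mul, Complex.re_ofReal_mul]
  rfl

/-- The number of excitations decays at most exponentially. -/
lemma expect_decayOp_ge {K : V × Bool → FockOp V} {Γ : ℝ} (hΓ : ∀ a, ∑ b, ‖jumpGram K a b‖ ≤ Γ)
    {ρ : FockOp V} (hρ : ρ ∈ densityMatrices V) {t : ℝ} (ht : 0 ≤ t) :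
    Real.exp (-(Γ * t)) * expect ρ (decayOp K) ≤ expect ρ (heisEvolve K t (decayOp K)) := by
  have h1 := le_of_hasDerivAt_nonneg (f := fun s => Real.exp (Γ * s) *
      expect ρ (heisEvolve K s (decayOp K)))
    (f' := fun s => Real.exp (Γ * s) * Γ * expect ρ (heisEvolve K s (decayOp K)) +
      Real.exp (Γ * s) * expect ρ (heisEvolve K s (heis 1 K (decayOp K)))) ht
    (fun s => by
      have := (((hasDerivAt_id s).const_mul Γ).exp).fun_mul
        (hasDerivAt_expect K ρ (decayOp K) s)
      simpa using this)
    (fun s hs _ => by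
      have h2 := expect_heisEvolve_nonneg K hs (heis_decayOp_add_posSemidef hΓ) hρ
      rw [heisEvolve_add, heisEvolve_smul, map_add, expect_smul] at h2
      have h3 := Real.exp_pos (Γ * s)
      nlinarith)
  simp only [mul_zero, Real.exp_zero, one_mul, heisEvolve_zero_time] at h1
  calc _ ≤ Real.exp (-(Γ * t)) * (Real.exp (Γ * t) * expect ρ (heisEvolve K t (decayOp K))) := by
        gcongr
    _ = _ := by rw [← mul_assoc, ← Real.exp_add]; simp

variable (V) in
/-- The maximally mixed state. -/
def maxMixed : FockOp V := ((2 ^ Fintype.card V : ℝ)⁻¹ : ℂ) • 1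

lemma maxMixed_mem : maxMixed V ∈ densityMatrices V := by
  constructor
  · refine Matrix.PosSemidef.one.smul ?_
    have : (0 : ℝ) ≤ (2 ^ Fintype.card V : ℝ)⁻¹ := by positivity
    exact_mod_cast this
  · rw [maxMixed, Matrix.trace_smul, Matrix.trace_one, Fintype.card_finset]
    push_cast
    rw [smul_eq_mul, inv_mul_cancel₀ (by positivity)]

lemma maxMixed_mem_even : maxMixed V ∈ evenDensityMatrices V :=
  ⟨maxMixed_mem, (Commute.one_right _).smul_right _⟩

lemma expect_maxMixed (X : FockOp V) :
    expect (maxMixed V) X = (2 ^ Fintype.card V : ℝ)⁻¹ * X.trace.re := by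
  rw [expect_apply, maxMixed, mul_smul_comm, mul_one, Matrix.trace_smul, smul_eq_mul]
  have : ((2 ^ Fintype.card V : ℝ)⁻¹ : ℂ) = (((2 ^ Fintype.card V : ℝ)⁻¹ : ℝ) : ℂ) := by push_cast; rfl
  rw [this, Complex.re_ofReal_mul]

lemma expect_maxMixed_comm (X Y : FockOp V) :
    expect (maxMixed V) (X * Y) = expect (maxMixed V) (Y * X) := by
  rw [expect_maxMixed, expect_maxMixed, Matrix.trace_mul_comm]

lemma expect_maxMixed_star (X : FockOp V) : expect (maxMixed V) (star X) = expect (maxMixed V) X := by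
  rw [expect_maxMixed, expect_maxMixed, Matrix.star_eq_conjTranspose, Matrix.trace_conjTranspose]
  simp

lemma expect_star_mul_self_nonneg {ρ : FockOp V} (hρ : ρ ∈ densityMatrices V) (X : FockOp V) :
    0 ≤ expect ρ (star X * X) :=
  trace_mul_nonneg hρ.1 (Matrix.posSemidef_conjTranspose_mul_self X)

lemma expect_one {ρ : FockOp V} (hρ : ρ ∈ densityMatrices V) : expect ρ 1 = 1 := by
  rw [expect_apply, one_mul, hρ.2, Complex.one_re]

/-- The trace is invariant under conjugation by `γ_a`, so its even and odd eigenspaces are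
orthogonal. -/
lemma expect_maxMixed_eq_zero {X Y : FockOp V} (a : V × Bool)
    (hX : majorana a * X * majorana a = X) (hY : majorana a * Y * majorana a = -Y) :
    expect (maxMixed V) (X * Y) = 0 := by
  have h1 : expect (maxMixed V) (majorana a * (X * Y) * majorana a) =
      expect (maxMixed V) (X * Y) := by
    rw [expect_maxMixed_comm, majorana_mul_cancel]
  have h2 : majorana a * (X * Y) * majorana a = -(X * Y) := by
    calc _ = majorana a * X * (majorana a * majorana a) * Y * majorana a := by
          rw [majorana_sq]; noncomm_ring
      _ = (majorana a * X * majorana a) * (majorana a * Y * majorana a) := by noncomm_ring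
      _ = _ := by rw [hX, hY]; noncomm_ring
  rw [h2, map_neg] at h1
  linarith

lemma conj_twirl (a : V × Bool) (B : FockOp V) :
    majorana a * twirl 1 a B * majorana a = twirl 1 a B := by
  have h := defect_twirl_self (σ := 1) (one_mul 1) a B
  rw [defect, one_smul, sub_eq_zero] at h
  rw [h, mul_majorana_cancel]

/-- The twirl is an orthogonal projection for the tracial inner product, so this is Pythagoras with
the remainder bounded in operator norm. -/
lemma expect_maxMixed_twirl (a : V × Bool) (B : FockOp V) :
    expect (maxMixed V) (star B * B) ≤ expect (maxMixed V) (star (twirl 1 a B) * twirl 1 a B) +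
      1 / 4 * ‖defect 1 a B‖ ^ 2 := by
  set T := twirl 1 a B with hT
  set R := B - T with hR
  have hB : B = T + R := by rw [hR]; abel
  have hTc : majorana a * T * majorana a = T := conj_twirl a B
  have hTs : majorana a * star T * majorana a = star T := by
    have := congrArg star hTc
    rw [star_mul, star_mul, star_majorana, ← mul_assoc] at this
    exact this
  have hRc : majorana a * R * majorana a = -R := by
    have h2 : majorana a * B * majorana a = T + T - B := by
      rw [hT, twirl, one_smul]; module
    rw [hR, mul_sub, sub_mul, hTc, h2]; abel
  have h1 : expect (maxMixed V) (star T * R) = 0 := expect_maxMixed_eq_zero a hTs hRc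
  have h2 : expect (maxMixed V) (star R * T) = 0 := by
    rw [← expect_maxMixed_star, star_mul, star_star, h1]
  have h3 : expect (maxMixed V) (star B * B) = expect (maxMixed V) (star T * T) +
      expect (maxMixed V) (star R * R) := by
    have : star B * B = star T * T + star T * R + star R * T + star R * R := by
      conv_lhs => rw [hB]
      rw [star_add]; noncomm_ring
    rw [this, map_add, map_add, map_add, h1, h2]; ring
  have h4 := norm_sub_twirl_le (σ := 1) a B
  have h5 : expect (maxMixed V) (star R * R) ≤ ‖R‖ ^ 2 := by
    refine (le_abs_self _).trans ((abs_expect_le maxMixed_mem _).trans ?_)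
    rw [CStarRing.norm_star_mul_self, sq]
  have h6 : ‖R‖ ^ 2 ≤ (1 / 2 * ‖defect 1 a B‖) ^ 2 := by
    gcongr
  rw [h3]
  nlinarith

/-- A Poincaré inequality for the maximally mixed state. -/
lemma expect_maxMixed_variance_le (B : FockOp V) (hB : star B = B) :
    expect (maxMixed V) (B * B) ≤ expect (maxMixed V) B ^ 2 + 1 / 4 * ∑ k, ‖defect 1 k B‖ ^ 2 := by
  -- As in the Efron-Stein inequality, the Majorana operators are averaged out one at a time. Each
  -- step loses only the squared defect at its own label, and at the end only the mean is left.
  suffices H : ∀ (s : Finset (V × Bool)) (B : FockOp V), star B = B → ∃ B' : FockOp V, star B' = B' ∧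
      (∀ k, ‖defect 1 k B'‖ ≤ ‖defect 1 k B‖) ∧ (∀ k ∈ s, majorana k * B' = B' * majorana k) ∧
      expect (maxMixed V) B' = expect (maxMixed V) B ∧
      expect (maxMixed V) (star B * B) ≤ expect (maxMixed V) (star B' * B') +
        1 / 4 * ∑ k ∈ s, ‖defect 1 k B‖ ^ 2 by
    obtain ⟨B', h1, -, h3, h4, h5⟩ := H Finset.univ B hB
    obtain ⟨z, rfl⟩ := eq_scalar_of_commute B' fun a => h3 a (Finset.mem_univ a)
    have hz : star z = z := by
      have h6 : star (z • (1 : FockOp V)) ∅ ∅ = (z • (1 : FockOp V)) ∅ ∅ := by rw [h1]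
      rw [star_smul, star_one] at h6
      simpa using h6
    obtain ⟨r, rfl⟩ : ∃ r : ℝ, (r : ℂ) = z := ⟨z.re, Complex.conj_eq_iff_re.mp hz⟩
    rw [h1, smul_mul_smul_comm, one_mul, ← Complex.ofReal_mul, expect_smul, expect_one maxMixed_mem, hB] at h5
    rw [expect_smul, expect_one maxMixed_mem] at h4
    rw [← h4]
    linarith
  intro s
  induction s using Finset.induction_on with
  | empty => exact fun B hB => ⟨B, hB, fun _ => le_rfl, by simp, rfl, by simp⟩
  | insert a s ha ih =>
    intro B hB
    have hT : star (twirl 1 a B) = twirl 1 a B := by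
      simp only [twirl, one_smul, star_smul, star_add, star_mul, star_majorana, hB, mul_assoc]
      simp
    obtain ⟨B', h1, h2, h3, h4, h5⟩ := ih (twirl 1 a B) hT
    refine ⟨B', h1, fun k => (h2 k).trans (norm_defect_twirl_le (Or.inl rfl) a k B), ?_, ?_, ?_⟩
    · intro k hk
      rcases Finset.mem_insert.mp hk with rfl | hk
      · have h6 := h2 k
        rw [defect_twirl_self (one_mul 1), norm_zero] at h6
        have h7 := norm_le_zero_iff.mp h6
        rw [defect, one_smul] at h7
        exact sub_eq_zero.mp h7
      · exact h3 k hk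
    · rw [h4, twirl, one_smul, show (1 / 2 : ℂ) = ((1 / 2 : ℝ) : ℂ) by push_cast; rfl, expect_smul,
        map_add, expect_maxMixed_comm, majorana_mul_cancel]
      ring
    · rw [Finset.sum_insert ha]
      have h6 := expect_maxMixed_twirl a B
      have h7 : ∑ k ∈ s, ‖defect 1 k (twirl 1 a B)‖ ^ 2 ≤ ∑ k ∈ s, ‖defect 1 k B‖ ^ 2 := by
        gcongr
        exact norm_defect_twirl_le (Or.inl rfl) a _ B
      linarith

end LowerBounds

/-! ### Carré du champ and the variance of the excitation number -/

section LowerBounds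

variable {V : Type} [LinearOrder V] [Fintype V]

/-- The carré du champ of the Heisenberg generator. -/
lemma heis_mul_self (K : V × Bool → FockOp V) {A : FockOp V} (hA : star A = A) :
    heis 1 K (A * A) - heis 1 K A * A - A * heis 1 K A =
      ∑ a, star (A * K a - K a * A) * (A * K a - K a * A) := by
  have hG : decayOp K = ∑ a, star (K a) * K a := rfl
  have h1 : ∀ a, star (A * K a - K a * A) * (A * K a - K a * A) =
      star (K a) * (A * A) * K a - (star (K a) * A * K a) * A - A * (star (K a) * A * K a) +
        A * (star (K a) * K a) * A := by
    intro a
    rw [star_sub, star_mul, star_mul, hA]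
    noncomm_ring
  have h2 : ∀ X, heis 1 K X =
      ∑ a, star (K a) * X * K a - (1 / 2 : ℂ) • (decayOp K * X + X * decayOp K) := fun X => by
    rw [heis_apply, one_smul]; rfl
  rw [Finset.sum_congr rfl fun a _ => h1 a, Finset.sum_add_distrib, Finset.sum_sub_distrib,
    Finset.sum_sub_distrib, ← Finset.sum_mul, ← Finset.mul_sum, ← Finset.sum_mul, ← Finset.mul_sum,
    ← hG, h2, h2]
  simp only [mul_sub, sub_mul, mul_smul_comm, smul_mul_assoc, mul_add, add_mul, mul_assoc]
  module

lemma hasDerivAt_evolve (K : V × Bool → FockOp V) (ρ : FockOp V) (t : ℝ) :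
    HasDerivAt (fun t => evolve (lind K) t ρ) (lind K (evolve (lind K) t ρ)) t :=
  hasDerivAt_exp_apply _ _ _

lemma expect_evolve (K : V × Bool → FockOp V) (t : ℝ) (O ρ : FockOp V) :
    expect (evolve (lind K) t ρ) O = expect ρ (heisEvolve K t O) := by
  rw [expect_apply, expect_apply, trace_mul_evolve]

lemma star_heisEvolve (K : V × Bool → FockOp V) (t : ℝ) {O : FockOp V} (hO : star O = O) :
    star (heisEvolve K t O) = heisEvolve K t O := by
  rw [Matrix.star_eq_conjTranspose, ← heisEvolve_conjTranspose, ← Matrix.star_eq_conjTranspose, hO]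

/-- The function interpolates between the expectation of the squared evolved `Q` in `ρ` at `s = 0`
and that of `Q²` in the evolved state at `s = t`; its derivative is the carré du champ. -/
lemma hasDerivAt_expect_sq (K : V × Bool → FockOp V) (ρ : FockOp V) {Q : FockOp V}
    (hQ : star Q = Q) (t s : ℝ) :
    HasDerivAt (fun s => expect (evolve (lind K) s ρ) (heisEvolve K (t - s) Q * heisEvolve K (t - s) Q))
      (expect (evolve (lind K) s ρ) (∑ a,
        star (heisEvolve K (t - s) Q * K a - K a * heisEvolve K (t - s) Q) *
          (heisEvolve K (t - s) Q * K a - K a * heisEvolve K (t - s) Q))) s := by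
  set A := heisEvolve K (t - s) Q with hA
  have h1 : HasDerivAt (fun s => heisEvolve K (t - s) Q) (-heis 1 K A) s := by
    have := (hasDerivAt_heisEvolve K Q (t - s)).scomp s ((hasDerivAt_id s).const_sub t)
    exact HasDerivAt.congr_deriv (f := fun s => heisEvolve K (t - s) Q) this (by simp [hA])
  have h2 := ((h1.fun_mul h1).fun_mul (hasDerivAt_evolve K ρ s))
  let B : FockOp V →L[ℝ] ℝ := Complex.reCLM ∘L (LinearMap.toContinuousLinearMap
    (Matrix.traceLinearMap (Finset V) ℂ ℂ)).restrictScalars ℝ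
  have h3 := B.hasFDerivAt.comp_hasDerivAt s h2
  refine HasDerivAt.congr_deriv h3 ?_
  rw [← heis_mul_self K (star_heisEvolve K _ hQ), ← hA, expect_apply]
  change Complex.re (Matrix.trace (_ + _ : FockOp V)) = _
  rw [Matrix.trace_add, trace_mul_lind, ← Matrix.trace_add, ← add_mul]
  congr 3
  noncomm_ring

section Bounds

variable {d : V → V → ℕ} {w : V → V → ℝ} {Z : ℝ} {K : V × Bool → FockOp V} {κ₀ C δ : ℝ}

lemma norm_decayOp_le (hK : JumpBounds w K κ₀ C δ) : ‖decayOp K‖ ≤ 2 * Fintype.card V * κ₀ ^ 2 := by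
  rw [decayOp]
  calc _ ≤ ∑ _a : V × Bool, κ₀ ^ 2 := by
        refine (norm_sum_le _ _).trans (Finset.sum_le_sum fun a _ => ?_)
        rw [← Matrix.star_eq_conjTranspose, CStarRing.norm_star_mul_self, ← sq]
        have := hK.norm_le a
        gcongr
    _ = _ := by
        rw [Finset.sum_const, nsmul_eq_mul]
        simp [mul_comm]

/-- By the graded Leibniz rule `[c, K†K] = {c, K†} K - K† {c, K}`, which is summable over the
labels: a single mode changes `Q` only by a bounded amount. -/
lemma norm_grad_decayOp_le (hw : IsWeight d w Z) (hK : JumpBounds w K κ₀ C δ) (hC : 0 ≤ C) (hκ : 0 ≤ κ₀)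
    (hZ : 0 ≤ Z) :
    ‖grad (decayOp K)‖ ≤ 4 * C * κ₀ * Z := by
  refine (pi_norm_le_iff_of_nonneg (by positivity)).mpr fun b => ?_
  have h1 : grad (decayOp K) b = ∑ a, (acomm b (star (K a)) * K a - star (K a) * acomm b (K a)) := by
    rw [grad_apply, decayOp, Finset.mul_sum, Finset.sum_mul, ← Finset.sum_sub_distrib]
    refine Finset.sum_congr rfl fun a _ => ?_
    rw [acomm, acomm, Matrix.star_eq_conjTranspose]
    noncomm_ring
  rw [h1]
  calc _ ≤ ∑ a : V × Bool, w a.1 b.1 * (2 * C * κ₀) := by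
        refine (norm_sum_le _ _).trans (Finset.sum_le_sum fun a _ => ?_)
        have e1 : w a.1 b.1 ^ 4 ≤ w a.1 b.1 :=
          pow_le_of_le_one (hw.nonneg _ _) (hw.le_one _ _) (by norm_num)
        have e2 : ‖acomm b (star (K a))‖ ≤ C * w a.1 b.1 := by
          rw [acomm_star, norm_star]
          exact (hK.decay a (flip b)).trans (by gcongr; exact e1)
        have e3 : ‖acomm b (K a)‖ ≤ C * w a.1 b.1 := (hK.decay a b).trans (by gcongr)
        have e4 := hK.norm_le a
        have e5 : ‖star (K a)‖ ≤ κ₀ := by rwa [norm_star]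
        have e6 := hw.nonneg a.1 b.1
        calc _ ≤ ‖acomm b (star (K a))‖ * ‖K a‖ + ‖star (K a)‖ * ‖acomm b (K a)‖ :=
              (norm_sub_le _ _).trans (add_le_add (norm_mul_le _ _) (norm_mul_le _ _))
          _ ≤ C * w a.1 b.1 * κ₀ + κ₀ * (C * w a.1 b.1) := by gcongr
          _ = _ := by ring
    _ ≤ 2 * Z * (2 * C * κ₀) := by
        rw [← Finset.sum_mul, sum_prod_bool fun i => w i b.1]
        have := hw.sum_le b.1
        simp only [hw.symm b.1] at this
        gcongr
    _ = _ := by ring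

/-- The constant in the variance bound. -/
def varConst (Z κ₀ C : ℝ) : ℝ := 4 * (16 * C * Z ^ 2 * (4 * C * κ₀ * Z)) ^ 2 + 2 * (4 * C * κ₀ * Z) ^ 2

/-- The variance comes from the noise added along the evolution and from the initial state. The
former is the integral of the carré du champ, of order `N e^{-(t-s)/2}` by gradient decay. The
latter is bounded by the Poincaré inequality. Both are of order `N`, uniformly in `t`. -/
lemma expect_heisEvolve_sq_le (hw : IsWeight d w Z) (hK : JumpBounds w K κ₀ C δ) (hC : 0 ≤ C)
    (hδ : 0 ≤ δ) (hκ : 0 ≤ κ₀) (hZ : 0 ≤ Z) (hsmall : δ * gradConst Z κ₀ C ≤ 1 / 4)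
    {t : ℝ} (ht : 0 ≤ t) :
    expect (maxMixed V) (heisEvolve K t (decayOp K * decayOp K)) ≤
      expect (maxMixed V) (heisEvolve K t (decayOp K)) ^ 2 + Fintype.card V * varConst Z κ₀ C := by
  set Q := decayOp K with hQ
  have hQs : star Q = Q := decayOp_isHermitian K
  set N : ℝ := ((Fintype.card V : ℕ) : ℝ) with hN
  set g := 4 * C * κ₀ * Z with hg
  set q := 16 * C * Z ^ 2 * g with hq
  have hgrad : ∀ u, 0 ≤ u → ‖grad (heisEvolve K u Q)‖ ≤ Real.exp (-(u / 4)) * g := fun u hu =>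
    (norm_grad_heisEvolve_le hw hK hC hδ hsmall Q hu).trans (by
      gcongr; exact norm_grad_decayOp_le hw hK hC hκ hZ)
  have hgam : ∀ s, 0 ≤ s → s ≤ t → expect (evolve (lind K) s (maxMixed V)) (∑ a,
        star (heisEvolve K (t - s) Q * K a - K a * heisEvolve K (t - s) Q) *
          (heisEvolve K (t - s) Q * K a - K a * heisEvolve K (t - s) Q)) ≤
        2 * N * q ^ 2 * Real.exp (-((t - s) / 2)) := by
    intro s hs hst
    set A := heisEvolve K (t - s) Q with hA
    rw [expect_evolve]
    refine (le_abs_self _).trans ((abs_expect_le maxMixed_mem _).trans ((norm_heisEvolve_le K _ hs).trans ?_))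
    calc _ ≤ ∑ _a : V × Bool, q ^ 2 * Real.exp (-((t - s) / 2)) := by
          refine (norm_sum_le _ _).trans (Finset.sum_le_sum fun a _ => ?_)
          rw [CStarRing.norm_star_mul_self, ← sq]
          have e1 := norm_commutator_odd_le hw (hK.odd a) hC a.1 (hK.decay a) A
          have e2 := hgrad (t - s) (by linarith)
          have e3 : ‖A * K a - K a * A‖ ≤ q * Real.exp (-((t - s) / 4)) := by
            refine e1.trans ?_
            calc _ ≤ 16 * C * Z ^ 2 * (Real.exp (-((t - s) / 4)) * g) := by gcongr
              _ = _ := by rw [hq]; ring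
          calc _ ≤ (q * Real.exp (-((t - s) / 4))) ^ 2 := by gcongr
            _ = q ^ 2 * Real.exp (-((t - s) / 2)) := by
                rw [mul_pow, ← Real.exp_nat_mul]
                congr 2
                push_cast; ring
      _ = _ := by
          rw [Finset.sum_const, nsmul_eq_mul]
          simp only [Finset.card_univ, Fintype.card_prod, Fintype.card_bool, hN]
          push_cast; ring
  -- The first term is a primitive of the bound on the carré du champ, so the difference is
  -- nondecreasing; its total variation is at most `4 N q²`.
  have h1 := le_of_hasDerivAt_nonneg (f := fun s => 4 * N * q ^ 2 * Real.exp (-((t - s) / 2)) -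
      expect (evolve (lind K) s (maxMixed V)) (heisEvolve K (t - s) Q * heisEvolve K (t - s) Q))
    (f' := fun s => 2 * N * q ^ 2 * Real.exp (-((t - s) / 2)) -
      expect (evolve (lind K) s (maxMixed V)) (∑ a,
        star (heisEvolve K (t - s) Q * K a - K a * heisEvolve K (t - s) Q) *
          (heisEvolve K (t - s) Q * K a - K a * heisEvolve K (t - s) Q))) ht
    (fun s => by
      refine HasDerivAt.fun_sub ?_ (hasDerivAt_expect_sq K (maxMixed V) hQs t s)
      have := ((((hasDerivAt_id s).const_sub t).div_const 2).fun_neg.exp).const_mul (4 * N * q ^ 2)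
      refine HasDerivAt.congr_deriv this ?_
      simp; ring)
    (fun s hs hst => by linarith [hgam s hs hst])
  simp only [sub_zero, sub_self, heisEvolve_zero_time, expect_evolve] at h1
  have h2 := expect_maxMixed_variance_le (heisEvolve K t Q) (star_heisEvolve K t hQs)
  have h3 : ∑ k, ‖defect 1 k (heisEvolve K t Q)‖ ^ 2 ≤ 2 * N * (2 * g) ^ 2 := by
    calc _ ≤ ∑ _k : V × Bool, (2 * g) ^ 2 := by
          refine Finset.sum_le_sum fun k _ => ?_
          have e1 := norm_defect_one_le k (heisEvolve K t Q)
          have e2 := hgrad t ht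
          have e3 : Real.exp (-(t / 4)) ≤ 1 := Real.exp_le_one_iff.mpr (by linarith)
          have hg0 : 0 ≤ g := by positivity
          have e4 : ‖defect 1 k (heisEvolve K t Q)‖ ≤ 2 * g := by nlinarith
          gcongr
      _ = _ := by
          rw [Finset.sum_const, nsmul_eq_mul]
          simp only [Finset.card_univ, Fintype.card_prod, Fintype.card_bool, hN]
          push_cast; ring
  have h4 : 0 ≤ 4 * N * q ^ 2 * Real.exp (-(t / 2)) := by positivity
  have h5 : Real.exp (-(0 / 2)) = 1 := by simp
  have h6 : N * varConst Z κ₀ C = 4 * N * q ^ 2 + 1 / 4 * (2 * N * (2 * g) ^ 2) := by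
    rw [varConst, hq, hg]; ring
  rw [h5] at h1
  linarith

/-- Many excitations are present in the maximally mixed state. -/
lemma expect_decayOp_maxMixed_ge (hw : IsWeight d w Z) (hK : JumpBounds w K κ₀ C δ) (hδ : 0 ≤ δ)
    (hδ' : δ ≤ 1 / 2) : (Fintype.card V : ℝ) / 16 ≤ expect (maxMixed V) (decayOp K) := by
  have h1 : ∀ i : V, 1 / 16 ≤ expect (maxMixed V) (star (K (i, false)) * K (i, false)) := by
    intro i
    set X := K (i, false) with hX
    set c : FockOp V := annihilation i with hc
    have e1 : acomm (i, true) X = 1 + acomm (i, true) (X - freeJump (i, false)) := by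
      have e2 : X = freeJump (i, false) + (X - freeJump (i, false)) := by abel
      conv_lhs => rw [e2]
      rw [acomm_add]
      congr 1
      have := annihilation_creation_anticomm i i
      rw [if_pos rfl, add_comm] at this
      simpa [acomm, ladder, freeJump] using this
    have e3 : ‖acomm (i, true) (X - freeJump (i, false))‖ ≤ 1 / 2 := by
      refine (hK.close (i, false) (i, true)).trans ?_
      have := pow_le_one₀ (n := 4) (hw.nonneg i i) (hw.le_one i i)
      simp only
      nlinarith
    have e4 : 1 / 2 ≤ expect (maxMixed V) (acomm (i, true) X) := by
      rw [e1, map_add, expect_one maxMixed_mem]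
      have := (abs_le.mp ((abs_expect_le maxMixed_mem _).trans e3)).1
      linarith
    have e5 : expect (maxMixed V) (acomm (i, true) X) = 2 * expect (maxMixed V) (star c * X) := by
      have : acomm (i, true) X = star c * X + X * star c := rfl
      rw [this, map_add, expect_maxMixed_comm X]; ring
    -- The expectation of `c† X` is at least `1/4` and that of `c† c` at most `1`. Completing the
    -- square with the multiple `1/4` gives `1/8 - 1/16 = 1/16`.
    have e6 := expect_star_mul_self_nonneg maxMixed_mem (X - ((1 / 4 : ℝ) : ℂ) • c)
    have e7 : star (X - ((1 / 4 : ℝ) : ℂ) • c) * (X - ((1 / 4 : ℝ) : ℂ) • c) =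
        star X * X - ((1 / 4 : ℝ) : ℂ) • (star X * c) - ((1 / 4 : ℝ) : ℂ) • (star c * X) +
          ((1 / 16 : ℝ) : ℂ) • (star c * c) := by
      rw [star_sub, star_smul, Complex.star_def, Complex.conj_ofReal]
      simp only [mul_sub, sub_mul, mul_smul_comm, smul_mul_assoc]
      push_cast
      module
    have e8 : expect (maxMixed V) (star X * c) = expect (maxMixed V) (star c * X) := by
      rw [← expect_maxMixed_star, star_mul, star_star]
    have e9 : expect (maxMixed V) (star c * c) ≤ 1 := by
      refine (le_abs_self _).trans ((abs_expect_le maxMixed_mem _).trans ?_)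
      rw [CStarRing.norm_star_mul_self]
      have := norm_ladder_le (i, false)
      simp only [ladder, Bool.false_eq_true, if_false] at this
      nlinarith [norm_nonneg (annihilation i)]
    rw [e7, map_add, map_sub, map_sub, expect_smul, expect_smul, expect_smul, e8] at e6
    linarith
  rw [decayOp, map_sum, Fintype.sum_prod_type]
  calc (Fintype.card V : ℝ) / 16 = ∑ _i : V, (1 / 16 : ℝ) := by
        rw [Finset.sum_const, nsmul_eq_mul, Finset.card_univ]; ring
    _ ≤ _ := by
        refine Finset.sum_le_sum fun i _ => ?_
        rw [Fintype.sum_bool]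
        have e1 := expect_star_mul_self_nonneg maxMixed_mem (K (i, true))
        have e2 := h1 i
        rw [Matrix.star_eq_conjTranspose] at e1 e2
        linarith

end Bounds

end LowerBounds

/-! ### Lower bounds from test observables, and the mixing time -/

section MixingTime

variable {V : Type} [LinearOrder V] [Fintype V]

lemma abs_expect_sub_le {ρ σ : FockOp V} (hρ : ρ.IsHermitian) (hσ : σ.IsHermitian) (X : FockOp V) :
    |expect ρ X - expect σ X| ≤ 2 * ‖X‖ * traceDistance ρ σ := by
  have hA : (ρ - σ).IsHermitian := hρ.sub hσ
  have h1 := norm_trace_mul_le hA X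
  rw [← traceNorm_eq hA] at h1
  have h2 : expect ρ X - expect σ X = ((X * (ρ - σ)).trace).re := by
    rw [mul_sub, Matrix.trace_sub, Complex.sub_re, expect_apply, expect_apply]
  rw [h2, traceDistance]
  refine (Complex.abs_re_le_norm _).trans (h1.trans (le_of_eq ?_))
  ring

lemma mul_pureState (X : FockOp V) (ψ : Finset V → ℂ) :
    X * pureState ψ = Matrix.vecMulVec (X *ᵥ ψ) (star ψ) := by
  rw [pureState, Matrix.mul_vecMulVec]

lemma star_pureState (ψ : Finset V → ℂ) : star (pureState ψ) = pureState ψ := by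
  rw [pureState, Matrix.star_eq_conjTranspose, Matrix.conjTranspose_vecMulVec, star_star]

lemma pureState_mul_self {ψ : Finset V → ℂ} (hψ : star ψ ⬝ᵥ ψ = 1) :
    pureState ψ * pureState ψ = pureState ψ := by
  rw [mul_pureState]
  congr 1
  rw [pureState, Matrix.vecMulVec_mulVec, hψ]
  simp

lemma norm_one_sub_pureState {ψ : Finset V → ℂ} (hψ : star ψ ⬝ᵥ ψ = 1) :
    ‖1 - (2 : ℂ) • pureState ψ‖ ≤ 1 := by
  refine norm_le_one_of_star_mul_self ?_
  have h1 := pureState_mul_self hψ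
  rw [star_sub, star_smul, star_pureState, star_one]
  simp only [mul_sub, sub_mul, mul_smul_comm, smul_mul_assoc, mul_one, one_mul, h1]
  have : star (2 : ℂ) = 2 := Complex.conj_ofNat 2
  rw [this]
  match_scalars <;> norm_num

lemma norm_pureState_le {ψ : Finset V → ℂ} (hψ : star ψ ⬝ᵥ ψ = 1) : ‖pureState ψ‖ ≤ 1 := by
  have h1 : ‖pureState ψ‖ = ‖pureState ψ‖ * ‖pureState ψ‖ := by
    rw [← CStarRing.norm_star_mul_self, star_pureState, pureState_mul_self hψ]
  by_contra h
  nlinarith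

lemma decayOp_mul_pureState {K : V × Bool → FockOp V} {ψ : Finset V → ℂ}
    (hψ : ∀ a, K a *ᵥ ψ = 0) : decayOp K * pureState ψ = 0 := by
  rw [decayOp, Finset.sum_mul]
  exact Finset.sum_eq_zero fun a _ => by
    rw [mul_assoc, mul_pureState, hψ]; simp

lemma pureState_mul_decayOp {K : V × Bool → FockOp V} {ψ : Finset V → ℂ}
    (hψ : ∀ a, K a *ᵥ ψ = 0) : pureState ψ * decayOp K = 0 := by
  have h := congrArg star (decayOp_mul_pureState hψ)
  rw [star_mul, star_pureState, star_zero] at h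
  have h2 : star (decayOp K) = decayOp K := decayOp_isHermitian K
  rwa [h2] at h

/-- The overlap with the target state is at least `1 - η` once the distance is at most `η`. -/
lemma one_sub_le_expect_pureState {ψ : Finset V → ℂ} (hψ : star ψ ⬝ᵥ ψ = 1) {ρ : FockOp V}
    (hρ : ρ.IsHermitian) (hρ1 : expect ρ 1 = 1) {η : ℝ} (h : traceDistance ρ (pureState ψ) ≤ η) :
    1 - η ≤ expect ρ (pureState ψ) := by
  have hσ := pureState_mem hψ
  -- Testing with the reflection `1 - 2|ψ⟩⟨ψ|` of norm at most one, rather than with the projection,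
  -- gives `1 - η` without losing a factor 2.
  have h1 := abs_expect_sub_le hρ hσ.1.1 (1 - ((2 : ℝ) : ℂ) • pureState ψ)
  have h2 : ‖1 - ((2 : ℝ) : ℂ) • pureState ψ‖ ≤ 1 := by
    rw [Complex.ofReal_ofNat]; exact norm_one_sub_pureState hψ
  rw [map_sub, map_sub, expect_smul, expect_smul, hρ1, expect_one hσ] at h1
  have h3 : expect (pureState ψ) (pureState ψ) = 1 := by
    rw [expect_apply, pureState_mul_self hψ, hσ.2, Complex.one_re]
  rw [h3] at h1
  have h4 : 0 ≤ traceDistance ρ (pureState ψ) := by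
    by_contra hneg
    have h5 := (abs_nonneg _).trans (abs_expect_sub_le hρ hσ.1.1 (1 : FockOp V))
    have h6 : (0 : ℝ) < ‖(1 : FockOp V)‖ := by
      rw [norm_pos_iff]; exact one_ne_zero
    push Not at hneg
    nlinarith
  have h5 := (le_abs_self _).trans h1
  nlinarith

section Bounds

variable {d : V → V → ℕ} {w : V → V → ℝ} {Z : ℝ} {K : V × Bool → FockOp V} {κ₀ C δ Γ : ℝ}
  {ψ : Finset V → ℂ} {η t : ℝ}

lemma expect_evolve_one (K : V × Bool → FockOp V) (t : ℝ) {ρ : FockOp V}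
    (hρ : ρ ∈ densityMatrices V) : expect (evolve (lind K) t ρ) 1 = 1 := by
  rw [expect_evolve, heisEvolve_one, expect_one hρ]

/-- The decay operator has mean at least `e^{-Γt} N/16` in the evolved state and zero in the dark
state, while its norm is at most `2 N κ₀²`. The factors `N` cancel, so this forces growth of `t` in
`1/η` only. -/
lemma exp_neg_le_of_traceDistance_le (hw : IsWeight d w Z) (hK : JumpBounds w K κ₀ C δ) (hδ : 0 ≤ δ)
    (hδ' : δ ≤ 1 / 2) (hΓ : ∀ a, ∑ b, ‖jumpGram K a b‖ ≤ Γ) (hcard : 0 < Fintype.card V)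
    (hψ1 : star ψ ⬝ᵥ ψ = 1) (hψ : ∀ a, K a *ᵥ ψ = 0) (ht : 0 ≤ t)
    (h : traceDistance (evolve (lind K) t (maxMixed V)) (pureState ψ) ≤ η) :
    Real.exp (-(Γ * t)) ≤ 64 * κ₀ ^ 2 * η := by
  have hN : (0 : ℝ) < Fintype.card V := by exact_mod_cast hcard
  have h1 := expect_decayOp_ge hΓ maxMixed_mem ht
  have h2 := expect_decayOp_maxMixed_ge hw hK hδ hδ'
  have h3 := abs_expect_sub_le (evolve_isHermitian K t (maxMixed_mem (V := V)).1.1)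
    (pureState_mem hψ1).1.1 (decayOp K)
  have h4 : expect (pureState ψ) (decayOp K) = 0 := by
    rw [expect_apply, decayOp_mul_pureState hψ]; simp
  rw [h4, sub_zero, expect_evolve] at h3
  have h5 := norm_decayOp_le hK
  have h6 := Real.exp_pos (-(Γ * t))
  have h7 : Real.exp (-(Γ * t)) * (Fintype.card V / 16) ≤ 2 * ‖decayOp K‖ * η := by
    calc _ ≤ Real.exp (-(Γ * t)) * expect (maxMixed V) (decayOp K) := by gcongr
      _ ≤ _ := h1
      _ ≤ _ := le_abs_self _
      _ ≤ _ := h3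
      _ ≤ _ := by gcongr
  have hη : 0 ≤ η := by
    by_contra hneg
    push Not at hneg
    nlinarith [norm_nonneg (decayOp K), mul_pos h6 hN]
  have h8 : Real.exp (-(Γ * t)) * (Fintype.card V / 16) ≤
      (64 * κ₀ ^ 2 * η) * (Fintype.card V / 16) := by
    refine h7.trans ?_
    calc _ ≤ 2 * (2 * Fintype.card V * κ₀ ^ 2) * η := by gcongr
      _ = _ := by ring
  exact le_of_mul_le_mul_right h8 (by positivity)

/-- A Chebyshev argument: on the dark state `Q` vanishes and deviates from its mean `m` by all of
`m`. An overlap `p ≥ 1 - η` therefore costs a variance of at least `m² p`, whereas `m` is of order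
`e^{-Γt} N` and the variance of order `N`. -/
lemma card_le_of_traceDistance_le (hw : IsWeight d w Z) (hK : JumpBounds w K κ₀ C δ) (hC : 0 ≤ C)
    (hκ : 0 ≤ κ₀) (hZ : 0 ≤ Z) (hsmall : δ * gradConst Z κ₀ C ≤ 1 / 4) (hδ : 0 ≤ δ)
    (hδ' : δ ≤ 1 / 2) (hΓ : ∀ a, ∑ b, ‖jumpGram K a b‖ ≤ Γ) (hcard : 0 < Fintype.card V)
    (hψ1 : star ψ ⬝ᵥ ψ = 1) (hψ : ∀ a, K a *ᵥ ψ = 0) (ht : 0 ≤ t) (hη : η ≤ 1)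
    (h : traceDistance (evolve (lind K) t (maxMixed V)) (pureState ψ) ≤ η) :
    (1 - η) * Fintype.card V ≤ 256 * varConst Z κ₀ C * Real.exp (2 * (Γ * t)) := by
  have hN : (0 : ℝ) < Fintype.card V := by exact_mod_cast hcard
  set N : ℝ := ((Fintype.card V : ℕ) : ℝ)
  set Q := decayOp K with hQ
  have hQs : star Q = Q := decayOp_isHermitian K
  set σ := pureState ψ with hσ
  set ρ := maxMixed V
  set m := expect ρ (heisEvolve K t Q) with hm
  have h1 : Real.exp (-(Γ * t)) * expect ρ Q ≤ m := expect_decayOp_ge hΓ maxMixed_mem ht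
  have h2 : N / 16 ≤ expect ρ Q := expect_decayOp_maxMixed_ge hw hK hδ hδ'
  have h3 : expect ρ (heisEvolve K t (Q * Q)) ≤ m ^ 2 + N * varConst Z κ₀ C :=
    expect_heisEvolve_sq_le hw hK hC hδ hκ hZ hsmall ht
  have h4 := one_sub_le_expect_pureState hψ1 (evolve_isHermitian K t (maxMixed_mem (V := V)).1.1)
    (expect_evolve_one K t maxMixed_mem) h
  rw [expect_evolve] at h4
  set p := expect ρ (heisEvolve K t σ) with hp
  -- Positivity of this square, with `Q σ = σ Q = 0`, is the operator form of `m² p ≤` variance.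
  have h5 : star ((1 - σ) * (Q - (m : ℂ) • 1)) * ((1 - σ) * (Q - (m : ℂ) • 1)) =
      Q * Q - ((2 * m : ℝ) : ℂ) • Q + ((m ^ 2 : ℝ) : ℂ) • 1 - ((m ^ 2 : ℝ) : ℂ) • σ := by
    have e1 : σ * σ = σ := pureState_mul_self hψ1
    have e2 : Q * σ = 0 := decayOp_mul_pureState hψ
    have e3 : σ * Q = 0 := pureState_mul_decayOp hψ
    have e4 : star σ = σ := star_pureState ψ
    have e5 : (1 - σ) * (Q - (m : ℂ) • 1) = Q - (m : ℂ) • 1 + (m : ℂ) • σ := by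
      simp only [mul_sub, sub_mul, mul_smul_comm, one_mul, mul_one, e3]
      module
    rw [e5, star_add, star_sub, star_smul, star_smul, star_one, e4, hQs, Complex.star_def,
      Complex.conj_ofReal]
    simp only [mul_add, add_mul, mul_sub, sub_mul, mul_smul_comm, smul_mul_assoc, one_mul, mul_one,
      e1, e2, e3, smul_smul, smul_add, smul_sub]
    push_cast
    match_scalars <;> ring
  have h6 := expect_heisEvolve_nonneg K ht
    (Matrix.posSemidef_conjTranspose_mul_self ((1 - σ) * (Q - (m : ℂ) • 1)))
    (maxMixed_mem (V := V))
  rw [← Matrix.star_eq_conjTranspose, h5, heisEvolve_sub, heisEvolve_add, heisEvolve_sub, heisEvolve_smul,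
    heisEvolve_smul, heisEvolve_smul, heisEvolve_one, map_sub, map_add, map_sub, expect_smul,
    expect_smul, expect_smul, expect_one maxMixed_mem] at h6
  have h7 : m ^ 2 * p ≤ N * varConst Z κ₀ C := by
    change 0 ≤ expect ρ (heisEvolve K t (Q * Q)) - 2 * m * m + m ^ 2 * 1 - m ^ 2 * p at h6
    linarith
  set e := Real.exp (-(Γ * t)) with he
  have he0 : 0 < e := Real.exp_pos _
  have h8 : e * (N / 16) ≤ m := le_trans (by gcongr) h1
  have h9 : (e * (N / 16)) ^ 2 * (1 - η) ≤ N * varConst Z κ₀ C := by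
    refine le_trans ?_ h7
    have : 0 ≤ 1 - η := by linarith
    gcongr
  have h10 : e ^ 2 * Real.exp (2 * (Γ * t)) = 1 := by
    rw [he, ← Real.exp_nat_mul, ← Real.exp_add]
    simp
  have h11 : 0 < Real.exp (2 * (Γ * t)) := Real.exp_pos _
  have h12 : (1 - η) * N * N ≤ 256 * varConst Z κ₀ C * Real.exp (2 * (Γ * t)) * N := by
    calc (1 - η) * N * N = (e ^ 2 * Real.exp (2 * (Γ * t))) * ((1 - η) * N * N) := by
          rw [h10, one_mul]
      _ = 256 * Real.exp (2 * (Γ * t)) * ((e * (N / 16)) ^ 2 * (1 - η)) := by ring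
      _ ≤ 256 * Real.exp (2 * (Γ * t)) * (N * varConst Z κ₀ C) := by gcongr
      _ = _ := by ring
  exact le_of_mul_le_mul_right h12 hN

lemma norm_heis_le (hK : JumpBounds w K κ₀ C δ) {X : FockOp V} (hX : ‖X‖ ≤ 1) :
    ‖heis 1 K X‖ ≤ 4 * Fintype.card V * κ₀ ^ 2 := by
  have h1 := norm_decayOp_le hK
  have h2 : ‖∑ a, (K a)ᴴ * X * K a‖ ≤ 2 * Fintype.card V * κ₀ ^ 2 := by
    calc _ ≤ ∑ _a : V × Bool, κ₀ ^ 2 := by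
          refine (norm_sum_le _ _).trans (Finset.sum_le_sum fun a _ => ?_)
          have e1 := hK.norm_le a
          have e2 : ‖(K a)ᴴ‖ ≤ κ₀ := by rwa [← Matrix.star_eq_conjTranspose, norm_star]
          have e3 : 0 ≤ κ₀ := (norm_nonneg _).trans e1
          calc _ ≤ ‖(K a)ᴴ‖ * ‖X‖ * ‖K a‖ := (norm_mul_le _ _).trans (by gcongr; exact norm_mul_le _ _)
            _ ≤ κ₀ * 1 * κ₀ := by gcongr
            _ = _ := by ring
      _ = _ := by
          rw [Finset.sum_const, nsmul_eq_mul]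
          simp only [Finset.card_univ, Fintype.card_prod, Fintype.card_bool]
          push_cast; ring
  rw [heis_apply, one_smul]
  have h3 : ‖decayOp K * X‖ ≤ 2 * Fintype.card V * κ₀ ^ 2 :=
    (norm_mul_le _ _).trans (by nlinarith [norm_nonneg X, norm_nonneg (decayOp K)])
  have h4 : ‖X * decayOp K‖ ≤ 2 * Fintype.card V * κ₀ ^ 2 :=
    (norm_mul_le _ _).trans (by nlinarith [norm_nonneg X, norm_nonneg (decayOp K)])
  have h5 : ‖(1 / 2 : ℂ) • (decayOp K * X + X * decayOp K)‖ ≤ 2 * Fintype.card V * κ₀ ^ 2 := by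
    rw [norm_smul]
    have := norm_add_le (decayOp K * X) (X * decayOp K)
    norm_num
    linarith
  refine (norm_sub_le _ _).trans ?_
  linarith

/-- The vacuum and a state with two particles span a plane of even vectors, which contains a unit
vector orthogonal to `ψ`. This is where two sites are needed. -/
lemma exists_even_orthogonal (hcard : 2 ≤ Fintype.card V) (ψ : Finset V → ℂ) :
    ∃ φ : Finset V → ℂ, star φ ⬝ᵥ φ = 1 ∧ star ψ ⬝ᵥ φ = 0 ∧
      pureState φ ∈ evenDensityMatrices V := by
  obtain ⟨x, y, hxy⟩ := Fintype.exists_pair_of_one_lt_card (by omega : 1 < Fintype.card V)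
  set S : Finset V := {x, y} with hS
  have hS2 : S.card = 2 := Finset.card_pair hxy
  have hS0 : (∅ : Finset V) ≠ S := by
    intro h; rw [← h] at hS2; simp at hS2
  obtain ⟨u, v, huv, horth⟩ : ∃ u v : ℂ, star u * u + star v * v = 1 ∧
      star (ψ ∅) * u + star (ψ S) * v = 0 := by
    by_cases h0 : ψ ∅ = 0
    · exact ⟨1, 0, by simp, by simp [h0]⟩
    · set r : ℝ := Real.sqrt (‖ψ ∅‖ ^ 2 + ‖ψ S‖ ^ 2) with hr
      have hpos : 0 < ‖ψ ∅‖ ^ 2 + ‖ψ S‖ ^ 2 := by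
        have : 0 < ‖ψ ∅‖ := norm_pos_iff.mpr h0
        positivity
      have hr0 : (r : ℂ) ≠ 0 := by
        exact_mod_cast (Real.sqrt_pos.mpr hpos).ne'
      have hr2 : (r : ℂ) * r = ψ ∅ * star (ψ ∅) + ψ S * star (ψ S) := by
        have h1 : r * r = ‖ψ ∅‖ ^ 2 + ‖ψ S‖ ^ 2 := Real.mul_self_sqrt hpos.le
        have h2 := congrArg (fun z : ℝ => (z : ℂ)) h1
        push_cast at h2
        rw [h2, Complex.star_def, Complex.mul_conj', Complex.mul_conj']
      refine ⟨star (ψ S) / r, -(star (ψ ∅)) / r, ?_, by ring⟩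
      simp only [Complex.star_def, map_div₀, map_neg, Complex.conj_conj, Complex.conj_ofReal] at hr2 ⊢
      field_simp
      linear_combination -hr2
  refine ⟨fun T => if T = ∅ then u else if T = S then v else 0, ?_⟩
  set φ : Finset V → ℂ := fun T => if T = ∅ then u else if T = S then v else 0 with hφ
  have hsum : ∀ g : Finset V → ℂ, ∑ T, g T * φ T = g ∅ * u + g S * v := by
    intro g
    rw [Fintype.sum_eq_add ∅ S hS0]
    · simp [hφ, hS0.symm]
    · rintro T ⟨h1, h2⟩
      simp [hφ, h1, h2]
  have h1 : star φ ⬝ᵥ φ = 1 := by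
    rw [dotProduct, hsum, ← huv]
    simp [hφ, hS0.symm]
  refine ⟨h1, ?_, pureState_mem h1, ?_⟩
  · rw [dotProduct, hsum]
    exact horth
  · have heven : ∀ T, φ T ≠ 0 → (-1 : ℂ) ^ T.card = 1 := by
      intro T hT
      by_cases hT0 : T = ∅
      · simp [hT0]
      · by_cases hTS : T = S
        · rw [hTS, hS2]; norm_num
        · simp [hφ, hT0, hTS] at hT
    have : ∀ A B, (parity * pureState φ : FockOp V) A B = (pureState φ * parity : FockOp V) A B := by
      intro A B
      rw [parity, Matrix.diagonal_mul, Matrix.mul_diagonal, pureState, Matrix.vecMulVec_apply]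
      by_cases hA : φ A = 0
      · simp [hA]
      · by_cases hB : φ B = 0
        · simp [hB]
        · rw [heven A hA, heven B hB]; ring
    exact Matrix.ext this

/-- The overlap with `ψ` starts at zero and grows at most at the rate `‖heis 1 K (pureState ψ)‖`.
The bound excludes arbitrarily short times when `N` is bounded and `η` is not small, where the other
two lower bounds may be void. -/
lemma one_sub_le_of_traceDistance_le (hK : JumpBounds w K κ₀ C δ)
    (hψ1 : star ψ ⬝ᵥ ψ = 1) (ht : 0 ≤ t) {φ : Finset V → ℂ} (hφ1 : star φ ⬝ᵥ φ = 1)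
    (hφ : star ψ ⬝ᵥ φ = 0)
    (h : traceDistance (evolve (lind K) t (pureState φ)) (pureState ψ) ≤ η) :
    1 - η ≤ 4 * Fintype.card V * κ₀ ^ 2 * t := by
  have hρ := pureState_mem hφ1
  have h1 := one_sub_le_expect_pureState hψ1 (evolve_isHermitian K t hρ.1.1)
    (expect_evolve_one K t hρ) h
  rw [expect_evolve] at h1
  have h2 := le_of_hasDerivAt_nonneg (f := fun s => 4 * Fintype.card V * κ₀ ^ 2 * s -
      expect (pureState φ) (heisEvolve K s (pureState ψ)))
    (f' := fun s => 4 * Fintype.card V * κ₀ ^ 2 -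
      expect (pureState φ) (heisEvolve K s (heis 1 K (pureState ψ)))) ht
    (fun s => by
      refine HasDerivAt.fun_sub ?_ (hasDerivAt_expect K _ _ s)
      simpa using (hasDerivAt_id s).const_mul (4 * Fintype.card V * κ₀ ^ 2))
    (fun s hs _ => by
      have e1 := (abs_expect_le hρ (heisEvolve K s (heis 1 K (pureState ψ)))).trans
        ((norm_heisEvolve_le K _ hs).trans (norm_heis_le hK (norm_pureState_le hψ1)))
      linarith [le_abs_self (expect (pureState φ) (heisEvolve K s (heis 1 K (pureState ψ))))])
  have h3 : expect (pureState φ) (pureState ψ) = 0 := by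
    rw [expect_apply, mul_pureState, pureState, Matrix.vecMulVec_mulVec, hφ]
    simp
  simp only [heisEvolve_zero_time, h3, mul_zero, sub_zero] at h2
  linarith

end Bounds

/-- The first two inequalities multiply to `N/η ≤ A e^{3Γt}`. If `log (N/η) ≥ 2 log A`, half of the
logarithm absorbs `log A`. Otherwise `N ≤ A²` and the logarithm is bounded, and the third inequality
keeps `t` away from zero. -/
lemma exists_log_le {κ₀ Γ B η₀ : ℝ} (hκ : 0 < κ₀) (hΓ : 0 < Γ) (hB : 0 < B) (hη₀ : η₀ < 1) :
    ∃ c > 0, ∀ N t η : ℝ, 1 ≤ N → 0 ≤ t → 0 < η → η ≤ η₀ →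
      Real.exp (-(Γ * t)) ≤ 64 * κ₀ ^ 2 * η →
      (1 - η) * N ≤ 256 * B * Real.exp (2 * (Γ * t)) →
      1 - η ≤ 4 * N * κ₀ ^ 2 * t → c * Real.log (N / η) ≤ t := by
  have hβ : 0 < 1 - η₀ := by linarith
  set A : ℝ := 1 + 256 * B / (1 - η₀) * (64 * κ₀ ^ 2) with hA
  have hA1 : 1 < A := by
    have : 0 < 256 * B / (1 - η₀) * (64 * κ₀ ^ 2) := by positivity
    linarith
  have hlA : 0 < Real.log A := Real.log_pos hA1
  set c₂ : ℝ := (1 - η₀) / (4 * A ^ 2 * κ₀ ^ 2 * (2 * Real.log A)) with hc₂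
  have hc₂0 : 0 < c₂ := by positivity
  refine ⟨min (1 / (6 * Γ)) c₂, by positivity, ?_⟩
  intro N t η hN ht hη hη1 ha hb hc
  have hN0 : 0 < N := by linarith
  have hη' : η ≤ 1 := by linarith
  have hx1 : 1 ≤ N / η := by rw [le_div_iff₀ hη]; linarith
  have hlx : 0 ≤ Real.log (N / η) := Real.log_nonneg hx1
  have h1 : N / η ≤ A * Real.exp (3 * (Γ * t)) := by
    have e1 : N ≤ 256 * B / (1 - η₀) * Real.exp (2 * (Γ * t)) := by
      rw [div_mul_eq_mul_div, le_div_iff₀ hβ]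
      nlinarith
    have e2 : 1 ≤ 64 * κ₀ ^ 2 * η * Real.exp (Γ * t) := by
      have := mul_le_mul_of_nonneg_right ha (Real.exp_pos (Γ * t)).le
      rwa [← Real.exp_add, neg_add_cancel, Real.exp_zero] at this
    have e3 : Real.exp (3 * (Γ * t)) = Real.exp (2 * (Γ * t)) * Real.exp (Γ * t) := by
      rw [← Real.exp_add]; ring_nf
    rw [div_le_iff₀ hη, e3]
    have h0 := Real.exp_pos (2 * (Γ * t))
    have h0' := Real.exp_pos (Γ * t)
    calc N ≤ N * (64 * κ₀ ^ 2 * η * Real.exp (Γ * t)) := le_mul_of_one_le_right hN0.le e2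
      _ ≤ 256 * B / (1 - η₀) * Real.exp (2 * (Γ * t)) * (64 * κ₀ ^ 2 * η * Real.exp (Γ * t)) := by
          gcongr
      _ = (256 * B / (1 - η₀) * (64 * κ₀ ^ 2)) * (Real.exp (2 * (Γ * t)) * Real.exp (Γ * t)) * η := by
          ring
      _ ≤ _ := by gcongr; linarith
  have h2 : Real.log (N / η) ≤ Real.log A + 3 * (Γ * t) := by
    have := Real.log_le_log (by positivity) h1
    rwa [Real.log_mul (by positivity) (Real.exp_pos _).ne', Real.log_exp] at this
  by_cases hcase : 2 * Real.log A ≤ Real.log (N / η)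
  · calc _ ≤ 1 / (6 * Γ) * Real.log (N / η) := by gcongr; exact min_le_left _ _
      _ ≤ t := by
        rw [div_mul_eq_mul_div, div_le_iff₀ (by positivity)]
        linarith
  · push Not at hcase
    have h3 : N ≤ A ^ 2 := by
      have e1 : Real.log N ≤ Real.log (A ^ 2) := by
        rw [Real.log_pow]
        push_cast
        refine le_trans (Real.log_le_log hN0 ?_) hcase.le
        rw [le_div_iff₀ hη]
        nlinarith
      exact (Real.log_le_log_iff hN0 (by positivity)).mp e1
    have h4 : 1 - η₀ ≤ 4 * A ^ 2 * κ₀ ^ 2 * t := by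
      calc 1 - η₀ ≤ 1 - η := by linarith
        _ ≤ _ := hc
        _ ≤ _ := by gcongr
    calc _ ≤ c₂ * (2 * Real.log A) := by
          gcongr
          exact min_le_right _ _
      _ = (1 - η₀) / (4 * A ^ 2 * κ₀ ^ 2) := by
          rw [hc₂]; field_simp
      _ ≤ t := by
          rw [div_le_iff₀ (by positivity)]
          linarith

lemma evenDensityMatrices_subset : evenDensityMatrices V ⊆ densityMatrices V := fun _ h => h.1

/-- Mixing time bounds for jump operators close to the free ones. -/
theorem exists_mixingTime_bounds {Z κ₀ C Γ η₀ : ℝ} (hZ : 0 ≤ Z) (hκ : 0 < κ₀) (hC : 0 ≤ C)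
    (hΓ : 0 < Γ) (hη₀ : η₀ < 1) :
    ∃ c > 0, ∀ (V : Type) [LinearOrder V] [Fintype V] (d : V → V → ℕ) (w : V → V → ℝ)
      (K : V × Bool → FockOp V) (δ : ℝ) (ψ : Finset V → ℂ) (𝒮 : Set (FockOp V)) (η : ℝ),
      2 ≤ Fintype.card V → IsWeight d w Z → JumpBounds w K κ₀ C δ → 0 ≤ δ → δ ≤ 1 / 2 →
      δ * gradConst Z κ₀ C ≤ 1 / 4 → (∀ a, ∑ b, ‖jumpGram K a b‖ ≤ Γ) →
      star ψ ⬝ᵥ ψ = 1 → (∀ a, K a *ᵥ ψ = 0) →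
      (𝒮 = densityMatrices V ∨ 𝒮 = evenDensityMatrices V) → 0 < η → η ≤ η₀ →
      ∃ τ, IsMixingTime 𝒮 (lind K) (pureState ψ) η τ ∧
        c * Real.log (Fintype.card V / η) ≤ τ ∧ τ ≤ 12 * Real.log (Fintype.card V / η) := by
  have hB : 0 < varConst Z κ₀ C + 1 := by
    rw [varConst]; positivity
  obtain ⟨c, hc, H⟩ := exists_log_le hκ hΓ hB hη₀
  refine ⟨c, hc, ?_⟩
  intro V _ _ d w K δ ψ 𝒮 η hcard hw hK hδ hδ' hsmall hgram hψ1 hψ h𝒮 hη hη1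
  have h𝒮1 : 𝒮 ⊆ densityMatrices V := by
    rcases h𝒮 with rfl | rfl
    exacts [subset_rfl, evenDensityMatrices_subset]
  have h𝒮2 : evenDensityMatrices V ⊆ 𝒮 := by
    rcases h𝒮 with rfl | rfl
    exacts [evenDensityMatrices_subset, subset_rfl]
  have hN : (2 : ℝ) ≤ Fintype.card V := by exact_mod_cast hcard
  set N : ℝ := ((Fintype.card V : ℕ) : ℝ) with hNdef
  have hx : 2 ≤ N / η := by rw [le_div_iff₀ hη]; nlinarith
  have hlx : 0 ≤ Real.log (N / η) := Real.log_nonneg (by linarith)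
  -- At this time `4 N e^{-t/4} = 4 N (η/N)³`, which is at most `η` because `N/η ≥ 2`.
  obtain ⟨τ, hτ, hτ1⟩ := exists_isMixingTime h𝒮1 K hψ1 (η := η)
    (t₀ := 12 * Real.log (N / η)) (by positivity) (fun ρ hρ => by
      refine (traceDistance_evolve_le hw hK hC hδ hsmall hψ1 hψ (h𝒮1 hρ) (by positivity)).trans ?_
      have e1 : Real.exp (-(12 * Real.log (N / η) / 4)) = ((N / η) ^ 3)⁻¹ := by
        rw [← Real.exp_log (show 0 < N / η by positivity), Real.exp_log (by positivity), Real.exp_neg]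
        congr 1
        rw [show 12 * Real.log (N / η) / 4 = (3 : ℕ) * Real.log (N / η) by push_cast; ring,
          Real.exp_nat_mul, Real.exp_log (by positivity)]
      rw [e1, ← div_eq_mul_inv, div_le_iff₀ (by positivity)]
      have e2 : η * (N / η) ^ 3 = N * (N / η) ^ 2 := by field_simp
      rw [e2]
      nlinarith [mul_le_mul hx hx (by norm_num) (by positivity)])
  refine ⟨τ, hτ, ?_, hτ1⟩
  -- Both test states are even, so the lower bound holds for either class of initial states.
  have hmix := hτ.1.2 _ (h𝒮2 maxMixed_mem_even)
  obtain ⟨φ, hφ1, hφ2, hφ3⟩ := exists_even_orthogonal hcard ψ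
  refine H N τ η (by linarith) hτ.1.1 hη hη1
    (exp_neg_le_of_traceDistance_le hw hK hδ hδ' hgram (by omega) hψ1 hψ hτ.1.1 hmix) ?_
    (one_sub_le_of_traceDistance_le hK hψ1 hτ.1.1 hφ1 hφ2 (hτ.1.2 _ (h𝒮2 hφ3)))
  refine (card_le_of_traceDistance_le hw hK hC hκ.le hZ hsmall hδ hδ' hgram (by omega) hψ1 hψ
    hτ.1.1 (by linarith) hmix).trans ?_
  gcongr
  linarith

end MixingTime

/-! ### Lattice geometry and summable weights -/

section Lattice

/-- The distance of two coordinates. -/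
def coordDist (periodic : Bool) (L : ℕ) (a b : Fin (L + 1)) : ℕ :=
  if periodic then min ((((a : ℕ) : ℤ) - ((b : ℕ) : ℤ)).natAbs)
    (L + 1 - (((a : ℕ) : ℤ) - ((b : ℕ) : ℤ)).natAbs)
  else (((a : ℕ) : ℤ) - ((b : ℕ) : ℤ)).natAbs

lemma manhattan_eq (periodic : Bool) {D L : ℕ} (x y : LatticeSite D L) :
    manhattan periodic x y = ∑ k, coordDist periodic L (ofLex x k) (ofLex y k) := rfl

lemma coordDist_self (periodic : Bool) (L : ℕ) (a : Fin (L + 1)) : coordDist periodic L a a = 0 := by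
  simp [coordDist]

lemma coordDist_comm (periodic : Bool) (L : ℕ) (a b : Fin (L + 1)) :
    coordDist periodic L a b = coordDist periodic L b a := by
  unfold coordDist
  split_ifs <;> omega

lemma coordDist_triangle (periodic : Bool) (L : ℕ) (a b c : Fin (L + 1)) :
    coordDist periodic L a c ≤ coordDist periodic L a b + coordDist periodic L b c := by
  have ha := a.2
  have hb := b.2
  have hc := c.2
  unfold coordDist
  split_ifs <;> omega

variable {D L : ℕ} (periodic : Bool)

lemma manhattan_self (x : LatticeSite D L) : manhattan periodic x x = 0 := by
  simp [manhattan_eq, coordDist_self]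

lemma manhattan_comm (x y : LatticeSite D L) : manhattan periodic x y = manhattan periodic y x := by
  simp only [manhattan_eq]
  exact Finset.sum_congr rfl fun k _ => coordDist_comm _ _ _ _

lemma manhattan_triangle (x y z : LatticeSite D L) :
    manhattan periodic x z ≤ manhattan periodic x y + manhattan periodic y z := by
  simp only [manhattan_eq, ← Finset.sum_add_distrib]
  exact Finset.sum_le_sum fun k _ => coordDist_triangle _ _ _ _ _

lemma summable_inv_sq : Summable fun n : ℕ => ((1 + n : ℝ) ^ 2)⁻¹ := by
  have h : Summable fun n : ℕ => (((n : ℝ)) ^ 2)⁻¹ := Real.summable_nat_pow_inv.mpr one_lt_two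
  have h2 := (summable_nat_add_iff 1).mpr h
  refine h2.congr fun n => ?_
  push_cast
  rw [add_comm]

/-- `∑ₙ (1 + n)⁻²`. -/
def invSqSum : ℝ := ∑' n : ℕ, ((1 + n : ℝ) ^ 2)⁻¹

lemma invSqSum_nonneg : 0 ≤ invSqSum := tsum_nonneg fun _ => by positivity

lemma sum_inv_sq_le_of_injOn {ι : Type*} (s : Finset ι) (g : ι → ℕ) (hg : Set.InjOn g s) :
    ∑ i ∈ s, ((1 + g i : ℝ) ^ 2)⁻¹ ≤ invSqSum := by
  have h := Finset.sum_image (f := fun n : ℕ => ((1 + n : ℝ) ^ 2)⁻¹) hg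
  rw [← h]
  exact summable_inv_sq.sum_le_tsum _ fun _ _ => by positivity

/-- The coordinate distance is either `|a - b|` or `L + 1 - |a - b|`, and each of these is injective
on `b ≤ a` and on `b > a`; hence four copies of the series. -/
lemma sum_inv_sq_coordDist_le (a : Fin (L + 1)) :
    ∑ b, ((1 + coordDist periodic L a b : ℝ) ^ 2)⁻¹ ≤ 4 * invSqSum := by
  have ha := a.2
  have h1 : ∀ g : Fin (L + 1) → ℕ, Set.InjOn g {b | b ≤ a} → Set.InjOn g {b | ¬ b ≤ a} →
      ∑ b, ((1 + g b : ℝ) ^ 2)⁻¹ ≤ 2 * invSqSum := by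
    intro g h1 h2
    rw [← Finset.sum_filter_add_sum_filter_not Finset.univ (fun b => b ≤ a)]
    have e1 := sum_inv_sq_le_of_injOn (Finset.univ.filter fun b => b ≤ a) g (by simpa using h1)
    have e2 := sum_inv_sq_le_of_injOn (Finset.univ.filter fun b => ¬ b ≤ a) g (by simpa using h2)
    linarith
  have h2 := h1 (fun b => (((a : ℕ) : ℤ) - ((b : ℕ) : ℤ)).natAbs)
    (fun b hb c hc hbc => by
      have hb' : (b : ℕ) ≤ a := hb
      have hc' : (c : ℕ) ≤ a := hc
      simp only at hbc
      exact Fin.ext (by omega))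
    (fun b hb c hc hbc => by
      have hb' : ¬ (b : ℕ) ≤ a := hb
      have hc' : ¬ (c : ℕ) ≤ a := hc
      simp only at hbc
      exact Fin.ext (by omega))
  have h3 := h1 (fun b => L + 1 - (((a : ℕ) : ℤ) - ((b : ℕ) : ℤ)).natAbs)
    (fun b hb c hc hbc => by
      have hb' : (b : ℕ) ≤ a := hb
      have hc' : (c : ℕ) ≤ a := hc
      simp only at hbc
      exact Fin.ext (by omega))
    (fun b hb c hc hbc => by
      have hb' : ¬ (b : ℕ) ≤ a := hb
      have hc' : ¬ (c : ℕ) ≤ a := hc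
      have := b.2
      have := c.2
      simp only at hbc
      exact Fin.ext (by omega))
  have h4 := invSqSum_nonneg
  have h5 : ∀ b : Fin (L + 1), ((1 + coordDist periodic L a b : ℝ) ^ 2)⁻¹ ≤
      ((1 + ((((a : ℕ) : ℤ) - ((b : ℕ) : ℤ)).natAbs : ℕ) : ℝ) ^ 2)⁻¹ +
      ((1 + (L + 1 - (((a : ℕ) : ℤ) - ((b : ℕ) : ℤ)).natAbs : ℕ) : ℝ) ^ 2)⁻¹ := by
    intro b
    set u := (((a : ℕ) : ℤ) - ((b : ℕ) : ℤ)).natAbs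
    have e1 : (0 : ℝ) ≤ ((1 + (u : ℕ) : ℝ) ^ 2)⁻¹ := by positivity
    have e2 : (0 : ℝ) ≤ ((1 + ((L + 1 - u : ℕ) : ℕ) : ℝ) ^ 2)⁻¹ := by positivity
    have e3 : coordDist periodic L a b = u ∨ coordDist periodic L a b = L + 1 - u := by
      simp only [coordDist]
      split_ifs
      · exact min_choice _ _
      · exact Or.inl rfl
    rcases e3 with e3 | e3 <;> rw [e3] <;> linarith
  refine (Finset.sum_le_sum fun b _ => h5 b).trans ?_
  rw [Finset.sum_add_distrib]
  linarith

/-- The weight `(1 + d(x, y))^{-2D}`. -/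
def latticeWeight (periodic : Bool) {D L : ℕ} (x y : LatticeSite D L) : ℝ :=
  ((1 + manhattan periodic x y : ℝ) ^ (2 * D))⁻¹

lemma prod_one_add_le (x y : LatticeSite D L) :
    ∏ k, (1 + coordDist periodic L (ofLex x k) (ofLex y k) : ℝ) ^ 2 ≤
      (1 + manhattan periodic x y : ℝ) ^ (2 * D) := by
  have h : ∀ k, (1 + coordDist periodic L (ofLex x k) (ofLex y k) : ℝ) ≤
      1 + manhattan periodic x y := by
    intro k
    have : coordDist periodic L (ofLex x k) (ofLex y k) ≤ manhattan periodic x y := by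
      rw [manhattan_eq]
      exact Finset.single_le_sum (f := fun k => coordDist periodic L (ofLex x k) (ofLex y k))
        (fun _ _ => Nat.zero_le _) (Finset.mem_univ k)
    have h2 : (coordDist periodic L (ofLex x k) (ofLex y k) : ℝ) ≤ manhattan periodic x y := by
      exact_mod_cast this
    linarith
  calc _ ≤ ∏ _k : Fin D, (1 + manhattan periodic x y : ℝ) ^ 2 :=
        Finset.prod_le_prod (fun _ _ => by positivity) fun k _ =>
          pow_le_pow_left₀ (by positivity) (h k) 2
    _ = _ := by rw [Finset.prod_const, Finset.card_univ, Fintype.card_fin, ← pow_mul]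

/-- With exponent `2D` the weight is dominated by a product of inverse squares over the coordinates,
so the sum factorizes. -/
lemma sum_latticeWeight_le (x : LatticeSite D L) :
    ∑ y, latticeWeight periodic x y ≤ (4 * invSqSum) ^ D := by
  calc _ ≤ ∑ y : LatticeSite D L, ∏ k, ((1 + coordDist periodic L (ofLex x k) (ofLex y k) : ℝ) ^ 2)⁻¹ := by
        refine Finset.sum_le_sum fun y _ => ?_
        rw [latticeWeight, Finset.prod_inv_distrib]
        have := prod_one_add_le periodic x y
        have h0 : 0 < ∏ k, (1 + coordDist periodic L (ofLex x k) (ofLex y k) : ℝ) ^ 2 :=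
          Finset.prod_pos fun k _ => by positivity
        gcongr
    _ = ∑ y : Fin D → Fin (L + 1), ∏ k, ((1 + coordDist periodic L (ofLex x k) (y k) : ℝ) ^ 2)⁻¹ :=
        Fintype.sum_equiv ofLex _ _ fun y => rfl
    _ = ∏ k, ∑ b, ((1 + coordDist periodic L (ofLex x k) b : ℝ) ^ 2)⁻¹ := by
        rw [Finset.prod_univ_sum, Fintype.piFinset_univ]
    _ ≤ ∏ _k : Fin D, (4 * invSqSum) :=
        Finset.prod_le_prod (fun _ _ => Finset.sum_nonneg fun _ _ => by positivity)
          fun k _ => sum_inv_sq_coordDist_le periodic _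
    _ = _ := by rw [Finset.prod_const, Finset.card_univ, Fintype.card_fin]

lemma isWeight_latticeWeight :
    IsWeight (manhattan periodic (D := D) (L := L)) (latticeWeight periodic) ((4 * invSqSum) ^ D) where
  nonneg x y := by rw [latticeWeight]; positivity
  le_one x y := by
    rw [latticeWeight]
    refine inv_le_one_of_one_le₀ (one_le_pow₀ ?_)
    have : (0 : ℝ) ≤ manhattan periodic x y := Nat.cast_nonneg _
    linarith
  anti x y z hyz := by
    rw [latticeWeight, latticeWeight]
    have : (manhattan periodic x y : ℝ) ≤ manhattan periodic x z := by exact_mod_cast hyz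
    gcongr
  symm x y := by rw [latticeWeight, latticeWeight, manhattan_comm]
  sum_le x := sum_latticeWeight_le periodic x

lemma card_latticeSite : Fintype.card (LatticeSite D L) = (L + 1) ^ D := by
  rw [show Fintype.card (LatticeSite D L) = Fintype.card (Fin D → Fin (L + 1)) from
    Fintype.card_congr ofLex]
  simp

/-- All sites of `S` have weight at least `(1 + r)^{-2D}` relative to a fixed one of them, and the
weights are summable. -/
lemma card_le_of_diam (S : Finset (LatticeSite D L)) {r : ℕ}
    (hS : ∀ x ∈ S, ∀ y ∈ S, manhattan periodic x y ≤ r) :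
    (S.card : ℝ) ≤ (4 * invSqSum) ^ D * (1 + r) ^ (2 * D) := by
  rcases S.eq_empty_or_nonempty with rfl | ⟨x, hx⟩
  · have := invSqSum_nonneg
    simp; positivity
  · rw [← div_le_iff₀ (by positivity)]
    refine le_trans ?_ (sum_latticeWeight_le periodic x)
    calc (S.card : ℝ) / (1 + r) ^ (2 * D) = ∑ _y ∈ S, ((1 + r : ℝ) ^ (2 * D))⁻¹ := by
          rw [Finset.sum_const, nsmul_eq_mul, div_eq_mul_inv]
      _ ≤ ∑ y ∈ S, latticeWeight periodic x y := by
          refine Finset.sum_le_sum fun y hy => ?_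
          rw [latticeWeight]
          have : (manhattan periodic x y : ℝ) ≤ r := by exact_mod_cast hS x hx y hy
          gcongr
      _ ≤ _ := Finset.sum_le_univ_sum_of_nonneg fun y => by rw [latticeWeight]; positivity

end Lattice

/-! ### Unitary Heisenberg evolution -/

section HeisenbergPicture

variable {n : Type*} [Fintype n] [DecidableEq n]

/-- The Heisenberg evolution `e^{iHt} A e^{-iHt}`. -/
def heisTime (H : Matrix n n ℂ) (t : ℝ) (A : Matrix n n ℂ) : Matrix n n ℂ :=
  NormedSpace.exp ((Complex.I * (t : ℂ)) • H) * A * NormedSpace.exp ((-(Complex.I * (t : ℂ))) • H)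

lemma exp_smul_mul_exp_neg (H : Matrix n n ℂ) (z : ℂ) :
    NormedSpace.exp (z • H) * NormedSpace.exp ((-z) • H) = 1 := by
  rw [← Matrix.exp_add_of_commute _ _ ((Commute.refl H).smul_left _ |>.smul_right _), ← add_smul,
    add_neg_cancel, zero_smul, NormedSpace.exp_zero]

lemma exp_neg_mul_exp_smul (H : Matrix n n ℂ) (z : ℂ) :
    NormedSpace.exp ((-z) • H) * NormedSpace.exp (z • H) = 1 := by
  simpa using exp_smul_mul_exp_neg H (-z)

lemma star_exp_smul {H : Matrix n n ℂ} (hH : H.IsHermitian) (t : ℝ) :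
    star (NormedSpace.exp ((Complex.I * (t : ℂ)) • H)) =
      NormedSpace.exp ((-(Complex.I * (t : ℂ))) • H) := by
  rw [Matrix.star_eq_conjTranspose, ← Matrix.exp_conjTranspose, Matrix.conjTranspose_smul, hH.eq]
  congr 2
  simp

lemma heisTime_zero (H A : Matrix n n ℂ) : heisTime H 0 A = A := by
  simp [heisTime]

lemma heisTime_mul (H : Matrix n n ℂ) (t : ℝ) (A B : Matrix n n ℂ) :
    heisTime H t (A * B) = heisTime H t A * heisTime H t B := by
  have h := exp_neg_mul_exp_smul H (Complex.I * (t : ℂ))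
  rw [heisTime, heisTime, heisTime]
  calc _ = NormedSpace.exp ((Complex.I * (t : ℂ)) • H) * A * 1 * B *
        NormedSpace.exp ((-(Complex.I * (t : ℂ))) • H) := by noncomm_ring
    _ = _ := by rw [← h]; noncomm_ring

lemma heisTime_add (H : Matrix n n ℂ) (t : ℝ) (A B : Matrix n n ℂ) :
    heisTime H t (A + B) = heisTime H t A + heisTime H t B := by
  rw [heisTime, heisTime, heisTime, mul_add, add_mul]

lemma heisTime_smul (H : Matrix n n ℂ) (t : ℝ) (z : ℂ) (A : Matrix n n ℂ) :
    heisTime H t (z • A) = z • heisTime H t A := by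
  rw [heisTime, heisTime, mul_smul_comm, smul_mul_assoc]

lemma heisTime_sum {ι : Type*} (s : Finset ι) (H : Matrix n n ℂ) (t : ℝ) (A : ι → Matrix n n ℂ) :
    heisTime H t (∑ i ∈ s, A i) = ∑ i ∈ s, heisTime H t (A i) := by
  simp only [heisTime, Finset.mul_sum, Finset.sum_mul]

lemma heisTime_neg_heisTime (H : Matrix n n ℂ) (t : ℝ) (A : Matrix n n ℂ) :
    heisTime H (-t) (heisTime H t A) = A := by
  have h := exp_neg_mul_exp_smul H (Complex.I * (t : ℂ))
  have h1 : NormedSpace.exp ((Complex.I * ((-t : ℝ) : ℂ)) • H) =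
      NormedSpace.exp ((-(Complex.I * (t : ℂ))) • H) := by push_cast; rw [mul_neg]
  have h2 : NormedSpace.exp ((-(Complex.I * ((-t : ℝ) : ℂ))) • H) =
      NormedSpace.exp ((Complex.I * (t : ℂ)) • H) := by push_cast; rw [mul_neg, neg_neg]
  rw [heisTime, heisTime, h1, h2]
  calc _ = (NormedSpace.exp ((-(Complex.I * (t : ℂ))) • H) *
        NormedSpace.exp ((Complex.I * (t : ℂ)) • H)) * A *
        (NormedSpace.exp ((-(Complex.I * (t : ℂ))) • H) *
        NormedSpace.exp ((Complex.I * (t : ℂ)) • H)) := by noncomm_ring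
    _ = A := by rw [h, one_mul, mul_one]

lemma heisTime_heisTime_neg (H : Matrix n n ℂ) (t : ℝ) (A : Matrix n n ℂ) :
    heisTime H t (heisTime H (-t) A) = A := by
  simpa using heisTime_neg_heisTime H (-t) A

lemma heisTime_heisTime (H : Matrix n n ℂ) (s t : ℝ) (A : Matrix n n ℂ) :
    heisTime H s (heisTime H t A) = heisTime H (s + t) A := by
  have hc : ∀ z w : ℂ, Commute (z • H) (w • H) := fun z w =>
    ((Commute.refl H).smul_left _ |>.smul_right _)
  have h1 : NormedSpace.exp ((Complex.I * ((s + t : ℝ) : ℂ)) • H) =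
      NormedSpace.exp ((Complex.I * (s : ℂ)) • H) * NormedSpace.exp ((Complex.I * (t : ℂ)) • H) := by
    rw [← Matrix.exp_add_of_commute _ _ (hc _ _), ← add_smul]
    push_cast; rw [mul_add]
  have h2 : NormedSpace.exp ((-(Complex.I * ((s + t : ℝ) : ℂ))) • H) =
      NormedSpace.exp ((-(Complex.I * (t : ℂ))) • H) *
        NormedSpace.exp ((-(Complex.I * (s : ℂ))) • H) := by
    rw [← Matrix.exp_add_of_commute _ _ (hc _ _), ← add_smul]
    congr 2; push_cast; ring
  rw [heisTime, heisTime, heisTime, h1, h2]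
  noncomm_ring

lemma star_heisTime {H : Matrix n n ℂ} (hH : H.IsHermitian) (t : ℝ) (A : Matrix n n ℂ) :
    star (heisTime H t A) = heisTime H t (star A) := by
  have h1 := star_exp_smul hH t
  have h2 : star (NormedSpace.exp ((-(Complex.I * (t : ℂ))) • H)) =
      NormedSpace.exp ((Complex.I * (t : ℂ)) • H) := by rw [← h1, star_star]
  rw [heisTime, heisTime, star_mul, star_mul, h1, h2, mul_assoc]

lemma norm_heisTime_le {H : Matrix n n ℂ} (hH : H.IsHermitian) (t : ℝ) (A : Matrix n n ℂ) :
    ‖heisTime H t A‖ ≤ ‖A‖ := by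
  have h1 := star_exp_smul hH t
  have h2 : star (NormedSpace.exp ((-(Complex.I * (t : ℂ))) • H)) =
      NormedSpace.exp ((Complex.I * (t : ℂ)) • H) := by rw [← h1, star_star]
  rw [heisTime, ← h2]
  refine norm_unitary_conj_le ?_ A
  rw [h2, exp_smul_mul_exp_neg]

lemma hasDerivAt_heisTime (H A : Matrix n n ℂ) (t : ℝ) :
    HasDerivAt (fun t => heisTime H t A) (heisTime H t (Complex.I • (H * A - A * H))) t := by
  have h1 : HasDerivAt (fun t : ℝ => NormedSpace.exp ((Complex.I * (t : ℂ)) • H))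
      (NormedSpace.exp ((Complex.I * (t : ℂ)) • H) * (Complex.I • H)) t := by
    have := (hasDerivAt_exp_smul_const (𝕂 := ℂ) (Complex.I • H) (t : ℂ)).scomp t
      Complex.ofRealCLM.hasDerivAt
    simp only [Complex.ofRealCLM_apply, Complex.ofReal_one, one_smul] at this
    have e : (fun t : ℝ => NormedSpace.exp ((Complex.I * (t : ℂ)) • H)) =
        (fun u : ℂ => NormedSpace.exp (u • Complex.I • H)) ∘ (fun t : ℝ => (t : ℂ)) := by
      funext t; simp [smul_smul, mul_comm]
    rw [e]
    refine HasDerivAt.congr_deriv this ?_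
    rw [smul_smul, mul_comm]
  have h2 : HasDerivAt (fun t : ℝ => NormedSpace.exp ((-(Complex.I * (t : ℂ))) • H))
      ((-Complex.I • H) * NormedSpace.exp ((-(Complex.I * (t : ℂ))) • H)) t := by
    have := (hasDerivAt_exp_smul_const' (𝕂 := ℂ) (-Complex.I • H) (t : ℂ)).scomp t
      Complex.ofRealCLM.hasDerivAt
    simp only [Complex.ofRealCLM_apply, Complex.ofReal_one, one_smul] at this
    have e : (fun t : ℝ => NormedSpace.exp ((-(Complex.I * (t : ℂ))) • H)) =
        (fun u : ℂ => NormedSpace.exp (u • -Complex.I • H)) ∘ (fun t : ℝ => (t : ℂ)) := by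
      funext t; simp [smul_smul, mul_comm]
    rw [e]
    refine HasDerivAt.congr_deriv this ?_
    rw [smul_smul, mul_neg, mul_comm]
  refine HasDerivAt.congr_deriv (f := fun t => heisTime H t A)
    ((h1.fun_mul (hasDerivAt_const t A)).fun_mul h2) ?_
  rw [heisTime]
  simp only [mul_sub, sub_mul, mul_smul_comm, smul_mul_assoc, neg_smul, mul_neg, neg_mul, smul_sub,
    mul_zero, add_zero, mul_assoc]
  module

lemma continuous_heisTime (H A : Matrix n n ℂ) : Continuous fun t => heisTime H t A :=
  continuous_iff_continuousAt.mpr fun t => (hasDerivAt_heisTime H A t).continuousAt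

lemma heisTime_acomm (H : Matrix n n ℂ) (t : ℝ) (A B : Matrix n n ℂ) :
    A * heisTime H t B + heisTime H t B * A =
      heisTime H t (heisTime H (-t) A * B + B * heisTime H (-t) A) := by
  rw [heisTime_add, heisTime_mul, heisTime_mul, heisTime_heisTime_neg]

end HeisenbergPicture

/-! ### Even local operators and their anticommutators -/

section Locality

variable {V : Type} [LinearOrder V] [Fintype V]

lemma mul_prod_ladder {S : Finset V} {B : FockOp V}
    (hB : ∀ a : V × Bool, a.1 ∈ S → B * ladder a = -(ladder a * B)) (w : List (V × Bool))
    (hw : ∀ a ∈ w, a.1 ∈ S) :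
    B * (w.map ladder).prod = (-1 : ℂ) ^ w.length • ((w.map ladder).prod * B) := by
  induction w with
  | nil => simp
  | cons a w ih =>
    have h1 := hB a (hw a (by simp))
    have h2 := ih fun b hb => hw b (by simp [hb])
    rw [List.map_cons, List.prod_cons, List.length_cons, ← mul_assoc, h1, neg_mul, mul_assoc, h2,
      mul_smul_comm, pow_succ, mul_assoc]
    module

lemma commute_of_mem_evenLocal {S : Finset V} {B : FockOp V}
    (hB : ∀ a : V × Bool, a.1 ∈ S → B * ladder a = -(ladder a * B)) {X : FockOp V}
    (hX : X ∈ evenLocal S) : B * X = X * B := by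
  induction hX using Submodule.span_induction with
  | mem x hx =>
    obtain ⟨w, hw1, hw2, rfl⟩ := hx
    rw [mul_prod_ladder hB w hw2, hw1.neg_one_pow, one_smul]
  | zero => simp
  | add x y _ _ hx hy => rw [mul_add, add_mul, hx, hy]
  | smul z x _ hx => rw [mul_smul_comm, smul_mul_assoc, hx]

lemma parity_mul_of_mem_evenLocal {S : Finset V} {X : FockOp V} (hX : X ∈ evenLocal S) :
    parity * X = X * parity :=
  commute_of_mem_evenLocal (fun a _ => parity_mul_ladder a) hX

lemma ladder_mul_of_mem_evenLocal {S : Finset V} {X : FockOp V} (hX : X ∈ evenLocal S)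
    {a : V × Bool} (ha : a.1 ∉ S) : ladder a * X = X * ladder a := by
  refine commute_of_mem_evenLocal (fun b hb => ?_) hX
  have h := ladder_anticomm a b
  rw [if_neg] at h
  · exact eq_neg_of_add_eq_zero_left h
  · rintro rfl
    exact ha hb

/-- The anticommutator of `B` with a local odd operator is controlled by the anticommutators of `B`
with the ladder operators of the support. -/
lemma norm_acomm_commutator_le {S : Finset V} {h : FockOp V} (hh : h ∈ evenLocal S) (hn : ‖h‖ ≤ 1)
    {a : V × Bool} (ha : a.1 ∈ S) (B : FockOp V) :
    ‖B * (h * ladder a - ladder a * h) + (h * ladder a - ladder a * h) * B‖ ≤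
      4 * ∑ i ∈ S, ∑ b : Bool, ‖B * ladder (i, b) + ladder (i, b) * B‖ := by
  -- The twirled `B'` anticommutes with all ladder operators on `S`, hence with the odd operator
  -- `[h, ladder a]`; only `B - B'` contributes.
  obtain ⟨B', h1, -, h3⟩ := exists_twirl (σ := -1) (Or.inr rfl) (S ×ˢ Finset.univ) B
  have h1' : ∀ k : V × Bool, k.1 ∈ S → majorana k * B' = -(B' * majorana k) := by
    intro k hk
    have := h1 k (by simp [hk])
    simpa using this
  have h4 : ∀ k : V × Bool, k.1 ∈ S → B' * ladder k = -(ladder k * B') := by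
    intro k hk
    have e1 := h1' (k.1, true) hk
    have e2 := h1' (k.1, false) hk
    rw [ladder_eq_majorana k]
    simp only [mul_add, add_mul, mul_smul_comm, smul_mul_assoc, e1, e2]
    module
  have h5 := commute_of_mem_evenLocal h4 hh
  have h6 := h4 a ha
  set X := h * ladder a - ladder a * h with hX
  have h7 : B' * X + X * B' = 0 := by
    rw [hX]
    have e1 : B' * (h * ladder a) = -(h * ladder a * B') := by
      rw [← mul_assoc, h5, mul_assoc, h6]; noncomm_ring
    have e2 : B' * (ladder a * h) = -(ladder a * h * B') := by
      rw [← mul_assoc, h6, neg_mul, mul_assoc, h5]; noncomm_ring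
    rw [mul_sub, sub_mul, e1, e2]
    abel
  have h8 : B * X + X * B = (B - B') * X + X * (B - B') := by
    calc B * X + X * B = (B - B') * X + X * (B - B') + (B' * X + X * B') := by noncomm_ring
      _ = _ := by rw [h7, add_zero]
  have hla := norm_ladder_le a
  have h9 : ‖X‖ ≤ 2 := by
    have e1 : ‖h * ladder a‖ ≤ 1 := (norm_mul_le _ _).trans (by
      nlinarith [norm_nonneg h, norm_nonneg (ladder a)])
    have e2 : ‖ladder a * h‖ ≤ 1 := (norm_mul_le _ _).trans (by
      nlinarith [norm_nonneg h, norm_nonneg (ladder a)])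
    refine (norm_sub_le _ _).trans ?_
    linarith
  have h10 : ‖B * X + X * B‖ ≤ 4 * ‖B - B'‖ := by
    rw [h8]
    have e1 := norm_mul_le (B - B') X
    have e2 := norm_mul_le X (B - B')
    have e3 := norm_nonneg (B - B')
    refine (norm_add_le _ _).trans ?_
    nlinarith
  refine h10.trans ?_
  have h11 : ∑ k ∈ S ×ˢ (Finset.univ : Finset Bool), ‖defect (-1) k B‖ ≤
      2 * ∑ i ∈ S, ∑ b : Bool, ‖B * ladder (i, b) + ladder (i, b) * B‖ := by
    rw [Finset.sum_product, Finset.mul_sum]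
    refine Finset.sum_le_sum fun i _ => ?_
    have e1 : ∀ b : Bool, ‖defect (-1) (i, b) B‖ ≤
        ∑ b : Bool, ‖B * ladder (i, b) + ladder (i, b) * B‖ := by
      intro b
      refine (norm_defect_le (-1) (i, b) B).trans (le_of_eq ?_)
      rw [Fintype.sum_bool]
      simp [add_comm]
    rw [Fintype.sum_bool]
    linarith [e1 true, e1 false]
  linarith

end Locality

lemma sum_le_of_ncard_le {ι : Type*} [Fintype ι] (P : ι → Prop) (f : ι → ℝ) {G : ℝ} {l : ℕ} (hG : 0 ≤ G)
    (h0 : ∀ i, ¬ P i → f i = 0) (h1 : ∀ i, P i → f i ≤ G) (hl : {i | P i}.ncard ≤ l) :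
    ∑ i, f i ≤ l * G := by
  classical
  have h2 : ∑ i, f i = ∑ i ∈ Finset.univ.filter P, f i := by
    rw [Finset.sum_filter]
    refine Finset.sum_congr rfl fun i _ => ?_
    split_ifs with h
    · rfl
    · exact h0 i h
  rw [h2]
  calc _ ≤ ∑ _i ∈ Finset.univ.filter P, G := Finset.sum_le_sum fun i hi => h1 i (by simpa using hi)
    _ = (Finset.univ.filter P).card * G := by rw [Finset.sum_const, nsmul_eq_mul]
    _ ≤ l * G := by
      have h3 : (Finset.univ.filter P).card ≤ l := by
        rw [← Set.ncard_coe_finset]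
        simpa using hl
      have h4 : ((Finset.univ.filter P).card : ℝ) ≤ l := by exact_mod_cast h3
      gcongr

/-- A (pseudo-)distance with values in `ℕ`. -/
structure IsDist {V : Type} (d : V → V → ℕ) : Prop where
  self : ∀ x, d x x = 0
  symm : ∀ x y, d x y = d y x
  triangle : ∀ x y z, d x z ≤ d x y + d y z

/-! ### Local fermionic models and the Lieb-Robinson bound -/

section Model

variable {V : Type} [LinearOrder V] [Fintype V]

/-- A local fermionic model: nearest neighbour hopping and local even interaction terms. -/
structure IsLocalModel (d : V → V → ℕ) {n : ℕ} (M : Matrix V V ℂ) (h : Fin n → FockOp V)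
    (S : Fin n → Finset V) (l r : ℕ) (m s : ℝ) : Prop where
  isDist : IsDist d
  hermitian : M.IsHermitian
  entry_le : ∀ i j, ‖M i j‖ ≤ m
  range : ∀ i j, M i j ≠ 0 → d i j ≤ 1
  degree : ∀ i, {j | M i j ≠ 0}.ncard ≤ l
  sum_hermitian : (∑ j, h j).IsHermitian
  norm_le : ∀ j, ‖h j‖ ≤ 1
  mem : ∀ j, h j ∈ evenLocal (S j)
  diam : ∀ j, ∀ x ∈ S j, ∀ y ∈ S j, d x y ≤ r
  card_le : ∀ j, ((S j).card : ℝ) ≤ s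
  overlap : ∀ k, {j | k ∈ S j}.ncard ≤ l

/-- The coefficients of `[∑ M_{ij} c_i† c_j, ladder a]`. -/
def hopCoeff (M : Matrix V V ℂ) (a : V × Bool) (j : V) : ℂ := if a.2 then M j a.1 else -M a.1 j

lemma commutator_quadratic (M : Matrix V V ℂ) (a : V × Bool) :
    quadraticHamiltonian M * ladder a - ladder a * quadraticHamiltonian M =
      ∑ j, hopCoeff M a j • ladder (j, a.2) := by
  have key : ∀ p q : V, creation p * annihilation q * ladder a - ladder a * (creation p * annihilation q) =
      (if (q, false) = flip a then creation p else 0) -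
        (if (p, true) = flip a then annihilation q else 0) := by
    intro p q
    have e1 := ladder_anticomm (q, false) a
    have e2 := ladder_anticomm (p, true) a
    have hq : ladder (q, false) = annihilation q := by simp [ladder]
    have hp : ladder (p, true) = creation p := by simp [ladder]
    rw [hq] at e1
    rw [hp] at e2
    calc _ = creation p * (annihilation q * ladder a + ladder a * annihilation q) -
        (creation p * ladder a + ladder a * creation p) * annihilation q := by noncomm_ring
      _ = _ := by
        rw [e1, e2]
        split_ifs <;> simp
  rw [quadraticHamiltonian, Finset.sum_mul, Finset.mul_sum, ← Finset.sum_sub_distrib]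
  have h1 : ∀ p, (∑ q, M p q • (creation p * annihilation q)) * ladder a -
      ladder a * ∑ q, M p q • (creation p * annihilation q) =
      ∑ q, M p q • ((if (q, false) = flip a then creation p else 0) -
        (if (p, true) = flip a then annihilation q else 0)) := by
    intro p
    rw [Finset.sum_mul, Finset.mul_sum, ← Finset.sum_sub_distrib]
    refine Finset.sum_congr rfl fun q _ => ?_
    rw [← key, smul_sub, smul_mul_assoc, mul_smul_comm]
  rw [Finset.sum_congr rfl fun p _ => h1 p]
  rcases a with ⟨i, b⟩
  cases b
  · simp only [flip, Prod.mk.injEq, Bool.not_false, Bool.false_eq_true, and_false, if_false, and_true,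
      zero_sub, hopCoeff, ladder, Bool.false_eq_true]
    rw [Finset.sum_comm]
    refine Finset.sum_congr rfl fun q _ => ?_
    rw [Finset.sum_eq_single i]
    · simp
    · intro p _ hp; simp [hp]
    · simp
  · simp only [flip, Prod.mk.injEq, Bool.not_true, Bool.true_eq_false, and_false, if_false, and_true,
      sub_zero, hopCoeff, ladder, if_true]
    refine Finset.sum_congr rfl fun p _ => ?_
    rw [Finset.sum_eq_single i]
    · simp
    · intro p _ hp; simp [hp]
    · simp

lemma commutator_hamiltonian {n : ℕ} (M : Matrix V V ℂ) (h : Fin n → FockOp V) (ε : ℝ) (a : V × Bool) :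
    hamiltonian M h ε * ladder a - ladder a * hamiltonian M h ε =
      ∑ j, hopCoeff M a j • ladder (j, a.2) + (ε : ℂ) • ∑ j, (h j * ladder a - ladder a * h j) := by
  rw [← commutator_quadratic, hamiltonian, add_mul, mul_add, smul_mul_assoc, mul_smul_comm,
    Finset.sum_mul, Finset.mul_sum, Finset.sum_sub_distrib]
  module

lemma quadraticHamiltonian_isHermitian {M : Matrix V V ℂ} (hM : M.IsHermitian) :
    (quadraticHamiltonian M).IsHermitian := by
  rw [Matrix.IsHermitian, quadraticHamiltonian, Matrix.conjTranspose_sum]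
  simp only [Matrix.conjTranspose_sum, Matrix.conjTranspose_smul, Matrix.conjTranspose_mul, creation,
    Matrix.conjTranspose_conjTranspose]
  rw [Finset.sum_comm]
  refine Finset.sum_congr rfl fun i _ => Finset.sum_congr rfl fun j _ => ?_
  rw [hM.apply]

variable {d : V → V → ℕ} {n : ℕ} {M : Matrix V V ℂ} {h : Fin n → FockOp V} {S : Fin n → Finset V}
  {l r : ℕ} {m s : ℝ} {ε : ℝ}

lemma IsLocalModel.hamiltonian_isHermitian (hm : IsLocalModel d M h S l r m s) (ε : ℝ) :
    (hamiltonian M h ε).IsHermitian := by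
  refine (quadraticHamiltonian_isHermitian hm.hermitian).add ?_
  rw [Matrix.IsHermitian, Matrix.conjTranspose_smul, hm.sum_hermitian.eq]
  simp

lemma IsLocalModel.sum_hopCoeff_le (hm : IsLocalModel d M h S l r m s) (hm0 : 0 ≤ m) (a : V × Bool)
    (g : V → ℝ) {G : ℝ} (hG : 0 ≤ G) (hg : ∀ j, d a.1 j ≤ 1 → g j ≤ G) (hg0 : ∀ j, 0 ≤ g j) :
    ∑ j, ‖hopCoeff M a j‖ * g j ≤ l * (m * G) := by
  have h1 : ∀ j, ‖hopCoeff M a j‖ = ‖M a.1 j‖ := by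
    intro j
    rw [hopCoeff]
    split_ifs
    · rw [← hm.hermitian.apply, norm_star]
    · rw [norm_neg]
  refine sum_le_of_ncard_le (fun j => M a.1 j ≠ 0) _ (by positivity) ?_ ?_ (hm.degree a.1)
  · intro j hj
    rw [h1]
    push Not at hj
    rw [hj, norm_zero, zero_mul]
  · intro j hj
    rw [h1]
    exact mul_le_mul (hm.entry_le _ _) (hg j (hm.range _ _ hj)) (hg0 j) hm0

lemma IsLocalModel.sum_perturbation_le (hm : IsLocalModel d M h S l r m s) (a : V × Bool)
    (g : FockOp V → ℝ) (hg : g 0 = 0) {G : ℝ} (hG : 0 ≤ G)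
    (h1 : ∀ j, a.1 ∈ S j → g (h j * ladder a - ladder a * h j) ≤ G) :
    ∑ j, g (h j * ladder a - ladder a * h j) ≤ l * G := by
  refine sum_le_of_ncard_le (fun j => a.1 ∈ S j) _ hG ?_ h1 (hm.overlap a.1)
  intro j hj
  rw [ladder_mul_of_mem_evenLocal (hm.mem j) hj, sub_self, hg]

/-- The Lieb-Robinson velocity. -/
def velocity (l r : ℕ) (m s : ℝ) : ℝ := l * (m * Real.exp 1) + l * (8 * s * Real.exp r)

/-- A Lieb-Robinson bound. -/
lemma IsLocalModel.norm_acomm_heisTime_le (hm : IsLocalModel d M h S l r m s) (hm0 : 0 ≤ m)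
    (hs : 0 ≤ s) (hε : |ε| ≤ 1) (a b : V × Bool) (t : ℝ) :
    ‖acomm b (heisTime (hamiltonian M h ε) t (ladder a))‖ ≤
      Real.exp (velocity l r m s * |t| - d b.1 a.1) := by
  set H := hamiltonian M h ε with hH
  have hHh : H.IsHermitian := hm.hamiltonian_isHermitian ε
  -- Negative times are reached by a Gronwall argument in `|t|` along the direction `sg`.
  obtain ⟨sg, hsg, hsgt⟩ : ∃ sg : ℝ, |sg| = 1 ∧ sg * |t| = t := by
    rcases le_total 0 t with h0 | h0
    · exact ⟨1, by simp, by rw [abs_of_nonneg h0]; ring⟩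
    · exact ⟨-1, by simp, by rw [abs_of_nonpos h0]; ring⟩
  set B : FockOp V := ladder b
  -- The weight converts exponential decay in the distance into a plain supremum bound. Terms of
  -- range `q` cost at most a factor `e^q`: `e` for the hopping and `e^r` for the interaction, as in
  -- `velocity`.
  let ω : V → ℝ := fun i => Real.exp (d b.1 i)
  have hω0 : ∀ i, 0 < ω i := fun i => Real.exp_pos _
  have hω : ∀ i j, ω i ≤ Real.exp (d i j) * ω j := by
    intro i j
    simp only [ω, ← Real.exp_add]
    have := hm.isDist.triangle b.1 j i
    rw [hm.isDist.symm j i] at this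
    have h2 : (d b.1 i : ℝ) ≤ d b.1 j + d i j := by exact_mod_cast this
    exact Real.exp_le_exp.mpr (by linarith)
  let x : ℝ → V × Bool → FockOp V := fun u a =>
    B * heisTime H (sg * u) (ladder a) + heisTime H (sg * u) (ladder a) * B
  let x' : ℝ → V × Bool → FockOp V := fun u a =>
    sg • (B * heisTime H (sg * u) (Complex.I • (H * ladder a - ladder a * H)) +
      heisTime H (sg * u) (Complex.I • (H * ladder a - ladder a * H)) * B)
  let y : ℝ → V × Bool → FockOp V := fun u a => ω a.1 • x u a
  let y' : ℝ → V × Bool → FockOp V := fun u a => ω a.1 • x' u a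
  have hder : ∀ u, HasDerivAt y (y' u) u := by
    intro u
    refine hasDerivAt_pi.mpr fun a => HasDerivAt.fun_const_smul (ω a.1) ?_
    have e1 : HasDerivAt (fun u => heisTime H (sg * u) (ladder a))
        (sg • heisTime H (sg * u) (Complex.I • (H * ladder a - ladder a * H))) u := by
      have := (hasDerivAt_heisTime H (ladder a) (sg * u)).scomp u ((hasDerivAt_id u).const_mul sg)
      exact HasDerivAt.congr_deriv (f := fun u => heisTime H (sg * u) (ladder a)) this (by simp)
    refine HasDerivAt.congr_deriv (f := fun u => B * heisTime H (sg * u) (ladder a) +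
      heisTime H (sg * u) (ladder a) * B) (((hasDerivAt_const u B).fun_mul e1).fun_add
        (e1.fun_mul (hasDerivAt_const u B))) ?_
    simp only [x', zero_mul, mul_zero, zero_add, add_zero, mul_smul_comm, smul_mul_assoc, smul_add]
  have hyx : ∀ u a, ω a.1 * ‖x u a‖ ≤ ‖y u‖ := by
    intro u a
    have := norm_le_pi_norm (y u) a
    simpa [y, norm_smul, abs_of_pos (hω0 a.1)] using this
  have hwx : ∀ u (a k : V × Bool) (q : ℕ), d a.1 k.1 ≤ q → ω a.1 * ‖x u k‖ ≤ Real.exp q * ‖y u‖ := by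
    intro u a k q hq
    have e1 : Real.exp (d a.1 k.1) ≤ Real.exp q := Real.exp_le_exp.mpr (by exact_mod_cast hq)
    calc _ ≤ (Real.exp (d a.1 k.1) * ω k.1) * ‖x u k‖ := by gcongr; exact hω _ _
      _ = Real.exp (d a.1 k.1) * (ω k.1 * ‖x u k‖) := by ring
      _ ≤ _ := by
        have := hyx u k
        have := hω0 k.1
        gcongr
  have hbound : ∀ u, ‖y' u‖ ≤ velocity l r m s * ‖y u‖ := by
    intro u
    have hv0 : 0 ≤ velocity l r m s := by rw [velocity]; positivity
    refine (pi_norm_le_iff_of_nonneg (by positivity)).mpr fun a => ?_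
    have e1 : x' u a = (sg • Complex.I) • (∑ j, hopCoeff M a j • x u (j, a.2) +
        (ε : ℂ) • ∑ j, (B * heisTime H (sg * u) (h j * ladder a - ladder a * h j) +
          heisTime H (sg * u) (h j * ladder a - ladder a * h j) * B)) := by
      simp only [x', x]
      rw [hH, commutator_hamiltonian, ← hH]
      simp only [heisTime_smul, heisTime_add, heisTime_sum, mul_add, add_mul, smul_add, Finset.mul_sum,
        Finset.sum_mul, mul_smul_comm, smul_mul_assoc, Finset.smul_sum, Finset.sum_add_distrib,
        smul_assoc]
      abel
    have e2 : ‖x' u a‖ ≤ ∑ j, ‖hopCoeff M a j‖ * ‖x u (j, a.2)‖ +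
        ∑ j, ‖B * heisTime H (sg * u) (h j * ladder a - ladder a * h j) +
          heisTime H (sg * u) (h j * ladder a - ladder a * h j) * B‖ := by
      rw [e1, norm_smul]
      have e3 : ‖sg • Complex.I‖ = 1 := by simp [hsg]
      rw [e3, one_mul]
      refine (norm_add_le _ _).trans (add_le_add ?_ ?_)
      · exact (norm_sum_le _ _).trans (Finset.sum_le_sum fun j _ => by rw [norm_smul])
      · rw [norm_smul, Complex.norm_real, Real.norm_eq_abs]
        have e4 := norm_sum_le Finset.univ (fun j =>
          B * heisTime H (sg * u) (h j * ladder a - ladder a * h j) +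
          heisTime H (sg * u) (h j * ladder a - ladder a * h j) * B)
        exact (mul_le_of_le_one_left (norm_nonneg _) hε).trans e4
    have e5 : ω a.1 * ∑ j, ‖hopCoeff M a j‖ * ‖x u (j, a.2)‖ ≤ l * (m * (Real.exp 1 * ‖y u‖)) := by
      rw [Finset.mul_sum]
      calc _ = ∑ j, ‖hopCoeff M a j‖ * (ω a.1 * ‖x u (j, a.2)‖) :=
            Finset.sum_congr rfl fun j _ => by ring
        _ ≤ _ := by
          refine hm.sum_hopCoeff_le hm0 a _ (by positivity) (fun j hj => ?_)
            (fun j => by have := hω0 a.1; positivity)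
          have := hwx u a (j, a.2) 1 hj
          simpa using this
    have e6 : ω a.1 * ∑ j, ‖B * heisTime H (sg * u) (h j * ladder a - ladder a * h j) +
          heisTime H (sg * u) (h j * ladder a - ladder a * h j) * B‖ ≤
          l * (8 * s * Real.exp r * ‖y u‖) := by
      rw [Finset.mul_sum]
      refine hm.sum_perturbation_le a (fun X => ω a.1 * ‖B * heisTime H (sg * u) X +
          heisTime H (sg * u) X * B‖) (by simp [heisTime]) (by positivity) fun j hj => ?_
      -- The evolution is moved onto `B`, so that the other factor is the unevolved, strictly local
      -- commutator. Its ladder anticommutators are the quantities `x u k` again, which closes the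
      -- system.
      rw [heisTime_acomm]
      set B' := heisTime H (-(sg * u)) B with hB'
      have f1 := norm_acomm_commutator_le (hm.mem j) (hm.norm_le j) hj B'
      have f2 : ∀ k : V × Bool, ‖B' * ladder k + ladder k * B'‖ ≤ ‖x u k‖ := by
        intro k
        have : B' * ladder k + ladder k * B' = heisTime H (-(sg * u)) (x u k) := by
          simp only [x]
          rw [heisTime_add, heisTime_mul, heisTime_mul, heisTime_neg_heisTime]
        rw [this]
        exact norm_heisTime_le hHh _ _
      have f3 : ω a.1 * ∑ i ∈ S j, ∑ b : Bool, ‖B' * ladder (i, b) + ladder (i, b) * B'‖ ≤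
          2 * s * Real.exp r * ‖y u‖ := by
        rw [Finset.mul_sum]
        calc _ ≤ ∑ _i ∈ S j, 2 * (Real.exp r * ‖y u‖) := by
              refine Finset.sum_le_sum fun i hi => ?_
              have g1 : ∀ b : Bool, ω a.1 * ‖B' * ladder (i, b) + ladder (i, b) * B'‖ ≤
                  Real.exp r * ‖y u‖ := fun b =>
                (mul_le_mul_of_nonneg_left (f2 (i, b)) (hω0 a.1).le).trans
                  (hwx u a (i, b) r (hm.diam j _ hj _ hi))
              rw [Fintype.sum_bool, mul_add]
              linarith [g1 true, g1 false]
          _ = (S j).card * (2 * (Real.exp r * ‖y u‖)) := by rw [Finset.sum_const, nsmul_eq_mul]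
          _ ≤ s * (2 * (Real.exp r * ‖y u‖)) := by gcongr; exact hm.card_le j
          _ = _ := by ring
      calc _ ≤ ω a.1 * (4 * ∑ i ∈ S j, ∑ b : Bool, ‖B' * ladder (i, b) + ladder (i, b) * B'‖) :=
            mul_le_mul_of_nonneg_left ((norm_heisTime_le hHh _ _).trans f1) (hω0 a.1).le
        _ = 4 * (ω a.1 * ∑ i ∈ S j, ∑ b : Bool, ‖B' * ladder (i, b) + ladder (i, b) * B'‖) := by ring
        _ ≤ 4 * (2 * s * Real.exp r * ‖y u‖) := by gcongr
        _ = _ := by ring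
    have e7 : ‖y' u a‖ = ω a.1 * ‖x' u a‖ := by
      simp [y', norm_smul, abs_of_pos (hω0 a.1)]
    rw [e7]
    calc _ ≤ ω a.1 * (∑ j, ‖hopCoeff M a j‖ * ‖x u (j, a.2)‖ +
        ∑ j, ‖B * heisTime H (sg * u) (h j * ladder a - ladder a * h j) +
          heisTime H (sg * u) (h j * ladder a - ladder a * h j) * B‖) :=
          mul_le_mul_of_nonneg_left e2 (hω0 a.1).le
      _ ≤ l * (m * (Real.exp 1 * ‖y u‖)) + l * (8 * s * Real.exp r * ‖y u‖) := by
          rw [mul_add]; exact add_le_add e5 e6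
      _ = _ := by rw [velocity]; ring
  have hstart : ‖y 0‖ ≤ 1 := by
    refine (pi_norm_le_iff_of_nonneg zero_le_one).mpr fun a => ?_
    simp only [y, x, mul_zero, heisTime_zero, norm_smul, Real.norm_eq_abs, abs_of_pos (hω0 a.1)]
    rw [ladder_anticomm]
    split_ifs with hba
    · have : ω a.1 = 1 := by
        simp only [ω, hba, flip]
        rw [hm.isDist.self]; simp
      rw [this, one_mul]
      exact norm_one_le
    · simp
  have hgron := norm_le_gronwallBound_of_norm_deriv_right_le (f := y) (f' := y') (δ := 1)
    (K := velocity l r m s) (ε := 0) (a := 0) (b := |t|)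
    (fun u _ => (hder u).continuousAt.continuousWithinAt)
    (fun u _ => (hder u).hasDerivWithinAt) hstart (fun u _ => by simpa using hbound u) |t|
    ⟨abs_nonneg t, le_rfl⟩
  rw [gronwallBound_ε0, sub_zero, one_mul] at hgron
  have hfin := (hyx |t| a).trans hgron
  have hxx : x |t| a = acomm b (heisTime H t (ladder a)) := by
    simp only [x, hsgt]; rfl
  rw [hxx] at hfin
  rw [Real.exp_sub, le_div_iff₀ (hω0 a.1), mul_comm]
  exact hfin

end Model

/-! ### Comparison with the free evolution -/

section FreeComparison

variable {V : Type} [LinearOrder V] [Fintype V]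

/-- The free evolution `∑_j (e^{-iMt})_{ij} c_j` of `c_i`. -/
def freeMode (M : Matrix V V ℂ) (t : ℝ) (i : V) : FockOp V :=
  ∑ j, NormedSpace.exp ((-(Complex.I * (t : ℂ))) • M) i j • annihilation j

lemma hasDerivAt_freeMode (M : Matrix V V ℂ) (t : ℝ) (i : V) :
    HasDerivAt (fun t => freeMode M t i) (-Complex.I • ∑ j, M i j • freeMode M t j) t := by
  have h2 : HasDerivAt (fun t : ℝ => NormedSpace.exp ((-(Complex.I * (t : ℂ))) • M))
      ((-Complex.I • M) * NormedSpace.exp ((-(Complex.I * (t : ℂ))) • M)) t := by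
    have := (hasDerivAt_exp_smul_const' (𝕂 := ℂ) (-Complex.I • M) (t : ℂ)).scomp t
      Complex.ofRealCLM.hasDerivAt
    simp only [Complex.ofRealCLM_apply, Complex.ofReal_one, one_smul] at this
    have e : (fun t : ℝ => NormedSpace.exp ((-(Complex.I * (t : ℂ))) • M)) =
        (fun u : ℂ => NormedSpace.exp (u • -Complex.I • M)) ∘ (fun t : ℝ => (t : ℂ)) := by
      funext t; simp [smul_smul, mul_comm]
    rw [e]
    refine HasDerivAt.congr_deriv this ?_
    rw [smul_smul, mul_neg, mul_comm]
  let Φ : Matrix V V ℂ →ₗ[ℂ] FockOp V :=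
    { toFun := fun X => ∑ j, X i j • annihilation j
      map_add' := fun X Y => by simp [add_smul, Finset.sum_add_distrib]
      map_smul' := fun z X => by simp [Finset.smul_sum, smul_smul] }
  have h3 := ((LinearMap.toContinuousLinearMap Φ).restrictScalars ℝ).hasFDerivAt.comp_hasDerivAt t h2
  refine HasDerivAt.congr_deriv (f := fun t => freeMode M t i) h3 ?_
  change ∑ j, ((-Complex.I • M) * NormedSpace.exp ((-(Complex.I * (t : ℂ))) • M)) i j • annihilation j = _
  simp only [freeMode, Finset.smul_sum, Matrix.mul_apply, Finset.sum_smul, Matrix.smul_apply, smul_eq_mul,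
    smul_smul]
  rw [Finset.sum_comm]
  refine Finset.sum_congr rfl fun j _ => Finset.sum_congr rfl fun k _ => ?_
  rw [mul_assoc]

lemma freeMode_zero (M : Matrix V V ℂ) (i : V) : freeMode M 0 i = annihilation i := by
  rw [freeMode, Finset.sum_eq_single i]
  · simp
  · intro j _ hj
    simp [hj.symm]
  · simp

variable {d : V → V → ℕ} {n : ℕ} {M : Matrix V V ℂ} {h : Fin n → FockOp V} {S : Fin n → Finset V}
  {l r : ℕ} {m s : ℝ}

/-- The differences for all modes satisfy a linear system with matrix `M`, of row sums at most `l
m`, and a source of size at most `2 l |ε|`. In the supremum norm over modes Gronwall gives a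
size-independent bound, with `2 l / (l m) = 2/m`. -/
lemma IsLocalModel.norm_heisTime_sub_freeMode_le (hm : IsLocalModel d M h S l r m s) (hm0 : 0 < m)
    (hl : 0 < l) (ε : ℝ) (i : V) (t : ℝ) :
    ‖heisTime (hamiltonian M h ε) t (annihilation i) - freeMode M t i‖ ≤
      |ε| * (2 / m * Real.exp (l * m * |t|)) := by
  set H := hamiltonian M h ε with hH
  have hHh : H.IsHermitian := hm.hamiltonian_isHermitian ε
  obtain ⟨sg, hsg, hsgt⟩ : ∃ sg : ℝ, |sg| = 1 ∧ sg * |t| = t := by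
    rcases le_total 0 t with h0 | h0
    · exact ⟨1, by simp, by rw [abs_of_nonneg h0]; ring⟩
    · exact ⟨-1, by simp, by rw [abs_of_nonpos h0]; ring⟩
  have hlad : ∀ i, (ladder (i, false) : FockOp V) = annihilation i := fun i => by simp [ladder]
  let e : ℝ → V → FockOp V := fun u i => heisTime H (sg * u) (ladder (i, false)) - freeMode M (sg * u) i
  let e' : ℝ → V → FockOp V := fun u i =>
    sg • (heisTime H (sg * u) (Complex.I • (H * ladder (i, false) - ladder (i, false) * H)) -
      (-Complex.I • ∑ j, M i j • freeMode M (sg * u) j))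
  have hder : ∀ u, HasDerivAt e (e' u) u := by
    intro u
    refine hasDerivAt_pi.mpr fun i => ?_
    have e1 := (hasDerivAt_heisTime H (ladder (i, false)) (sg * u)).scomp u ((hasDerivAt_id u).const_mul sg)
    have e2 := (hasDerivAt_freeMode M (sg * u) i).scomp u ((hasDerivAt_id u).const_mul sg)
    refine HasDerivAt.congr_deriv (f := fun u => e u i) (e1.fun_sub e2) ?_
    simp only [e', mul_one, smul_sub]
  have hbound : ∀ u, ‖e' u‖ ≤ l * m * ‖e u‖ + |ε| * (2 * l) := by
    intro u
    refine (pi_norm_le_iff_of_nonneg (by positivity)).mpr fun i => ?_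
    have e1 : e' u i = (sg • Complex.I) • (∑ j, hopCoeff M (i, false) j • e u j +
        (ε : ℂ) • ∑ j, heisTime H (sg * u) (h j * ladder (i, false) - ladder (i, false) * h j)) := by
      simp only [e', e]
      rw [hH, commutator_hamiltonian, ← hH]
      rw [heisTime_smul, heisTime_add, heisTime_sum, heisTime_smul, heisTime_sum]
      simp only [heisTime_smul]
      simp only [smul_add, smul_sub, hopCoeff, Bool.false_eq_true, if_false, smul_assoc, neg_smul, Finset.sum_neg_distrib,
        Finset.sum_sub_distrib, smul_neg]
      abel
    rw [e1, norm_smul]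
    have e3 : ‖sg • Complex.I‖ = 1 := by simp [hsg]
    rw [e3, one_mul]
    refine (norm_add_le _ _).trans (add_le_add ?_ ?_)
    · refine (norm_sum_le _ _).trans ?_
      simp only [norm_smul]
      refine (hm.sum_hopCoeff_le hm0.le (i, false) (fun j => ‖e u j‖) (norm_nonneg (e u))
        (fun j _ => norm_le_pi_norm (e u) j) (fun _ => norm_nonneg _)).trans (le_of_eq (by ring))
    · rw [norm_smul, Complex.norm_real, Real.norm_eq_abs]
      refine mul_le_mul_of_nonneg_left ?_ (abs_nonneg ε)
      refine (norm_sum_le _ _).trans ?_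
      refine (hm.sum_perturbation_le (i, false) (fun X => ‖heisTime H (sg * u) X‖)
        (by simp [heisTime]) (G := 2) (by norm_num) fun j _ => ?_).trans (le_of_eq (by ring))
      refine (norm_heisTime_le hHh _ _).trans ?_
      have f1 := hm.norm_le j
      have f2 := norm_commutator_ladder_le (i, false) (h j)
      rw [norm_sub_rev] at f2
      linarith
  have hgron := norm_le_gronwallBound_of_norm_deriv_right_le (f := e) (f' := e') (δ := 0)
    (K := l * m) (ε := |ε| * (2 * l)) (a := 0) (b := |t|)
    (fun u _ => (hder u).continuousAt.continuousWithinAt)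
    (fun u _ => (hder u).hasDerivWithinAt) (by
      rw [norm_le_zero_iff]
      funext i
      simp [e, heisTime_zero, freeMode_zero, hlad]) (fun u _ => hbound u) |t|
    ⟨abs_nonneg t, le_rfl⟩
  have hl' : (0 : ℝ) < l := by exact_mod_cast hl
  rw [gronwallBound_of_K_ne_0 (by positivity), sub_zero] at hgron
  have hfin := (norm_le_pi_norm (e |t|) i).trans hgron
  have hee : e |t| i = heisTime H t (annihilation i) - freeMode M t i := by
    simp only [e, hsgt, hlad]
  rw [hee] at hfin
  refine hfin.trans ?_
  have h1 : |ε| * (2 * l) / (l * m) = |ε| * (2 / m) := by field_simp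
  simp only [h1, zero_mul, zero_add, mul_assoc]
  have := abs_nonneg ε
  gcongr
  linarith

/-- The case `ε = 0` of the comparison: the explicit mode formula solves the free Heisenberg
equation. -/
lemma IsLocalModel.freeMode_eq (hm : IsLocalModel d M h S l r m s) (hm0 : 0 < m) (hl : 0 < l)
    (i : V) (t : ℝ) : freeMode M t i = heisTime (hamiltonian M h 0) t (annihilation i) := by
  have := hm.norm_heisTime_sub_freeMode_le hm0 hl 0 i t
  rw [abs_zero, zero_mul, norm_le_zero_iff, sub_eq_zero] at this
  exact this.symm

lemma norm_annihilation_le (i : V) : ‖(annihilation i : FockOp V)‖ ≤ 1 := by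
  have := norm_ladder_le (i, false)
  simpa [ladder] using this

/-- The distance of the interacting and the free evolution of a mode. -/
lemma IsLocalModel.norm_heisTime_sub_freeMode_le_min (hm : IsLocalModel d M h S l r m s) (hm0 : 0 < m)
    (hl : 0 < l) (ε : ℝ) (i : V) (t : ℝ) :
    ‖heisTime (hamiltonian M h ε) t (annihilation i) - freeMode M t i‖ ≤
      min 2 (|ε| * (2 / m * Real.exp (l * m * |t|))) := by
  refine le_min ?_ (hm.norm_heisTime_sub_freeMode_le hm0 hl ε i t)
  rw [hm.freeMode_eq hm0 hl]
  have e1 := norm_heisTime_le (hm.hamiltonian_isHermitian ε) t (annihilation i)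
  have e2 := norm_heisTime_le (hm.hamiltonian_isHermitian 0) t (annihilation i)
  have e3 := norm_annihilation_le i
  refine (norm_sub_le _ _).trans ?_
  linarith

end FreeComparison

open MeasureTheory Filter Topology

/-! ### Integrability of the filter envelope -/

section Envelope

lemma integrable_comp_abs {g : ℝ → ℝ} (hg : IntegrableOn g (Set.Ioi 0)) :
    Integrable fun t : ℝ => g |t| := by
  have h1 : IntegrableOn (fun t : ℝ => g |t|) (Set.Ioi 0) :=
    hg.congr_fun (fun t ht => by rw [abs_of_pos ht]) measurableSet_Ioi
  have h2 : IntegrableOn (fun t : ℝ => g |t|) (Set.Iic 0) := by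
    rw [← Measure.map_neg_eq_self (volume : Measure ℝ)]
    let m : MeasurableEmbedding fun x : ℝ => -x := (Homeomorph.neg ℝ).measurableEmbedding
    rw [m.integrableOn_map_iff]
    simp_rw [Function.comp_def, abs_neg, Set.neg_preimage, Set.neg_Iic, neg_zero]
    exact Iff.mpr integrableOn_Ici_iff_integrableOn_Ioi h1
  rw [← integrableOn_univ, ← Set.Iic_union_Ioi (a := (0 : ℝ))]
  exact h2.union h1

/-- The envelope `C₁ μ exp(-C₂ |t/Δ|^{1/α})` of the filter function. -/
def envelope (C₁ C₂ α Δ μ : ℝ) (t : ℝ) : ℝ := C₁ * μ * Real.exp (-C₂ * |t / Δ| ^ (1 / α))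

lemma integrable_envelope {C₁ C₂ α Δ μ : ℝ} (hC₂ : 0 < C₂) (hα : 0 < α) (hΔ : 0 < Δ) (q : ℕ) :
    Integrable fun t : ℝ => envelope C₁ C₂ α Δ μ t * (1 + |t|) ^ q := by
  have hp : 0 < 1 / α := by positivity
  have hb : 0 < C₂ * (Δ ^ (1 / α))⁻¹ := by
    have := Real.rpow_pos_of_pos hΔ (1 / α)
    positivity
  have h0 := integrableOn_rpow_mul_exp_neg_mul_rpow (s := 0) (by norm_num) hp hb
  have hq := integrableOn_rpow_mul_exp_neg_mul_rpow (s := q)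
    (by have : (0 : ℝ) ≤ q := Nat.cast_nonneg q
        linarith) hp hb
  have h1 := (integrable_comp_abs (h0.add hq)).const_mul (|C₁ * μ| * 2 ^ (q - 1))
  have hmeas : AEStronglyMeasurable (fun t : ℝ => envelope C₁ C₂ α Δ μ t * (1 + |t|) ^ q) volume := by
    unfold envelope
    exact Measurable.aestronglyMeasurable (by fun_prop)
  refine h1.mono' hmeas (Filter.Eventually.of_forall fun t => ?_)
  have e1 : Real.exp (-C₂ * |t / Δ| ^ (1 / α)) =
      Real.exp (-(C₂ * (Δ ^ (1 / α))⁻¹) * |t| ^ (1 / α)) := by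
    rw [abs_div, abs_of_pos hΔ, Real.div_rpow (abs_nonneg t) hΔ.le]
    congr 1; ring
  simp only [Pi.add_apply, Real.rpow_zero, Real.rpow_natCast]
  rw [Real.norm_eq_abs, envelope, e1, abs_mul, abs_mul, abs_of_pos (Real.exp_pos _),
    abs_of_nonneg (show 0 ≤ (1 + |t|) ^ q by positivity)]
  set E := Real.exp (-(C₂ * (Δ ^ (1 / α))⁻¹) * |t| ^ (1 / α)) with hE
  have hE0 : 0 < E := Real.exp_pos _
  have e2 := add_pow_le (zero_le_one (α := ℝ)) (abs_nonneg t) q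
  calc |C₁ * μ| * E * (1 + |t|) ^ q ≤ |C₁ * μ| * E * (2 ^ (q - 1) * (1 ^ q + |t| ^ q)) := by gcongr
    _ = _ := by rw [one_pow]; ring

end Envelope

/-! ### Polynomial form of the Lieb-Robinson bound -/

section PolynomialBound

/-- The constant in the polynomial form of the Lieb-Robinson bound. -/
def lrConst (v : ℝ) (q : ℕ) : ℝ := 2 * (1 + 2 * v) ^ q + q.factorial * 2 ^ q * Real.exp 1

lemma lrConst_nonneg {v : ℝ} (hv : 0 ≤ v) (q : ℕ) : 0 ≤ lrConst v q := by
  rw [lrConst]; positivity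

/-- Inside the light cone `d ≤ 2v|t|` the trivial bound `2` suffices, since there `1 + d ≲ 1 + |t|`.
Outside it the exponential is at most `e^{-d/2}`. The growth in time is only polynomial, hence
integrable against a stretched exponential. -/
lemma le_lrConst_mul {v x t : ℝ} {d : ℕ} (hv : 0 ≤ v) (q : ℕ) (h1 : x ≤ 2)
    (h2 : x ≤ Real.exp (v * |t| - d)) :
    x ≤ lrConst v q * (1 + |t|) ^ q * ((1 + d : ℝ) ^ q)⁻¹ := by
  have ht := abs_nonneg t
  have hd : (0 : ℝ) ≤ d := Nat.cast_nonneg d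
  have hd1 : (0 : ℝ) < (1 + d : ℝ) ^ q := by positivity
  rw [← div_eq_mul_inv, le_div_iff₀ hd1]
  have hT : (1 : ℝ) ≤ (1 + |t|) ^ q := one_le_pow₀ (by linarith)
  have hA : 0 ≤ (1 + 2 * v) ^ q := by positivity
  have hB : 0 ≤ q.factorial * 2 ^ q * Real.exp 1 := by positivity
  by_cases hc : (d : ℝ) ≤ 2 * v * |t|
  · have e1 : (1 + d : ℝ) ^ q ≤ ((1 + 2 * v) * (1 + |t|)) ^ q := by
      refine pow_le_pow_left₀ (by positivity) ?_ q
      nlinarith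
    rw [mul_pow] at e1
    calc x * (1 + d : ℝ) ^ q ≤ 2 * (1 + d : ℝ) ^ q := by gcongr
      _ ≤ 2 * ((1 + 2 * v) ^ q * (1 + |t|) ^ q) := by gcongr
      _ ≤ _ := by
        rw [lrConst]
        nlinarith
  · push Not at hc
    have e1 : x ≤ Real.exp (-(d / 2)) := h2.trans (Real.exp_le_exp.mpr (by linarith))
    have e2 := Real.pow_div_factorial_le_exp ((1 + d : ℝ) / 2) (by positivity) q
    rw [div_le_iff₀ (by positivity), div_pow, div_le_iff₀ (by positivity)] at e2
    have e3 : Real.exp (-(d / 2 : ℝ)) * Real.exp ((1 + d : ℝ) / 2) ≤ Real.exp 1 := by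
      rw [← Real.exp_add]
      exact Real.exp_le_exp.mpr (by linarith)
    calc x * (1 + d : ℝ) ^ q ≤ Real.exp (-(d / 2)) * (Real.exp ((1 + d : ℝ) / 2) * q.factorial * 2 ^ q) := by
          gcongr
      _ = (Real.exp (-(d / 2 : ℝ)) * Real.exp ((1 + d : ℝ) / 2)) * (q.factorial * 2 ^ q) := by ring
      _ ≤ Real.exp 1 * (q.factorial * 2 ^ q) := by gcongr
      _ = q.factorial * 2 ^ q * Real.exp 1 := by ring
      _ ≤ (q.factorial * 2 ^ q * Real.exp 1) * (1 + |t|) ^ q := le_mul_of_one_le_right hB hT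
      _ ≤ _ := by
        rw [lrConst]
        have : 0 ≤ 2 * (1 + 2 * v) ^ q * (1 + |t|) ^ q := by positivity
        linarith

end PolynomialBound

/-! ### The filter in the energy eigenbasis -/

section Filter

lemma exp_conj_diagonal {n : Type*} [Fintype n] [DecidableEq n] {U : Matrix n n ℂ}
    (h2 : U * star U = 1) (v : n → ℂ) (z : ℂ) :
    NormedSpace.exp (z • (U * Matrix.diagonal v * star U)) =
      U * Matrix.diagonal (fun k => Complex.exp (z * v k)) * star U := by
  have hinv : U⁻¹ = star U := Matrix.inv_eq_right_inv h2
  have hU : IsUnit U := (Matrix.isUnit_iff_isUnit_det _).mpr (Matrix.isUnit_det_of_right_inverse h2)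
  have h3 : z • (U * Matrix.diagonal v * star U) = U * Matrix.diagonal (fun k => z * v k) * U⁻¹ := by
    rw [hinv, ← smul_mul_assoc, ← mul_smul_comm, ← Matrix.diagonal_smul]
    rfl
  rw [h3, Matrix.exp_conj _ _ hU, hinv, Matrix.exp_diagonal]
  congr 3
  funext k
  rw [Pi.coe_exp, Complex.exp_eq_exp_ℂ]

variable {f : ℝ → ℂ} {F : ℝ → ℝ}

lemma integrable_smul_of_bounded {E : Type*} [NormedAddCommGroup E] [NormedSpace ℂ E]
    (hf : Integrable f) {G : ℝ → E} (hG : Continuous G) {c : ℝ} (hc : ∀ t, ‖G t‖ ≤ c) :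
    Integrable fun t => f t • G t := by
  refine (hf.norm.mul_const c).mono' (hf.aestronglyMeasurable.smul hG.aestronglyMeasurable)
    (Filter.Eventually.of_forall fun t => ?_)
  rw [norm_smul]
  exact mul_le_mul_of_nonneg_left (hc t) (norm_nonneg _)

lemma integrable_mul_exp (hf : Integrable f) (ν : ℝ) :
    Integrable fun t : ℝ => f t * Complex.exp (Complex.I * (ν : ℂ) * (t : ℂ)) := by
  refine integrable_smul_of_bounded (c := 1) hf (by fun_prop) fun t => le_of_eq ?_
  rw [mul_assoc, mul_comm, ← Complex.ofReal_mul, Complex.norm_exp_ofReal_mul_I]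

lemma continuous_filterHat (hf : Integrable f) : Continuous (filterHat f) := by
  refine continuous_of_dominated (bound := fun t => ‖f t‖)
    (fun ν => (integrable_mul_exp hf ν).aestronglyMeasurable)
    (fun ν => Filter.Eventually.of_forall fun t => le_of_eq ?_) hf.norm
    (Filter.Eventually.of_forall fun t => by fun_prop)
  rw [norm_mul, mul_assoc, mul_comm Complex.I, ← Complex.ofReal_mul, Complex.norm_exp_ofReal_mul_I,
    mul_one]

/-- Continuity adds the frequency `0`, which occurs for transitions within the ground space. -/
lemma filterHat_eq_zero (hf : Integrable f) (h : ∀ ν : ℝ, 0 < ν → filterHat f ν = 0) {ν : ℝ}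
    (hν : 0 ≤ ν) : filterHat f ν = 0 := by
  have h1 : Set.EqOn (filterHat f) (fun _ => 0) (closure (Set.Ioi 0)) :=
    Set.EqOn.closure (fun ν hν => h ν hν) (continuous_filterHat hf) continuous_const
  rw [closure_Ioi] at h1
  exact h1 hν

/-- The filter acts on a conjugated diagonal evolution by its Fourier transform. -/
lemma integral_conj_diagonal {n : Type*} [Fintype n] [DecidableEq n] (hf : Integrable f)
    (U W : Matrix n n ℂ) (ν : n → ℝ) (i j : n) :
    ∫ t : ℝ, f t * (U * Matrix.diagonal (fun k => Complex.exp (Complex.I * (ν k : ℂ) * (t : ℂ))) * W) i j =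
      (U * Matrix.diagonal (fun k => filterHat f (ν k)) * W) i j := by
  have h1 : ∀ v : n → ℂ, (U * Matrix.diagonal v * W) i j = ∑ k, v k * (U i k * W k j) := by
    intro v
    rw [Matrix.mul_apply]
    refine Finset.sum_congr rfl fun k _ => ?_
    rw [Matrix.mul_diagonal]; ring
  simp only [h1, Finset.mul_sum, ← mul_assoc]
  rw [integral_finsetSum _ fun k _ => (((integrable_mul_exp hf (ν k)).mul_const _).mul_const _)]
  refine Finset.sum_congr rfl fun k _ => ?_
  rw [integral_mul_const, integral_mul_const]
  rfl

end Filter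

section Exponentials

variable {n : Type*} [Fintype n] [DecidableEq n]

lemma norm_exp_smul_le {H : Matrix n n ℂ} (hH : H.IsHermitian) (t : ℝ) :
    ‖NormedSpace.exp ((Complex.I * (t : ℂ)) • H)‖ ≤ 1 := by
  refine norm_le_one_of_star_mul_self ?_
  rw [star_exp_smul hH, exp_neg_mul_exp_smul]

lemma continuous_exp_smul (H : Matrix n n ℂ) (c : ℝ) :
    Continuous fun t : ℝ => NormedSpace.exp ((Complex.I * ((c * t : ℝ) : ℂ)) • H) := by
  have h1 : Continuous fun t : ℝ => (Complex.I * ((c * t : ℝ) : ℂ)) • H := by fun_prop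
  let _ : NormedAlgebra ℚ (Matrix n n ℂ) := NormedAlgebra.restrictScalars ℚ ℂ _
  exact NormedSpace.exp_continuous.comp h1

variable {f : ℝ → ℂ}

lemma integrable_exp_entry (hf : Integrable f) {H : Matrix n n ℂ} (hH : H.IsHermitian) (c : ℝ) (i j : n) :
    Integrable fun t : ℝ => f t * NormedSpace.exp ((Complex.I * ((c * t : ℝ) : ℂ)) • H) i j :=
  integrable_smul_of_bounded hf ((continuous_exp_smul H c).matrix_elem i j) fun t =>
    (norm_apply_le _ i j).trans (norm_exp_smul_le hH (c * t))

lemma integral_exp_entry (hf : Integrable f) {H : Matrix n n ℂ} (hH : H.IsHermitian) (c : ℝ) {z : ℂ}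
    (hz : ∀ k, filterHat f (c * hH.eigenvalues k) = z) (i j : n) :
    ∫ t : ℝ, f t * NormedSpace.exp ((Complex.I * ((c * t : ℝ) : ℂ)) • H) i j = (z • (1 : Matrix n n ℂ)) i j := by
  obtain ⟨U, h1, h2, h3⟩ := exists_diagonalization hH
  have h4 := integral_conj_diagonal hf U (star U) (fun k => c * hH.eigenvalues k) i j
  simp only [hz] at h4
  have h5 : U * Matrix.diagonal (fun _ => z) * star U = z • (1 : Matrix n n ℂ) := by
    rw [← Matrix.smul_one_eq_diagonal, mul_smul_comm, mul_one, smul_mul_assoc, h2]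
  rw [h5] at h4
  rw [← h4]
  congr 1
  funext t
  conv_lhs => rw [h3]
  rw [exp_conj_diagonal h2]
  have h6 : ∀ k, Complex.I * ((c * t : ℝ) : ℂ) * (hH.eigenvalues k : ℂ) =
      Complex.I * ((c * hH.eigenvalues k : ℝ) : ℂ) * (t : ℂ) := fun k => by push_cast; ring
  simp only [h6]

lemma eigenvalue_mem_Icc {M : Matrix n n ℂ} {Δ : ℝ} (hM : M.IsHermitian)
    (hpos : (M - (Δ : ℂ) • (1 : Matrix n n ℂ)).PosSemidef) (k : n) :
    hM.eigenvalues k ∈ Set.Icc Δ ‖M‖ := by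
  obtain ⟨U, h1, h2, h3⟩ := exists_diagonalization hM
  have h4 : star U * M * U = Matrix.diagonal (fun i => (hM.eigenvalues i : ℂ)) := by
    conv_lhs => rw [h3]
    calc _ = (star U * U) * Matrix.diagonal (fun i => (hM.eigenvalues i : ℂ)) * (star U * U) := by
          noncomm_ring
      _ = _ := by rw [h1, one_mul, mul_one]
  constructor
  · have h5 := hpos.conjTranspose_mul_mul_same U
    have h6 : Uᴴ * (M - (Δ : ℂ) • 1) * U = Matrix.diagonal (fun i => ((hM.eigenvalues i - Δ : ℝ) : ℂ)) := by
      rw [← Matrix.star_eq_conjTranspose, mul_sub, sub_mul, h4, mul_smul_comm, mul_one, smul_mul_assoc,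
        h1, Matrix.smul_one_eq_diagonal, Matrix.diagonal_sub]
      push_cast
      rfl
    rw [h6, Matrix.posSemidef_diagonal_iff] at h5
    have h7 : (0 : ℝ) ≤ hM.eigenvalues k - Δ := by exact_mod_cast h5 k
    linarith
  · have h5 := norm_unitary_conj_le h1 M
    rw [h4, Matrix.l2_opNorm_diagonal] at h5
    have h6 := norm_le_pi_norm (fun i => (hM.eigenvalues i : ℂ)) k
    rw [Complex.norm_real, Real.norm_eq_abs] at h6
    exact (le_abs_self _).trans (h6.trans h5)

end Exponentials

/-! ### Jump operators: parity, ground state and free case -/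

section Jump

variable {V : Type} [LinearOrder V] [Fintype V] {f : ℝ → ℂ} {F : ℝ → ℝ}

lemma integrable_jump (hf : Integrable f) {H : FockOp V} (hH : H.IsHermitian) (A : FockOp V) :
    Integrable fun t => f t • heisTime H t A :=
  integrable_smul_of_bounded hf (continuous_heisTime H A) (norm_heisTime_le hH · A)

lemma clm_jumpOp {E : Type*} [NormedAddCommGroup E] [NormedSpace ℂ E] [CompleteSpace E]
    (hf : Integrable f) {H : FockOp V} (hH : H.IsHermitian) (A : FockOp V) (Φ : FockOp V →L[ℂ] E) :
    Φ (jumpOp f H A) = ∫ t, f t • Φ (heisTime H t A) := by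
  have h := Φ.integral_comp_comm (integrable_jump hf hH A)
  simp only [map_smul] at h
  exact h.symm

/-- The moment `∫ F(t) (1 + |t|)^q dt`. -/
def moment (F : ℝ → ℝ) (q : ℕ) : ℝ := ∫ t : ℝ, F t * (1 + |t|) ^ q

lemma norm_clm_jumpOp_le {E : Type*} [NormedAddCommGroup E] [NormedSpace ℂ E] [CompleteSpace E]
    (hf : Integrable f) (hF : ∀ t, ‖f t‖ ≤ F t) {q : ℕ}
    (hFq : Integrable fun t : ℝ => F t * (1 + |t|) ^ q) {H : FockOp V} (hH : H.IsHermitian)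
    (A : FockOp V) (Φ : FockOp V →L[ℂ] E) {c : ℝ}
    (hc : ∀ t, ‖Φ (heisTime H t A)‖ ≤ c * (1 + |t|) ^ q) :
    ‖Φ (jumpOp f H A)‖ ≤ c * moment F q := by
  rw [clm_jumpOp hf hH, moment, ← integral_const_mul]
  refine norm_integral_le_of_norm_le (hFq.const_mul c) (Filter.Eventually.of_forall fun t => ?_)
  rw [norm_smul]
  calc _ ≤ F t * (c * (1 + |t|) ^ q) :=
        mul_le_mul (hF t) (hc t) (norm_nonneg _) ((norm_nonneg _).trans (hF t))
    _ = _ := by ring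

/-- `X ↦ B X + X B`. -/
def acommCLM (B : FockOp V) : FockOp V →L[ℂ] FockOp V :=
  LinearMap.toContinuousLinearMap (LinearMap.mulLeft ℂ B + LinearMap.mulRight ℂ B)

lemma acommCLM_apply (B X : FockOp V) : acommCLM B X = B * X + X * B := rfl

lemma jumpOp_odd (hf : Integrable f) {H A : FockOp V} (hH : H.IsHermitian)
    (hHp : parity * H = H * parity) (hA : parity * A = -(A * parity)) :
    parity * jumpOp f H A = -(jumpOp f H A * parity) := by
  rw [eq_neg_iff_add_eq_zero, ← acommCLM_apply, clm_jumpOp hf hH]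
  have h1 : ∀ z : ℂ, Commute (parity : FockOp V) (NormedSpace.exp (z • H)) := fun z =>
    Commute.exp_right (Commute.smul_right hHp z)
  have h2 : ∀ t, acommCLM parity (heisTime H t A) = 0 := by
    intro t
    rw [acommCLM_apply, heisTime]
    have e1 := (h1 (Complex.I * (t : ℂ))).eq
    have e2 := (h1 (-(Complex.I * (t : ℂ)))).eq
    calc _ = (parity * NormedSpace.exp ((Complex.I * (t : ℂ)) • H)) * A *
          NormedSpace.exp ((-(Complex.I * (t : ℂ))) • H) +
          NormedSpace.exp ((Complex.I * (t : ℂ)) • H) * A *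
          (NormedSpace.exp ((-(Complex.I * (t : ℂ))) • H) * parity) := by noncomm_ring
      _ = NormedSpace.exp ((Complex.I * (t : ℂ)) • H) * (parity * A + A * parity) *
          NormedSpace.exp ((-(Complex.I * (t : ℂ))) • H) := by rw [e1, ← e2]; noncomm_ring
      _ = 0 := by rw [hA]; simp
  simp [h2]

/-- The jump operators annihilate the ground state. -/
lemma jumpOp_mulVec_groundState (hf : Integrable f) (h0 : ∀ ν : ℝ, 0 ≤ ν → filterHat f ν = 0)
    {H : FockOp V} (hH : H.IsHermitian) {ψ : Finset V → ℂ} (hψ : IsGroundState H ψ) (A : FockOp V) :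
    jumpOp f H A *ᵥ ψ = 0 := by
  obtain ⟨-, E, hE, hpos⟩ := hψ
  obtain ⟨U, h1, h2, h3⟩ := exists_diagonalization hH
  have hge := fun k => (eigenvalue_mem_Icc hH hpos k).1
  have hexp : ∀ z : ℂ, NormedSpace.exp (z • H) *ᵥ ψ = Complex.exp (z * E) • ψ := by
    intro z
    have e1 : ∀ k, (hH.eigenvalues k : ℂ) * (star U *ᵥ ψ) k = (E : ℂ) * (star U *ᵥ ψ) k := by
      intro k
      have e2 : star U *ᵥ (H *ᵥ ψ) = Matrix.diagonal (fun i => (hH.eigenvalues i : ℂ)) *ᵥ (star U *ᵥ ψ) := by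
        conv_lhs => rw [h3]
        rw [Matrix.mulVec_mulVec, Matrix.mulVec_mulVec]
        congr 1
        rw [← mul_assoc, ← mul_assoc, h1, one_mul]
      rw [hE, Matrix.mulVec_smul] at e2
      have e3 := congrFun e2 k
      rw [Matrix.mulVec_diagonal] at e3
      exact e3.symm
    have e4 : Matrix.diagonal (fun k => Complex.exp (z * (hH.eigenvalues k : ℂ))) *ᵥ (star U *ᵥ ψ) =
        Complex.exp (z * E) • (star U *ᵥ ψ) := by
      funext k
      rw [Matrix.mulVec_diagonal, Pi.smul_apply, smul_eq_mul]
      rcases eq_or_ne ((star U *ᵥ ψ) k) 0 with hk | hk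
      · rw [hk, mul_zero, mul_zero]
      · rw [mul_right_cancel₀ hk (e1 k)]
    conv_lhs => rw [h3]
    rw [exp_conj_diagonal h2, ← Matrix.mulVec_mulVec, ← Matrix.mulVec_mulVec, e4, Matrix.mulVec_smul,
      Matrix.mulVec_mulVec, h2, Matrix.one_mulVec]
  funext i
  let Φ : FockOp V →L[ℂ] ℂ := LinearMap.toContinuousLinearMap
    { toFun := fun X => (X *ᵥ ψ) i
      map_add' := fun X Y => by rw [Matrix.add_mulVec, Pi.add_apply]
      map_smul' := fun z X => by rw [Matrix.smul_mulVec, Pi.smul_apply]; rfl }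
  have hΦ : ∀ X, Φ X = (X *ᵥ ψ) i := fun _ => rfl
  rw [← hΦ, clm_jumpOp hf hH]
  -- The vector `A ψ` is stored as every column of a rank-one matrix, so that the entrywise integral
  -- formula applies; the column `∅` is an arbitrary choice.
  let W : FockOp V := star U * Matrix.vecMulVec (A *ᵥ ψ) (fun _ => 1)
  have h5 : ∀ t : ℝ, Φ (heisTime H t A) = (U * Matrix.diagonal
      (fun k => Complex.exp (Complex.I * ((hH.eigenvalues k - E : ℝ) : ℂ) * (t : ℂ))) * W) i ∅ := by
    intro t
    have e0 : U * Matrix.diagonal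
        (fun k => Complex.exp (Complex.I * ((hH.eigenvalues k - E : ℝ) : ℂ) * (t : ℂ))) * star U =
        Complex.exp (-(Complex.I * (t : ℂ)) * E) • NormedSpace.exp ((Complex.I * (t : ℂ)) • H) := by
      conv_rhs => rw [h3]
      rw [exp_conj_diagonal h2, ← smul_mul_assoc, ← mul_smul_comm, ← Matrix.diagonal_smul]
      congr 3
      funext k
      rw [Pi.smul_apply, smul_eq_mul, ← Complex.exp_add]
      congr 1
      push_cast
      ring
    rw [hΦ, heisTime, ← Matrix.mulVec_mulVec, hexp, ← mul_assoc, e0, Matrix.mul_vecMulVec,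
      Matrix.vecMulVec_apply, mul_one, Matrix.mulVec_smul, Matrix.smul_mulVec,
      Matrix.mulVec_mulVec]
  simp only [h5, smul_eq_mul]
  rw [integral_conj_diagonal hf U W (fun k => hH.eigenvalues k - E) i ∅]
  -- Out of a ground state only nonnegative energy differences occur, and there the filter vanishes.
  have h6 : (fun k => filterHat f (hH.eigenvalues k - E)) = fun _ => 0 :=
    funext fun k => h0 _ (by linarith [hge k])
  rw [h6]
  simp

lemma freeMode_eq_sum (M : Matrix V V ℂ) (t : ℝ) (i : V) :
    freeMode M t i =
      ∑ j, NormedSpace.exp ((Complex.I * ((-1 * t : ℝ) : ℂ)) • M) i j • annihilation j := by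
  rw [freeMode]
  have : -(Complex.I * (t : ℂ)) = Complex.I * ((-1 * t : ℝ) : ℂ) := by push_cast; ring
  rw [this]

lemma star_freeMode_eq_sum {M : Matrix V V ℂ} (hM : M.IsHermitian) (t : ℝ) (i : V) :
    star (freeMode M t i) =
      ∑ j, NormedSpace.exp ((Complex.I * ((1 * t : ℝ) : ℂ)) • M) j i • creation j := by
  rw [freeMode, star_sum]
  refine Finset.sum_congr rfl fun j _ => ?_
  rw [star_smul, one_mul, ← star_exp_smul hM, Matrix.star_apply, star_star]
  rfl

/-- The filter replaces `e^{-iMt}` by its transform at the frequencies `-λ`, that is by the identity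
matrix. -/
lemma integral_freeMode (hf : Integrable f) {M : Matrix V V ℂ} (hM : M.IsHermitian)
    (h1 : ∀ k, filterHat f (-1 * hM.eigenvalues k) = 1) (i : V) :
    ∫ t, f t • freeMode M t i = annihilation i := by
  simp only [freeMode_eq_sum, Finset.smul_sum, ← mul_smul]
  rw [integral_finsetSum _ fun j _ => (integrable_exp_entry hf hM (-1) i j).smul_const _]
  simp only [integral_smul_const, integral_exp_entry hf hM (-1) h1]
  rw [Finset.sum_eq_single i]
  · simp
  · intro j _ hj; simp [hj.symm]
  · simp

lemma integral_star_freeMode (hf : Integrable f) {M : Matrix V V ℂ} (hM : M.IsHermitian)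
    (h0 : ∀ k, filterHat f (1 * hM.eigenvalues k) = 0) (i : V) :
    ∫ t, f t • star (freeMode M t i) = 0 := by
  simp only [star_freeMode_eq_sum hM, Finset.smul_sum, ← mul_smul]
  rw [integral_finsetSum _ fun j _ => (integrable_exp_entry hf hM 1 j i).smul_const _]
  simp only [integral_smul_const, integral_exp_entry hf hM 1 h0]
  simp

end Jump

/-! ### Smallness of the deviation from the free jump operators -/

section Close

/-- The bound on the distance of the interacting and the free jump operators. -/
def closeBound (F : ℝ → ℝ) (l : ℕ) (m ε : ℝ) : ℝ :=
  ∫ t : ℝ, F t * min 2 (|ε| * (2 / m * Real.exp (l * m * |t|)))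

lemma integrable_closeBound {F : ℝ → ℝ} (hF : Integrable F) (hF0 : ∀ t, 0 ≤ F t) (l : ℕ) {m : ℝ}
    (hm : 0 < m) (ε : ℝ) :
    Integrable fun t : ℝ => F t * min 2 (|ε| * (2 / m * Real.exp (l * m * |t|))) := by
  have hc : Continuous fun t : ℝ => min 2 (|ε| * (2 / m * Real.exp (l * m * |t|))) := by fun_prop
  refine (hF.mul_const 2).mono' (hF.aestronglyMeasurable.mul hc.aestronglyMeasurable)
    (Eventually.of_forall fun t => ?_)
  have h1 : 0 ≤ min 2 (|ε| * (2 / m * Real.exp (l * m * |t|))) := le_min (by norm_num) (by positivity)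
  rw [Real.norm_of_nonneg (mul_nonneg (hF0 t) h1)]
  exact mul_le_mul_of_nonneg_left (min_le_left _ _) (hF0 t)

/-- Dominated convergence with majorant `2F`. The cut-off at `2` is essential, since a stretched
exponential `F` need not integrate the growth `e^{lm|t|}`. -/
lemma tendsto_closeBound {F : ℝ → ℝ} (hF : Integrable F) (hF0 : ∀ t, 0 ≤ F t) (l : ℕ) {m : ℝ}
    (hm : 0 < m) : Tendsto (closeBound F l m) (𝓝 0) (𝓝 0) := by
  have h := tendsto_integral_filter_of_dominated_convergence (l := 𝓝 (0 : ℝ))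
    (F := fun ε t => F t * min 2 (|ε| * (2 / m * Real.exp (l * m * |t|)))) (f := fun _ => 0)
    (fun t => F t * 2) (Eventually.of_forall fun ε =>
      (integrable_closeBound hF hF0 l hm ε).aestronglyMeasurable)
    (Eventually.of_forall fun ε => Eventually.of_forall fun t => by
      have h1 : 0 ≤ min 2 (|ε| * (2 / m * Real.exp (l * m * |t|))) := le_min (by norm_num) (by positivity)
      rw [Real.norm_of_nonneg (mul_nonneg (hF0 t) h1)]
      exact mul_le_mul_of_nonneg_left (min_le_left _ _) (hF0 t))
    (hF.mul_const 2)
    (Eventually.of_forall fun t => by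
      have hc : Continuous fun ε : ℝ => F t * min 2 (|ε| * (2 / m * Real.exp (l * m * |t|))) := by
        fun_prop
      have := hc.tendsto 0
      simpa using this)
  have h' : Tendsto (closeBound F l m) (𝓝 0) (𝓝 (∫ _ : ℝ, (0 : ℝ))) := h
  simpa using h'

end Close

/-! ### Quasi-locality and closeness of the jump operators -/

section JumpBounds

variable {V : Type} [LinearOrder V] [Fintype V]
  {d : V → V → ℕ} {n : ℕ} {M : Matrix V V ℂ} {h : Fin n → FockOp V} {S : Fin n → Finset V}
  {l r : ℕ} {m s ε : ℝ} {f : ℝ → ℂ} {F : ℝ → ℝ} {q : ℕ} {w : V → V → ℝ} {Z : ℝ}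

lemma velocity_nonneg (l r : ℕ) {m s : ℝ} (hm : 0 ≤ m) (hs : 0 ≤ s) : 0 ≤ velocity l r m s := by
  rw [velocity]; positivity

lemma IsLocalModel.norm_acomm_heisTime_le_pow (hm : IsLocalModel d M h S l r m s) (hm0 : 0 ≤ m)
    (hs : 0 ≤ s) (hε : |ε| ≤ 1) (hw : ∀ x y, ((1 + d x y : ℝ) ^ q)⁻¹ = w x y ^ 8) (a b : V × Bool) (t : ℝ) :
    ‖acomm b (heisTime (hamiltonian M h ε) t (ladder a))‖ ≤
      lrConst (velocity l r m s) q * (1 + |t|) ^ q * w a.1 b.1 ^ 8 := by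
  rw [← hw, hm.isDist.symm]
  refine le_lrConst_mul (velocity_nonneg l r hm0 hs) q ?_ (hm.norm_acomm_heisTime_le hm0 hs hε a b t)
  have h1 := norm_acomm_le b (heisTime (hamiltonian M h ε) t (ladder a))
  have h2 := (norm_heisTime_le (hm.hamiltonian_isHermitian ε) t (ladder a)).trans (norm_ladder_le a)
  linarith

lemma IsLocalModel.norm_acomm_jumpOp_le (hm : IsLocalModel d M h S l r m s) (hm0 : 0 ≤ m)
    (hs : 0 ≤ s) (hε : |ε| ≤ 1) (hw : ∀ x y, ((1 + d x y : ℝ) ^ q)⁻¹ = w x y ^ 8)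
    (hf : Integrable f) (hF : ∀ t, ‖f t‖ ≤ F t) (hFq : Integrable fun t : ℝ => F t * (1 + |t|) ^ q)
    (a k : V × Bool) :
    ‖acomm k (jumpOp f (hamiltonian M h ε) (ladder a))‖ ≤
      lrConst (velocity l r m s) q * moment F q * w a.1 k.1 ^ 8 := by
  have h1 := norm_clm_jumpOp_le hf hF hFq (hm.hamiltonian_isHermitian ε) (ladder a)
    (acommCLM (ladder k)) (c := lrConst (velocity l r m s) q * w a.1 k.1 ^ 8)
    (fun t => (hm.norm_acomm_heisTime_le_pow hm0 hs hε hw a k t).trans (le_of_eq (by ring)))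
  exact h1.trans (le_of_eq (by ring))

/-- The anticommutator at times `t` and `u` depends, up to unitary conjugation, only on `u - t`, and
`1 + |u - t| ≤ (1 + |u|)(1 + |t|)` lets the two filter integrals separate. -/
lemma IsLocalModel.norm_jumpGram_le (hm : IsLocalModel d M h S l r m s) (hm0 : 0 ≤ m)
    (hs : 0 ≤ s) (hε : |ε| ≤ 1) (hw : ∀ x y, ((1 + d x y : ℝ) ^ q)⁻¹ = w x y ^ 8)
    (hf : Integrable f) (hF : ∀ t, ‖f t‖ ≤ F t) (hFq : Integrable fun t : ℝ => F t * (1 + |t|) ^ q)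
    (a b : V × Bool) :
    ‖jumpGram (fun a => jumpOp f (hamiltonian M h ε) (ladder a)) a b‖ ≤
      lrConst (velocity l r m s) q * moment F q ^ 2 * w a.1 b.1 ^ 8 := by
  set H := hamiltonian M h ε with hH
  have hHh : H.IsHermitian := hm.hamiltonian_isHermitian ε
  set K : V × Bool → FockOp V := fun a => jumpOp f H (ladder a) with hK
  have hv := lrConst_nonneg (velocity_nonneg l r hm0 hs) q
  have hw0 : ∀ x y, 0 ≤ w x y ^ 8 := fun x y => by rw [← hw]; positivity
  have h1 : ∀ (u t : ℝ) (a b : V × Bool),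
      ‖heisTime H t (ladder b) * heisTime H u (ladder a) + heisTime H u (ladder a) * heisTime H t (ladder b)‖ ≤
        lrConst (velocity l r m s) q * ((1 + |u|) ^ q * (1 + |t|) ^ q) * w a.1 b.1 ^ 8 := by
    intro u t a b
    have e1 : heisTime H t (ladder b) * heisTime H u (ladder a) +
        heisTime H u (ladder a) * heisTime H t (ladder b) =
        heisTime H t (acomm b (heisTime H (-t + u) (ladder a))) := by
      rw [acomm, heisTime_add, heisTime_mul, heisTime_mul, heisTime_heisTime, add_neg_cancel_left]
    rw [e1]
    refine (norm_heisTime_le hHh _ _).trans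
      ((hm.norm_acomm_heisTime_le_pow hm0 hs hε hw a b (-t + u)).trans ?_)
    have e2 : (1 + |-t + u|) ^ q ≤ (1 + |u|) ^ q * (1 + |t|) ^ q := by
      rw [← mul_pow]
      refine pow_le_pow_left₀ (by positivity) ?_ q
      have := abs_add_le (-t) u
      rw [abs_neg] at this
      nlinarith [abs_nonneg t, abs_nonneg u]
    have := hw0 a.1 b.1
    gcongr
  have h2 : ∀ (t : ℝ) (a b : V × Bool),
      ‖heisTime H t (ladder b) * K a + K a * heisTime H t (ladder b)‖ ≤
        lrConst (velocity l r m s) q * moment F q * w a.1 b.1 ^ 8 * (1 + |t|) ^ q := by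
    intro t a b
    have := norm_clm_jumpOp_le hf hF hFq hHh (ladder a) (acommCLM (heisTime H t (ladder b)))
      (c := lrConst (velocity l r m s) q * (1 + |t|) ^ q * w a.1 b.1 ^ 8)
      (fun u => (h1 u t a b).trans (le_of_eq (by ring)))
    exact this.trans (le_of_eq (by ring))
  have h3 := norm_clm_jumpOp_le hf hF hFq hHh (ladder b) (acommCLM (star (K a)))
    (c := lrConst (velocity l r m s) q * moment F q * w a.1 b.1 ^ 8) (fun t => by
      rw [acommCLM_apply, ← norm_star, star_add, star_mul, star_mul, star_star, star_heisTime hHh,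
        star_ladder]
      exact h2 t a (flip b))
  exact h3.trans (le_of_eq (by ring))

lemma IsLocalModel.norm_jumpOp_sub_freeJump_le (hm : IsLocalModel d M h S l r m s) (hm0 : 0 < m)
    (hl : 0 < l) (hf : Integrable f) (hF : ∀ t, ‖f t‖ ≤ F t) (hFi : Integrable F)
    (h1 : ∀ k, filterHat f (-1 * hm.hermitian.eigenvalues k) = 1)
    (h0 : ∀ k, filterHat f (1 * hm.hermitian.eigenvalues k) = 0) (a : V × Bool) :
    ‖jumpOp f (hamiltonian M h ε) (ladder a) - freeJump a‖ ≤ closeBound F l m ε := by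
  set H := hamiltonian M h ε with hH
  have hHh : H.IsHermitian := hm.hamiltonian_isHermitian ε
  have hF0 : ∀ t, 0 ≤ F t := fun t => (norm_nonneg _).trans (hF t)
  have hbd : ∀ t i, ‖freeMode M t i‖ ≤ 1 := fun t i => by
    rw [hm.freeMode_eq hm0 hl]
    exact (norm_heisTime_le (hm.hamiltonian_isHermitian 0) _ _).trans (norm_annihilation_le i)
  have hcont : ∀ i, Continuous fun t => freeMode M t i := fun i =>
    continuous_iff_continuousAt.mpr fun t => (hasDerivAt_freeMode M t i).continuousAt
  obtain ⟨i, b⟩ := a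
  obtain ⟨G, hG, hGc, hGb, hGn⟩ : ∃ G : ℝ → FockOp V, ∫ t, f t • G t = freeJump (i, b) ∧ Continuous G ∧
      (∀ t, ‖G t‖ ≤ 1) ∧ ∀ t, ‖heisTime H t (ladder (i, b)) - G t‖ ≤
        min 2 (|ε| * (2 / m * Real.exp (l * m * |t|))) := by
    have key := hm.norm_heisTime_sub_freeMode_le_min hm0 hl ε i
    cases b
    · refine ⟨fun t => freeMode M t i, ?_, hcont i, fun t => hbd t i, fun t => ?_⟩
      · rw [integral_freeMode hf hm.hermitian h1]; simp [freeJump]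
      · simpa [ladder] using key t
    · refine ⟨fun t => star (freeMode M t i), ?_, (hcont i).star, fun t => ?_, fun t => ?_⟩
      · rw [integral_star_freeMode hf hm.hermitian h0]; simp [freeJump]
      · rw [norm_star]; exact hbd t i
      · have e1 : (ladder (i, true) : FockOp V) = star (annihilation i) := by
          simp [ladder, creation, Matrix.star_eq_conjTranspose]
        rw [e1, ← star_heisTime hHh, ← star_sub, norm_star]
        exact key t
  have h2 : jumpOp f H (ladder (i, b)) - freeJump (i, b) =
      ∫ t, f t • (heisTime H t (ladder (i, b)) - G t) := by
    rw [← hG]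
    simp only [smul_sub]
    rw [integral_sub (integrable_jump hf hHh _) (integrable_smul_of_bounded hf hGc hGb)]
    rfl
  rw [h2, closeBound]
  refine norm_integral_le_of_norm_le (integrable_closeBound hFi hF0 l hm0 ε)
    (Eventually.of_forall fun t => ?_)
  rw [norm_smul]
  exact mul_le_mul (hF t) (hGn t) (norm_nonneg _) (hF0 t)

lemma IsLocalModel.parity_mul_hamiltonian (hm : IsLocalModel d M h S l r m s) (ε : ℝ) :
    parity * hamiltonian M h ε = hamiltonian M h ε * parity := by
  have h1 : ∀ i j : V, (parity : FockOp V) * (creation i * annihilation j) =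
      creation i * annihilation j * parity := by
    intro i j
    have e1 := parity_mul_ladder (i, true)
    have e2 := parity_mul_ladder (j, false)
    simp only [ladder, if_true, Bool.false_eq_true, if_false] at e1 e2
    rw [← mul_assoc, e1, neg_mul, mul_assoc, e2]
    noncomm_ring
  have h2 : ∀ j, parity * h j = h j * parity := fun j => parity_mul_of_mem_evenLocal (hm.mem j)
  simp only [hamiltonian, quadraticHamiltonian, mul_add, add_mul, Finset.mul_sum, Finset.sum_mul,
    mul_smul_comm, smul_mul_assoc, h1, h2]

/-- The closeness parameter of the jump operators. -/
def closeness (F : ℝ → ℝ) (l : ℕ) (m C ε : ℝ) : ℝ := Real.sqrt (2 * closeBound F l m ε * (C + 1))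

/-- Closeness must be both small and decaying. The deviation is uniformly small by the free
comparison and decays like `w ^ 8` by Lieb-Robinson; the geometric mean of the two bounds gives
`closeness * w ^ 4`. -/
theorem IsLocalModel.jumpBounds (hm : IsLocalModel d M h S l r m s) (hm0 : 0 < m)
    (hs : 0 ≤ s) (hl : 0 < l) (hε : |ε| ≤ 1) (hw : ∀ x y, ((1 + d x y : ℝ) ^ q)⁻¹ = w x y ^ 8)
    (hwt : IsWeight d w Z)
    (hf : Integrable f) (hF : ∀ t, ‖f t‖ ≤ F t) (hFi : ∀ q, Integrable fun t : ℝ => F t * (1 + |t|) ^ q)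
    (h1 : ∀ k, filterHat f (-1 * hm.hermitian.eigenvalues k) = 1)
    (h0 : ∀ k, filterHat f (1 * hm.hermitian.eigenvalues k) = 0) :
    JumpBounds w (fun a => jumpOp f (hamiltonian M h ε) (ladder a)) (moment F 0 + 1)
      (lrConst (velocity l r m s) q * moment F q)
      (closeness F l m (lrConst (velocity l r m s) q * moment F q) ε) := by
  have hF0 : ∀ t, 0 ≤ F t := fun t => (norm_nonneg _).trans (hF t)
  have hmom : 0 ≤ moment F q := integral_nonneg fun t => by
    have := hF0 t
    positivity
  set C := lrConst (velocity l r m s) q * moment F q with hC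
  have hC0 : 0 ≤ C := mul_nonneg (lrConst_nonneg (velocity_nonneg l r hm0.le hs) q) hmom
  have hFint : Integrable F := by simpa using hFi 0
  have hdec := hm.norm_acomm_jumpOp_le hm0.le hs hε hw hf hF (hFi q)
  refine ⟨fun a => ?_, fun a => ?_, fun a k => ?_, fun a k => ?_⟩
  · exact jumpOp_odd hf (hm.hamiltonian_isHermitian ε) (hm.parity_mul_hamiltonian ε) (parity_mul_ladder a)
  · have := norm_clm_jumpOp_le hf hF (hFi 0) (hm.hamiltonian_isHermitian ε) (ladder a)
      (ContinuousLinearMap.id ℂ (FockOp V)) (c := 1) (fun t => by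
        simpa using (norm_heisTime_le (hm.hamiltonian_isHermitian ε) t (ladder a)).trans (norm_ladder_le a))
    rw [one_mul] at this
    exact this.trans (by linarith)
  · refine (hdec a k).trans ?_
    have := pow_le_pow_of_le_one (hwt.nonneg a.1 k.1) (hwt.le_one a.1 k.1) (show 4 ≤ 8 by norm_num)
    gcongr
  · set K := jumpOp f (hamiltonian M h ε) (ladder a) with hK
    set X := acomm k (K - freeJump a) with hX
    have e1 : ‖X‖ ≤ 2 * closeBound F l m ε := by
      have g1 := norm_acomm_le k (K - freeJump a)
      have g2 := hm.norm_jumpOp_sub_freeJump_le (ε := ε) hm0 hl hf hF hFint h1 h0 a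
      linarith
    have e2 : ‖acomm k (freeJump a)‖ ≤ w a.1 k.1 ^ 8 := by
      have hw0 : 0 ≤ w a.1 k.1 ^ 8 := pow_nonneg (hwt.nonneg _ _) 8
      obtain ⟨i, b⟩ := a
      cases b
      · have g1 : acomm k (freeJump (i, false)) = ladder k * ladder (i, false) + ladder (i, false) * ladder k := by
          simp [acomm, freeJump, ladder]
        rw [g1, ladder_anticomm]
        split_ifs with hk
        · have g2 : w i k.1 ^ 8 = 1 := by
            rw [hk, ← hw]
            simp [flip, hm.isDist.self]
          rw [g2]
          exact norm_one_le
        · simpa using hw0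
      · simpa [acomm, freeJump] using hw0
    have e3 : ‖X‖ ≤ (C + 1) * w a.1 k.1 ^ 8 := by
      have g1 : X = acomm k K - acomm k (freeJump a) := by
        rw [hX, acomm, acomm, acomm]; noncomm_ring
      rw [g1]
      refine (norm_sub_le _ _).trans ?_
      linarith [hdec a k]
    have hcb : 0 ≤ 2 * closeBound F l m ε := (norm_nonneg X).trans e1
    have e4 : ‖X‖ ^ 2 ≤ (2 * closeBound F l m ε * (C + 1)) * (w a.1 k.1 ^ 4) ^ 2 := by
      have := mul_le_mul e1 e3 (norm_nonneg X) hcb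
      calc ‖X‖ ^ 2 = ‖X‖ * ‖X‖ := sq _
        _ ≤ _ := this
        _ = _ := by ring
    have hw4 : 0 ≤ w a.1 k.1 ^ 4 := pow_nonneg (hwt.nonneg _ _) 4
    rw [closeness]
    calc ‖X‖ ≤ Real.sqrt ((2 * closeBound F l m ε * (C + 1)) * (w a.1 k.1 ^ 4) ^ 2) := Real.le_sqrt_of_sq_le e4
      _ = _ := by rw [Real.sqrt_mul' _ (by positivity), Real.sqrt_sq hw4]

end JumpBounds

/-! ### Choice of the threshold and the lattice model -/

section Assembly

lemma tendsto_closeness {F : ℝ → ℝ} (hF : Integrable F) (hF0 : ∀ t, 0 ≤ F t) (l : ℕ) {m : ℝ}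
    (hm : 0 < m) (C : ℝ) : Tendsto (closeness F l m C) (𝓝 0) (𝓝 0) := by
  have h1 := (((tendsto_closeBound hF hF0 l hm).const_mul 2).mul_const (C + 1)).sqrt
  have h2 : Real.sqrt (2 * 0 * (C + 1)) = 0 := by simp
  rw [h2] at h1
  exact h1

lemma exists_closeness_le {F : ℝ → ℝ} (hF : Integrable F) (hF0 : ∀ t, 0 ≤ F t) (l : ℕ) {m : ℝ}
    (hm : 0 < m) (C G : ℝ) :
    ∃ ε₁ > 0, ∀ ε : ℝ, |ε| < ε₁ → closeness F l m C ε ≤ 1 / 2 ∧ closeness F l m C ε * G ≤ 1 / 4 := by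
  have h1 := tendsto_closeness hF hF0 l hm C
  have h2 := h1.mul_const G
  rw [zero_mul] at h2
  have h3 := (h1.eventually_le_const (show (0 : ℝ) < 1 / 2 by norm_num)).and
    (h2.eventually_le_const (show (0 : ℝ) < 1 / 4 by norm_num))
  obtain ⟨ε₁, hε₁, H⟩ := Metric.eventually_nhds_iff.mp h3
  exact ⟨ε₁, hε₁, fun ε hε => H (by simpa [Real.dist_eq] using hε)⟩

lemma isLocalModel_lattice {D L n : ℕ} {periodic : Bool} {l r : ℕ} {Δ m : ℝ}
    {M : Matrix (LatticeSite D L) (LatticeSite D L) ℂ} {h : Fin n → FockOp (LatticeSite D L)}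
    {S : Fin n → Finset (LatticeSite D L)}
    (hpos : (M - (Δ : ℂ) • (1 : Matrix (LatticeSite D L) (LatticeSite D L) ℂ)).PosDef)
    (hm : ∀ i j, ‖M i j‖ ≤ m) (hM : IsLocalHopping periodic l M)
    (hherm : (∑ j, h j).IsHermitian) (hn : ∀ j, ‖h j‖ ≤ 1) (h1 : ∀ j, h j ∈ evenLocal (S j))
    (h2 : ∀ j, ∀ x ∈ S j, ∀ y ∈ S j, manhattan periodic x y ≤ r)
    (h3 : ∀ k, {j | k ∈ S j}.ncard ≤ l) :
    IsLocalModel (manhattan periodic) M h S l r m ((4 * invSqSum) ^ D * (1 + r) ^ (2 * D)) where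
  isDist := ⟨manhattan_self periodic, manhattan_comm periodic, manhattan_triangle periodic⟩
  hermitian := by
    have e1 : ((Δ : ℂ) • (1 : Matrix (LatticeSite D L) (LatticeSite D L) ℂ)).IsHermitian := by
      rw [Matrix.IsHermitian, Matrix.conjTranspose_smul, Matrix.conjTranspose_one]
      simp
    simpa using hpos.1.add e1
  entry_le := hm
  range := hM.range
  degree i := by
    refine le_trans (Set.ncard_le_ncard_of_injOn (fun j => (i, j)) ?_ ?_ (Set.toFinite _)) (hM.degree i)
    · intro j hj
      exact ⟨hj, Or.inl rfl⟩
    · intro j _ k _ hjk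
      exact (Prod.mk.inj hjk).2
  sum_hermitian := hherm
  norm_le := hn
  mem := h1
  diam := h2
  card_le j := card_le_of_diam periodic (S j) (h2 j)
  overlap := h3

end Assembly

end FermionMixing

end

/-! ### The main theorem -/

open FermionMixing in
theorem mainTheorem2 :
    ∃ (p : ℕ → ℝ) (a b : ℝ), 0 < a ∧ (∀ D : ℕ, a * D ≤ p D ∧ p D ≤ b * D) ∧
    ∀ (D : ℕ) (C₁ C₂ α : ℝ), 1 ≤ D → 0 < C₁ → 0 < C₂ → 0 < α →
    ∃ A κ : ℝ, 0 < A ∧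
    ∀ (r₀ l : ℕ) (Δ m μ : ℝ), 1 ≤ r₀ → 1 ≤ l → 0 < Δ → 0 < m → 0 < μ →
    ∃ εstar : ℝ, 0 < εstar ∧
      (let g : ℝ := (m * r₀ * l / Δ) ^ (-(p D)) * μ⁻¹
       εstar ≤ A * (g * (1 + |Real.log g|) ^ κ)) ∧
    ∃ C : ℝ, 0 < C ∧ ∀ η₀ : ℝ, 0 < η₀ → η₀ < 1 → ∃ c : ℝ, 0 < c ∧
    ∀ (periodic : Bool) (L n : ℕ) (M : Matrix (LatticeSite D L) (LatticeSite D L) ℂ)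
      (h : Fin n → FockOp (LatticeSite D L)) (f : ℝ → ℂ) (ε : ℝ), 1 ≤ L →
      (M - (Δ : ℂ) • (1 : Matrix (LatticeSite D L) (LatticeSite D L) ℂ)).PosDef →
      (∀ i j, ‖M i j‖ ≤ m) → ‖M‖ ≤ μ →
      IsLocalHopping periodic l M → IsLocalPerturbation periodic r₀ l h →
      IsFilter M Δ C₁ C₂ α f →
      |ε| < εstar →
    ∀ ψ : Finset (LatticeSite D L) → ℂ, IsGroundState (hamiltonian M h ε) ψ →
    ∀ 𝒮 : Set (FockOp (LatticeSite D L)),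
      (𝒮 = densityMatrices (LatticeSite D L) ∨ 𝒮 = evenDensityMatrices (LatticeSite D L)) →
    ∀ η : ℝ, 0 < η → η ≤ η₀ →
    ∃ τ : ℝ, IsMixingTime 𝒮 (lindbladian f (hamiltonian M h ε)) (pureState ψ) η τ ∧
      c * Real.log (((L : ℝ) + 1) ^ D / η) ≤ τ ∧
      τ ≤ C * Real.log (((L : ℝ) + 1) ^ D / η) := by
  -- The required form of `ε*` is only an upper bound, so the exponent `p(D) = D` may be chosen
  -- freely, and below `A = 1` and `κ = 0` suffice.
  refine ⟨fun D => D, 1, 1, one_pos, fun D => by simp, ?_⟩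
  intro D C₁ C₂ α hD hC₁ hC₂ hα
  refine ⟨1, 0, one_pos, ?_⟩
  intro r₀ l Δ m μ hr₀ hl hΔ hm0 hμ
  set Z : ℝ := (4 * invSqSum) ^ D with hZ
  have hZ0 : 0 ≤ Z := by have := invSqSum_nonneg; positivity
  set s : ℝ := Z * (1 + r₀) ^ (2 * D) with hs
  have hs0 : 0 ≤ s := by positivity
  -- This makes `(1 + d)^{-q}` the eighth power of the lattice weight `(1 + d)^{-2D}`. Powers are
  -- spent halving: 8 to 4 for closeness, 4 to 2 for commutators with anticommutators, 2 to 1 for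
  -- summation.
  set q : ℕ := 16 * D with hq
  set F : ℝ → ℝ := envelope C₁ C₂ α Δ μ with hF
  have hF0 : ∀ t, 0 ≤ F t := fun t => by rw [hF, envelope]; positivity
  have hFi : ∀ q : ℕ, MeasureTheory.Integrable fun t : ℝ => F t * (1 + |t|) ^ q := fun q =>
    integrable_envelope hC₂ hα hΔ q
  have hFint : MeasureTheory.Integrable F := by simpa using hFi 0
  have hmom : ∀ q, 0 ≤ moment F q := fun q => MeasureTheory.integral_nonneg fun t => by
    have := hF0 t
    positivity
  set ℓ : ℝ := lrConst (velocity l r₀ m s) q with hℓ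
  have hℓ0 : 0 ≤ ℓ := lrConst_nonneg (velocity_nonneg l r₀ hm0.le hs0) q
  have hC0 : 0 ≤ ℓ * moment F q := mul_nonneg hℓ0 (hmom q)
  have hκ0 : 0 < moment F 0 + 1 := by linarith [hmom 0]
  have hΓ0 : 0 < ℓ * moment F q ^ 2 * (2 * Z) + 1 := by
    have := hmom q
    positivity
  obtain ⟨ε₁, hε₁, hclose⟩ := exists_closeness_le hFint hF0 l hm0 (ℓ * moment F q)
    (gradConst Z (moment F 0 + 1) (ℓ * moment F q))
  set g : ℝ := (m * r₀ * l / Δ) ^ (-(D : ℝ)) * μ⁻¹ with hg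
  have hr₀' : (0 : ℝ) < r₀ := by exact_mod_cast hr₀
  have hl' : (0 : ℝ) < l := by exact_mod_cast hl
  have hg0 : 0 < g := mul_pos (Real.rpow_pos_of_pos (by positivity) _) (by positivity)
  -- `g` enforces the required upper bound, `1` serves the Lieb-Robinson estimate, and `ε₁` makes
  -- the deviation from the free jump operators small enough for gradient decay. The constant `12`
  -- is three times the inverse rate `4`.
  refine ⟨min g (min 1 ε₁), by positivity, by simp, 12, by norm_num, ?_⟩
  intro η₀ _ hη₀
  obtain ⟨c, hc, H⟩ := exists_mixingTime_bounds hZ0 hκ0 hC0 hΓ0 hη₀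
  refine ⟨c, hc, ?_⟩
  intro periodic L n M h f ε hL hpos hMm hMμ hhop hpert hfilter hε ψ hψ 𝒮 h𝒮 η hη hη1
  obtain ⟨S, hS1, hS2, hS3⟩ := hpert.isLocal
  have hmodel := isLocalModel_lattice hpos hMm hhop hpert.hermitian hpert.norm_le hS1 hS2 hS3
  have hε1 : |ε| ≤ 1 := (hε.trans_le ((min_le_right _ _).trans (min_le_left _ _))).le
  have hε2 : |ε| < ε₁ := hε.trans_le ((min_le_right _ _).trans (min_le_right _ _))
  have hfF : ∀ t, ‖f t‖ ≤ F t := fun t => (hfilter.decay t).trans (by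
    rw [hF, envelope]
    gcongr
    exact le_of_eq_of_le (by congr!) hMμ)
  have hf : MeasureTheory.Integrable f :=
    hFint.mono' hfilter.measurable (Filter.Eventually.of_forall hfF)
  have heig := eigenvalue_mem_Icc hmodel.hermitian hpos.posSemidef
  have hhat1 : ∀ k, filterHat f (-1 * hmodel.hermitian.eigenvalues k) = 1 := fun k =>
    hfilter.hat_eq_one _ ⟨by
      have h2 := (heig k).2
      have h3 : -1 * hmodel.hermitian.eigenvalues k = -hmodel.hermitian.eigenvalues k := by ring
      rw [h3]
      refine neg_le_neg ?_
      exact le_of_le_of_eq h2 (by congr!), by linarith [(heig k).1]⟩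
  have hhat0 : ∀ k, filterHat f (1 * hmodel.hermitian.eigenvalues k) = 0 := fun k =>
    hfilter.hat_eq_zero _ (by linarith [(heig k).1])
  have hw : ∀ x y : LatticeSite D L, ((1 + manhattan periodic x y : ℝ) ^ q)⁻¹ =
      latticeWeight periodic x y ^ 8 := fun x y => by
    rw [latticeWeight, inv_pow, ← pow_mul, hq]
    congr 2
    ring
  have hwt : IsWeight (manhattan periodic (D := D) (L := L)) (latticeWeight periodic) Z :=
    isWeight_latticeWeight periodic
  have hJ := hmodel.jumpBounds (ε := ε) hm0 hs0 hl hε1 hw hwt hf hfF hFi hhat1 hhat0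
  have hgram : ∀ a, ∑ b, ‖jumpGram (fun a => jumpOp f (hamiltonian M h ε) (ladder a)) a b‖ ≤
      ℓ * moment F q ^ 2 * (2 * Z) + 1 := by
    intro a
    have hc0 : 0 ≤ ℓ * moment F q ^ 2 := by positivity
    calc _ ≤ ∑ b : LatticeSite D L × Bool, ℓ * moment F q ^ 2 * latticeWeight periodic a.1 b.1 := by
          refine Finset.sum_le_sum fun b _ => ?_
          refine (hmodel.norm_jumpGram_le hm0.le hs0 hε1 hw hf hfF (hFi q) a b).trans ?_
          have := pow_le_of_le_one (hwt.nonneg a.1 b.1) (hwt.le_one a.1 b.1) (show 8 ≠ 0 by norm_num)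
          gcongr
      _ = ℓ * moment F q ^ 2 * (2 * ∑ y, latticeWeight periodic a.1 y) := by
          rw [← Finset.mul_sum, sum_prod_bool fun y => latticeWeight periodic a.1 y]
      _ ≤ ℓ * moment F q ^ 2 * (2 * Z) := by
          have := hwt.sum_le a.1
          gcongr
      _ ≤ _ := by linarith
  have hdark : ∀ a, jumpOp f (hamiltonian M h ε) (ladder a) *ᵥ ψ = 0 := fun a =>
    jumpOp_mulVec_groundState hf (fun ν hν => filterHat_eq_zero hf hfilter.hat_eq_zero hν)
      (hmodel.hamiltonian_isHermitian ε) hψ (ladder a)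
  have hcard : (Fintype.card (LatticeSite D L) : ℝ) = ((L : ℝ) + 1) ^ D := by
    rw [card_latticeSite]; push_cast; rfl
  have hcard2 : 2 ≤ Fintype.card (LatticeSite D L) := by
    rw [card_latticeSite]
    calc 2 ≤ L + 1 := by omega
      _ ≤ (L + 1) ^ D := Nat.le_self_pow (by omega) _
  have hfin := H (LatticeSite D L) (manhattan periodic) (latticeWeight periodic)
    (fun a => jumpOp f (hamiltonian M h ε) (ladder a)) _ ψ 𝒮 η hcard2 hwt hJ (Real.sqrt_nonneg _)
    (hclose ε hε2).1 (hclose ε hε2).2 hgram hψ.1 hdark h𝒮 hη hη1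
  rw [hcard] at hfin
  exact hfin
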